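/- Let $k$ be an algebraically closed field (of arbitrary characteristic), let $X$ be an integral smooth projective variety over $k$, and let $i:D\hookrightarrow X$ be an integral smooth closed subvariety of codimension $1$ which, regarded as a prime divisor on $X$ (with multiplicity $1$), is ample. For a smooth variety $Y$ over $k$ with tangent bundle $T_Y$, a $k$-morphism $g:\mathbb{P}^1_k\to Y$ is called very free if $H^1\bigl(\mathbb{P}^1_k,(g^*T_Y)(-2)\bigr)=0$, where $(-2)$ denotes the twist by $\mathcal{O}_{\mathbb{P}^1}(-2)$. Let $h:\mathbb{P}^1_k\to D$ be a non-constant $k$-morphism which is very free as a curve in $D$, i.e. $H^1\bigl(\mathbb{P}^1_k,(h^*T_D)(-2)\bigr)=0$. Then $i\circ h:\mathbb{P}^1_k\to X$ is very free as a curve in $X$, i.e. $H^1\bigl(\mathbb{P}^1_k,((i\circ h)^*T_X)(-2)\bigr)=0$. -/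

import Mathlib

open CategoryTheory AlgebraicGeometry TopologicalSpace Opposite

universe u

attribute [local instance] MvPolynomial.gradedAlgebra

noncomputable section

namespace VeryFreeCurves

/-! ### Tangent sheaf -/

section Tangent

variable {X S : Scheme.{u}} (π : X ⟶ S)

/-- Restriction of functions from `V` to a smaller open subset `W`. -/
abbrev res {V W : X.Opens} (h : W ≤ V) : Γ(X, V) →+* Γ(X, W) :=
  (X.presheaf.map (homOfLE h).op).hom

/-- Families of additive maps `D V : Γ(X, V) → Γ(X, V)`, for `V` open in `U`, that commute with
restriction, satisfy the Leibniz rule and vanish on functions pulled back from `S`: the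
`𝒪_S`-derivations of the sheaf of rings `𝒪_X|_U` into itself. -/
def tangentSections (U : X.Opens) :
    AddSubgroup (∀ V : {V : X.Opens // V ≤ U}, Γ(X, V.1) →+ Γ(X, V.1)) where
  carrier := {D |
    (∀ (V W : {V : X.Opens // V ≤ U}) (h : W.1 ≤ V.1) (a : Γ(X, V.1)),
      D W (res h a) = res h (D V a)) ∧
    (∀ (V : {V : X.Opens // V ≤ U}) (a b : Γ(X, V.1)), D V (a * b) = a * D V b + b * D V a) ∧
    (∀ (V : {V : X.Opens // V ≤ U}) (T : S.Opens) (e : V.1 ≤ π ⁻¹ᵁ T) (c : Γ(S, T)),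
      D V (π.appLE T V.1 e c) = 0)}
  zero_mem' := ⟨by simp, by simp, by simp⟩
  add_mem' := by
    rintro D E ⟨h₁, h₂, h₃⟩ ⟨h₁', h₂', h₃'⟩
    refine ⟨fun V W h a => ?_, fun V a b => ?_, fun V T e c => ?_⟩
    · simp [h₁ V W h, h₁' V W h]
    · simp [h₂, h₂']; ring
    · simp [h₃ V T e, h₃' V T e]
  neg_mem' := by
    rintro D ⟨h₁, h₂, h₃⟩
    refine ⟨fun V W h a => ?_, fun V a b => ?_, fun V T e c => ?_⟩
    · simp [h₁ V W h]
    · simp [h₂]; ring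
    · simp [h₃ V T e]

instance (U : X.Opens) : SMul Γ(X, U) (tangentSections π U) where
  smul r D := ⟨fun V => (AddMonoidHom.mulLeft (res V.2 r)).comp (D.1 V), by
    obtain ⟨D, h₁, h₂, h₃⟩ := D
    refine ⟨fun V W h a => ?_, fun V a b => ?_, fun V T e c => ?_⟩
    · have : res W.2 r = res h (res V.2 r) := by
        simp only [← CommRingCat.comp_apply, ← Functor.map_comp]; rfl
      simp [h₁ V W h, this]
    · simp [h₂]; ring
    · simp [h₃ V T e]⟩

theorem tangentSections_smul_apply (U : X.Opens) (r : Γ(X, U)) (D : tangentSections π U)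
    (V : {V : X.Opens // V ≤ U}) (a : Γ(X, V.1)) :
    (r • D).1 V a = res V.2 r * D.1 V a := rfl

instance (U : X.Opens) : Module Γ(X, U) (tangentSections π U) where
  one_smul D := by ext V a; simp [tangentSections_smul_apply]
  mul_smul r s D := by ext V a; simp [tangentSections_smul_apply, mul_assoc]
  smul_zero r := by ext V a; simp [tangentSections_smul_apply]
  smul_add r D E := by ext V a; simp [tangentSections_smul_apply, mul_add]
  add_smul r s D := by ext V a; simp [tangentSections_smul_apply, add_mul]
  zero_smul D := by ext V a; simp [tangentSections_smul_apply]

/-- Restriction of derivations to a smaller open subset. -/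
def tangentRestrict {U U' : X.Opens} (h : U' ≤ U) :
    tangentSections π U →+ tangentSections π U' where
  toFun D := ⟨fun V => D.1 ⟨V.1, V.2.trans h⟩,
    fun V W h' => D.2.1 ⟨V.1, V.2.trans h⟩ ⟨W.1, W.2.trans h⟩ h',
    fun V => D.2.2.1 ⟨V.1, V.2.trans h⟩, fun V => D.2.2.2 ⟨V.1, V.2.trans h⟩⟩
  map_zero' := rfl
  map_add' _ _ := rfl

/-- The presheaf of abelian groups `U ↦ tangentSections π U`. -/
def tangentPresheaf : X.Opensᵒᵖ ⥤ Ab.{u} where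
  obj U := .of (tangentSections π U.unop)
  map f := AddCommGrpCat.ofHom (tangentRestrict π f.unop.le)

instance (U : X.Opensᵒᵖ) : Module (X.ringCatSheaf.obj.obj U) ((tangentPresheaf π).obj U) :=
  inferInstanceAs (Module Γ(X, U.unop) (tangentSections π U.unop))

theorem res_res {V W Z : X.Opens} (h : W ≤ V) (h' : Z ≤ W) (a : Γ(X, V)) :
    res h' (res h a) = res (h'.trans h) a := by
  simp only [← CommRingCat.comp_apply, ← Functor.map_comp]; rfl

theorem eq_of_res_eq {ι : Type*} {V : X.Opens} (U : ι → X.Opens) (hV : V ≤ iSup U) (s t : Γ(X, V))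
    (h : ∀ j, res (W := V ⊓ U j) inf_le_left s = res inf_le_left t) : s = t :=
  TopCat.Sheaf.eq_of_locally_eq' X.sheaf (fun j => V ⊓ U j) V (fun _ => homOfLE inf_le_left)
    (by rw [← inf_iSup_eq]; exact le_inf le_rfl hV) s t h

theorem tangentPresheaf_isSheaf :
    TopCat.Presheaf.IsSheaf (X := X.carrier) (tangentPresheaf π) := by
  refine (TopCat.Presheaf.isSheaf_iff_isSheafUniqueGluing (X := X.carrier)
    (tangentPresheaf π)).mpr ?_
  intro ι U D hD
  change ∀ j, tangentSections π (U j) at D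
  have key : ∀ (j l : ι) (W : X.Opens) (hj : W ≤ U j) (hl : W ≤ U l) (a : Γ(X, W)),
      (D j).1 ⟨W, hj⟩ a = (D l).1 ⟨W, hl⟩ a := fun j l W hj hl a =>
    DFunLike.congr_fun (congrFun (congrArg Subtype.val (hD j l)) ⟨W, le_inf hj hl⟩) a
  have hglue : ∀ (V : {V : X.Opens // V ≤ iSup U}) (a : Γ(X, V.1)), ∃ b : Γ(X, V.1),
      ∀ j, res (W := V.1 ⊓ U j) inf_le_left b =
        (D j).1 ⟨V.1 ⊓ U j, inf_le_right⟩ (res inf_le_left a) := by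
    intro V a
    refine (TopCat.Sheaf.existsUnique_gluing' X.sheaf (fun j => V.1 ⊓ U j) V.1
      (fun _ => homOfLE inf_le_left) (by rw [← inf_iSup_eq]; exact le_inf le_rfl V.2)
      (fun j => (D j).1 ⟨V.1 ⊓ U j, inf_le_right⟩ (res inf_le_left a)) ?_).exists
    intro j l
    change res (inf_le_left (a := V.1 ⊓ U j) (b := V.1 ⊓ U l)) _ =
      res (inf_le_right (a := V.1 ⊓ U j) (b := V.1 ⊓ U l)) _
    rw [← (D j).2.1 ⟨_, inf_le_right⟩ ⟨V.1 ⊓ U j ⊓ (V.1 ⊓ U l), inf_le_left.trans inf_le_right⟩,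
      ← (D l).2.1 ⟨_, inf_le_right⟩ ⟨V.1 ⊓ U j ⊓ (V.1 ⊓ U l), inf_le_right.trans inf_le_right⟩,
      res_res, res_res]
    exact key _ _ _ _ _ _
  choose E hE using hglue
  have hEW : ∀ (V : {V : X.Opens // V ≤ iSup U}) (a : Γ(X, V.1)) (j : ι) (W : X.Opens)
      (hW : W ≤ V.1) (hj : W ≤ U j), res hW (E V a) = (D j).1 ⟨W, hj⟩ (res hW a) := by
    intro V a j W hW hj
    rw [← res_res (W := V.1 ⊓ U j) inf_le_left (le_inf hW hj), hE,
      ← (D j).2.1 ⟨_, inf_le_right⟩ ⟨W, hj⟩, res_res]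
  refine ⟨(⟨fun V => AddMonoidHom.mk' (E V) ?_, ?_, ?_, ?_⟩ : tangentSections π (iSup U)), ?_, ?_⟩
  · intro a b
    refine eq_of_res_eq U V.2 _ _ fun j => ?_
    simp only [map_add, hE]
  · intro V W h a
    refine eq_of_res_eq U W.2 _ _ fun j => ?_
    simp only [AddMonoidHom.mk'_apply]
    rw [hE, res_res, res_res, hEW V a j _ _ inf_le_right]
  · intro V a b
    refine eq_of_res_eq U V.2 _ _ fun j => ?_
    simp only [AddMonoidHom.mk'_apply, map_add, map_mul, hE]
    exact (D j).2.2.1 _ _ _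
  · intro V T e c
    refine eq_of_res_eq U V.2 _ _ fun j => ?_
    simp only [AddMonoidHom.mk'_apply, hE, map_zero]
    rw [← (D j).2.2.2 ⟨V.1 ⊓ U j, inf_le_right⟩ T (inf_le_left.trans e) c]
    congr 1
    simp only [← CommRingCat.comp_apply, Scheme.Hom.appLE_map]
  · intro j
    refine Subtype.ext (funext fun V => AddMonoidHom.ext fun a => ?_)
    have h := hEW ⟨V.1, V.2.trans (le_iSup U j)⟩ a j V.1 le_rfl V.2
    have hid : ∀ b : Γ(X, V.1), res le_rfl b = b := fun b => by
      change (X.presheaf.map (𝟙 _)) b = b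
      simp
    rw [hid, hid] at h
    exact h
  · intro F hF
    change tangentSections π (iSup U) at F
    refine Subtype.ext (funext fun V => AddMonoidHom.ext fun a => ?_)
    refine eq_of_res_eq U V.2 _ _ fun j => ?_
    simp only [AddMonoidHom.mk'_apply, hE]
    rw [← F.2.1 V ⟨V.1 ⊓ U j, inf_le_left.trans V.2⟩, ← hF j]
    rfl

/-- The relative tangent sheaf `T_{X/S} = Der_{𝒪_S}(𝒪_X, 𝒪_X)`. -/
def tangentSheaf : X.Modules where
  val := PresheafOfModules.ofPresheaf (R := X.ringCatSheaf.obj) (tangentPresheaf π) (by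
    intro U V f r D
    refine Subtype.ext (funext fun W => AddMonoidHom.ext fun a => ?_)
    exact congrArg (· * D.1 ⟨W.1, W.2.trans f.unop.le⟩ a) (res_res f.unop.le W.2 r).symm)
  isSheaf := tangentPresheaf_isSheaf π

end Tangent

/-! ### Twisting a sheaf of modules by a cocycle -/

section Twist

variable {X : Scheme.{u}}

/-- Restriction of sections of a sheaf of modules. -/
abbrev mres (M : X.Modules) {V W : X.Opens} (h : W ≤ V) : Γ(M, V) →+ Γ(M, W) :=
  (M.presheaf.map (homOfLE h).op).hom

theorem mres_smul (M : X.Modules) {V W : X.Opens} (h : W ≤ V) (r : Γ(X, V)) (x : Γ(M, V)) :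
    mres M h (r • x) = res h r • mres M h x :=
  M.map_smul _ _ _

theorem mres_mres (M : X.Modules) {V W Z : X.Opens} (h : W ≤ V) (h' : Z ≤ W) (x : Γ(M, V)) :
    mres M h' (mres M h x) = mres M (h'.trans h) x := by
  simp only [← AddCommGrpCat.comp_apply, ← Functor.map_comp]; rfl

variable {ι : Type} (c : ι → X.Opens) (g : ∀ i : ι, ι → Γ(X, c i)) (F : X.Modules)

/-- Families `sᵢ ∈ F(U ∩ cᵢ)` such that `sⱼ = gᵢⱼ sᵢ` over `U ∩ cᵢ ∩ cⱼ`. -/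
def twistSections (U : X.Opens) : AddSubgroup (∀ i : ι, Γ(F, U ⊓ c i)) where
  carrier := {s | ∀ i j : ι,
    mres F (W := U ⊓ (c i ⊓ c j)) (inf_le_inf_left U inf_le_right) (s j) =
      res (W := U ⊓ (c i ⊓ c j)) (inf_le_right.trans inf_le_left) (g i j) •
        mres F (inf_le_inf_left U inf_le_left) (s i)}
  zero_mem' i j := by
    simp only [Pi.zero_apply, map_zero, smul_zero]
  add_mem' {s t} hs ht i j := by
    simp only [Pi.add_apply, map_add, hs i j, ht i j, smul_add]
  neg_mem' {s} hs i j := by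
    simp only [Pi.neg_apply, map_neg, hs i j, smul_neg]

instance (U : X.Opens) : SMul Γ(X, U) (twistSections c g F U) where
  smul r s := ⟨fun i => res (W := U ⊓ c i) inf_le_left r • s.1 i, fun i j => by
    rw [mres_smul, mres_smul, s.2 i j, res_res, res_res, smul_comm]⟩

theorem twistSections_smul_apply (U : X.Opens) (r : Γ(X, U)) (s : twistSections c g F U) (i : ι) :
    (r • s).1 i = res (W := U ⊓ c i) inf_le_left r • s.1 i := rfl

instance (U : X.Opens) : Module Γ(X, U) (twistSections c g F U) where
  one_smul s := by ext i; simp [twistSections_smul_apply]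
  mul_smul r r' s := by ext i; simp [twistSections_smul_apply, mul_smul]
  smul_zero r := by ext i; simp [twistSections_smul_apply]
  smul_add r s t := by ext i; simp [twistSections_smul_apply]
  add_smul r r' s := by ext i; simp [twistSections_smul_apply, add_smul]
  zero_smul s := by ext i; simp [twistSections_smul_apply]

/-- Restriction of sections of the twisted sheaf. -/
def twistRestrict {U V : X.Opens} (h : V ≤ U) :
    twistSections c g F U →+ twistSections c g F V where
  toFun s := ⟨fun i => mres F (inf_le_inf_right (c i) h) (s.1 i), fun i j => by
    have := congrArg (mres F (inf_le_inf_right (c i ⊓ c j) h)) (s.2 i j)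
    rw [mres_smul, res_res, mres_mres, mres_mres] at this
    rw [mres_mres, mres_mres]
    exact this⟩
  map_zero' := by ext i; simp
  map_add' _ _ := by ext i; simp

/-- The presheaf of abelian groups `U ↦ twistSections c g F U`. -/
def twistPresheaf : X.Opensᵒᵖ ⥤ Ab.{u} where
  obj U := .of (twistSections c g F U.unop)
  map f := AddCommGrpCat.ofHom (twistRestrict c g F f.unop.le)
  map_id U := by
    refine AddCommGrpCat.hom_ext (AddMonoidHom.ext fun s => ?_)
    refine Subtype.ext (funext fun i => ?_)
    change F.presheaf.map (𝟙 _) (s.1 i) = s.1 i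
    simp
  map_comp f g := by
    refine AddCommGrpCat.hom_ext (AddMonoidHom.ext fun s => ?_)
    refine Subtype.ext (funext fun i => ?_)
    exact (mres_mres F _ _ _).symm

instance (U : X.Opensᵒᵖ) :
    Module (X.ringCatSheaf.obj.obj U) ((twistPresheaf c g F).obj U) :=
  inferInstanceAs (Module Γ(X, U.unop) (twistSections c g F U.unop))

theorem twistPresheaf_isSheaf :
    TopCat.Presheaf.IsSheaf (X := X.carrier) (twistPresheaf c g F) := by
  refine (TopCat.Presheaf.isSheaf_iff_isSheafUniqueGluing (X := X.carrier)
    (twistPresheaf c g F)).mpr ?_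
  intro κ U s hs
  change ∀ j, twistSections c g F (U j) at s
  have hcov : ∀ A : X.Opens, iSup U ⊓ A ≤ ⨆ j, U j ⊓ A := fun A => by
    rw [iSup_inf_eq]
  have hmap : ∀ (j : κ) (A : X.Opens), U j ⊓ A ≤ iSup U ⊓ A := fun j A =>
    inf_le_inf_right A (le_iSup U j)
  have sep : ∀ (A : X.Opens) (x y : Γ(F, iSup U ⊓ A)),
      (∀ j, mres F (hmap j A) x = mres F (hmap j A) y) → x = y := fun A x y h =>
    TopCat.Sheaf.eq_of_locally_eq' ⟨F.presheaf, F.isSheaf⟩ (fun j => U j ⊓ A) _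
      (fun j => homOfLE (hmap j A)) (hcov A) x y h
  have hglue : ∀ i : ι, ∃ t : Γ(F, iSup U ⊓ c i),
      ∀ j, mres F (hmap j (c i)) t = (s j).1 i := by
    intro i
    refine (TopCat.Sheaf.existsUnique_gluing' ⟨F.presheaf, F.isSheaf⟩ (fun j => U j ⊓ c i) _
      (fun j => homOfLE (hmap j (c i))) (hcov _) (fun j => (s j).1 i) ?_).exists
    intro j l
    have h := congrFun (congrArg Subtype.val (hs j l)) i
    have h' := congrArg (mres F (W := U j ⊓ c i ⊓ (U l ⊓ c i))
      (le_inf (inf_le_inf inf_le_left inf_le_left) (inf_le_left.trans inf_le_right))) h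
    exact (mres_mres F _ _ _).symm.trans (h'.trans (mres_mres F _ _ _))
  choose t ht using hglue
  refine ⟨(⟨t, ?_⟩ : twistSections c g F (iSup U)), ?_, ?_⟩
  · intro i l
    refine sep _ _ _ fun j => ?_
    have h := (s j).2 i l
    rw [← ht, ← ht, mres_mres, mres_mres] at h
    rw [mres_smul, res_res, mres_mres, mres_mres]
    exact h
  · intro j
    exact Subtype.ext (funext fun i => ht i j)
  · intro t' ht'
    refine Subtype.ext (funext fun i => sep _ _ _ fun j => ?_)
    rw [ht, ← ht' j]
    rfl

/-- The sheaf of modules with sections `twistSections c g F U`. If the `cᵢ` cover `X` and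
`eᵢ = gᵢⱼ eⱼ` for nowhere vanishing sections `eᵢ ∈ L(cᵢ)` of a line bundle `L`, then this is
`F ⊗ L`, the family `(sᵢ)` corresponding to the section equal to `sᵢ ⊗ eᵢ` over `U ∩ cᵢ`. -/
def twist : X.Modules where
  val := PresheafOfModules.ofPresheaf (R := X.ringCatSheaf.obj) (twistPresheaf c g F) (by
    intro U V f r s
    refine Subtype.ext (funext fun i => ?_)
    refine (mres_smul F _ _ _).trans ?_
    exact congrArg (· • mres F (inf_le_inf_right (c i) f.unop.le) (s.1 i))
      ((res_res _ _ r).trans (res_res f.unop.le inf_le_left r).symm))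
  isSheaf := twistPresheaf_isSheaf c g F

end Twist

/-! ### Projective space and the twists `F(-m)` -/

section ProjectiveSpace

variable (n : ℕ) (k : Type u) [Field k]

/-- Projective space `ℙⁿ` over `k`, as `Proj k[x₀, …, xₙ]`. -/
abbrev projSpace : Scheme.{u} := Proj (MvPolynomial.homogeneousSubmodule (Fin (n + 1)) k)

/-- The structure morphism `ℙⁿ ⟶ Spec k`. -/
def projSpaceToSpec : projSpace n k ⟶ Spec (.of k) :=
  Proj.toSpecZero _ ≫ Spec.map (CommRingCat.ofHom
    (algebraMap k (MvPolynomial.homogeneousSubmodule (Fin (n + 1)) k 0)))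

variable {n k}

/-- The standard open subset `xᵢ ≠ 0` of `ℙⁿ`. -/
def chart (i : Fin (n + 1)) : (projSpace n k).Opens := Proj.basicOpen _ (MvPolynomial.X i)

/-- The function `xⱼ / xᵢ` on `chart i`. -/
def ratio (i j : Fin (n + 1)) : Γ(projSpace n k, chart i) :=
  Proj.awayToSection _ (MvPolynomial.X i) (HomogeneousLocalization.Away.mk _
    (MvPolynomial.isHomogeneous_X k i) 1 (MvPolynomial.X j)
    (by simpa using MvPolynomial.isHomogeneous_X k j))

/-- The sheaf of modules `F(-m) = F ⊗ 𝒪(-m)` on projective space. Over `chart i` the line bundle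
`𝒪(-m)` is free on `xᵢ⁻ᵐ`, and `xᵢ⁻ᵐ = (xⱼ / xᵢ)ᵐ xⱼ⁻ᵐ`. -/
def twistNeg (F : (projSpace n k).Modules) (m : ℕ) : (projSpace n k).Modules :=
  twist chart (fun i j => ratio i j ^ m) F

end ProjectiveSpace

/-! ### Cohomology and very free curves -/

/-- The sheaf cohomology group `Hⁿ(X, M)` of a sheaf of modules on a scheme. -/
abbrev cohomology {X : Scheme.{u}} (M : X.Modules) (n : ℕ) : Type u :=
  Sheaf.H (J := Opens.grothendieckTopology X) ⟨M.presheaf, M.isSheaf⟩ n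

/-- A morphism `h : ℙ¹ ⟶ Y` to a scheme `π : Y ⟶ Spec k` is very free if
`H¹(ℙ¹, (h^* T_Y)(-2)) = 0`. -/
def IsVeryFree {k : Type u} [Field k] {Y : Scheme.{u}} (π : Y ⟶ Spec (.of k))
    (h : projSpace 1 k ⟶ Y) : Prop :=
  Subsingleton (cohomology (twistNeg ((Scheme.Modules.pullback h).obj (tangentSheaf π)) 2) 1)

/-! ### Projective varieties and ample divisors -/

/-- `π : X ⟶ Spec k` is projective: `X` is isomorphic over `k` to a closed subscheme of some
`ℙᴺ`. -/
def IsProjective {k : Type u} [Field k] {X : Scheme.{u}} (π : X ⟶ Spec (.of k)) : Prop :=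
  ∃ (N : ℕ) (j : X ⟶ projSpace N k), IsClosedImmersion j ∧ j ≫ projSpaceToSpec N k = π

section Ample

variable {X D : Scheme.{u}} [IsIntegral X] (i : D ⟶ X)

/-- The rational function `f` is a global section of `𝒪_X(nD) = ℋom(I_Dⁿ, 𝒪_X)`: the product of
`f` with every local section of `I_Dⁿ` is a regular function. -/
def IsSectionOfMultiple (n : ℕ) (f : X.functionField) : Prop :=
  ∀ (U : X.affineOpens) [Nonempty U.1], ∀ a ∈ i.ker.ideal U ^ n, ∃ b : Γ(X, U.1),
    X.germToFunctionField U.1 b = f * X.germToFunctionField U.1 a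

/-- The section `f` of `𝒪_X(nD)` generates this sheaf at the point `x`: for some local section `a`
of `I_Dⁿ` near `x`, the function `f a` is regular and does not vanish at `x`. -/
def GeneratesMultipleAt (n : ℕ) (f : X.functionField) (x : X) : Prop :=
  ∃ (U : X.affineOpens) (_ : Nonempty U.1), ∃ a ∈ i.ker.ideal U ^ n, ∃ b : Γ(X, U.1),
    X.germToFunctionField U.1 b = f * X.germToFunctionField U.1 a ∧ x ∈ X.basicOpen b

/-- The divisor `D` on `X` is ample: for every point `x` there are `n > 0` and a global section `f`
of `𝒪_X(nD)` whose non-vanishing locus is affine and contains `x`. -/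
def IsAmpleDivisor : Prop :=
  ∀ x : X, ∃ n > 0, ∃ f : X.functionField, IsSectionOfMultiple i n f ∧
    ∃ U : X.Opens, IsAffineOpen U ∧ x ∈ U ∧ ∀ y : X, y ∈ U ↔ GeneratesMultipleAt i n f y

end Ample

end VeryFreeCurves

end

noncomputable section

namespace VeryFreeCurves

/-! ### Sheaves of compatible families of functions -/

section LocalFamily

/-! Put g = i ∘ h. Along the curve, the normal sequence of D in X reads 0 → h^*T_D → g^*T_X → h^*N →
0 with N = 𝒪_X(D)|_D. After twisting by 𝒪(-2), the left term has no H¹ by hypothesis, so it suffices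
that H¹ of (h^*N)(-2) vanishes. On ℙ¹ this holds as soon as the line bundle h^*N has degree m ≥ 1,
because then m - 2 ≥ -1.

Ampleness gives m ≥ 1. Choose n > 0 and a section f of 𝒪_X(nD) whose non-vanishing locus U is affine
and meets the curve. Along the curve, f becomes a nonzero section of the n-th power of h^*N, so m ≥
0. If m = 0, this section vanishes nowhere, so the whole curve lies in the affine open U; a morphism
from ℙ¹ to an affine scheme is constant, contrary to the assumption on h.

All three sheaves of the sequence are realised by families of functions on ℙ¹. The pullback of a
tangent sheaf becomes the sheaf of derivations along the morphism
(`nonempty_pullback_tangentSheaf_iso`): both represent the same functor, since on a smooth scheme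
vector fields and derivations expand in local coordinates. The pullback of N becomes the sheaf of
𝒪_X-linear maps from the ideal of D to functions on the curve. In this form the sequence restricts a
derivation to functions vanishing on D (`sectionExact_normal`). Its exactness on the right and the
invertibility of the normal sheaf rest on commutative algebra: a smooth quotient of relative
dimension one less is locally cut out by one equation a (`exists_smul_ker_le_span_singleton`), and
some derivation takes the value 1 on a (`exists_isLeibniz_apply_eq_one`).

On ℙ¹ the two standard charts are spectra of principal ideal domains, so the normal sheaf is free on
each (`exists_isGenerator`). Its transition function is a unit c Tᵐ of k[T;T⁻¹], and m is the
degree. Comparing polynomials in T with polynomials in T⁻¹ gives both the sign of m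
(`degree_nonneg_of_res_eq`) and the vanishing of H¹ (`subsingleton_cohomology_twistNeg_two`). The
passage from Čech cocycles to H¹ is `subsingleton_cohomology_one`. -/

theorem res_self {X : Scheme.{u}} {V : X.Opens} (h : V ≤ V) (a : Γ(X, V)) : res h a = a := by
  change (X.presheaf.map (𝟙 _)) a = a
  simp

theorem mres_self {X : Scheme.{u}} (M : X.Modules) {V : X.Opens} (h : V ≤ V) (a : Γ(M, V)) :
    mres M h a = a := by
  change (M.presheaf.map (𝟙 _)) a = a
  simp

/-- Two functions agree if they agree on the members of an open cover. -/
theorem res_ext {X : Scheme.{u}} {ι : Type*} {V : X.Opens} (U : ι → X.Opens) (hU : ∀ j, U j ≤ V)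
    (hV : V ≤ iSup U) (s t : Γ(X, V)) (h : ∀ j, res (hU j) s = res (hU j) t) : s = t :=
  TopCat.Sheaf.eq_of_locally_eq' X.sheaf U V (fun j => homOfLE (hU j)) hV s t h

theorem mres_ext {X : Scheme.{u}} (M : X.Modules) {ι : Type*} {V : X.Opens} (U : ι → X.Opens)
    (hU : ∀ j, U j ≤ V) (hV : V ≤ iSup U) (s t : Γ(M, V))
    (h : ∀ j, mres M (hU j) s = mres M (hU j) t) : s = t :=
  TopCat.Sheaf.eq_of_locally_eq' ⟨M.presheaf, M.isSheaf⟩ U V (fun j => homOfLE (hU j)) hV s t h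

theorem exists_glue {X : Scheme.{u}} {ι : Type*} {V : X.Opens} (U : ι → X.Opens)
    (hU : ∀ j, U j ≤ V) (hV : V ≤ iSup U) (s : ∀ j, Γ(X, U j))
    (h : ∀ j l, res (W := U j ⊓ U l) inf_le_left (s j) = res inf_le_right (s l)) :
    ∃ t : Γ(X, V), ∀ j, res (hU j) t = s j :=
  (TopCat.Sheaf.existsUnique_gluing' X.sheaf U V (fun j => homOfLE (hU j)) hV s h).exists

theorem exists_mglue {X : Scheme.{u}} (M : X.Modules) {ι : Type*} {V : X.Opens} (U : ι → X.Opens)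
    (hU : ∀ j, U j ≤ V) (hV : V ≤ iSup U) (s : ∀ j, Γ(M, U j))
    (h : ∀ j l, mres M (W := U j ⊓ U l) inf_le_left (s j) = mres M inf_le_right (s l)) :
    ∃ t : Γ(M, V), ∀ j, mres M (hU j) t = s j :=
  (TopCat.Sheaf.existsUnique_gluing' ⟨M.presheaf, M.isSheaf⟩ U V
    (fun j => homOfLE (hU j)) hV s h).exists

/-- A sheaf condition on families `(sⱼ)`, with `sⱼ` a function on `W ∩ cⱼ`. -/
structure LocalFamily (Y : Scheme.{u}) where
  /-- The index type of the families. -/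
  J : Type u
  /-- The `j`-th member of a family over `W` is a function on `W ∩ cⱼ`. -/
  c : J → Y.Opens
  /-- The admissible families over an open subset. -/
  carrier (W : Y.Opens) : AddSubgroup (∀ j, Γ(Y, W ⊓ c j))
  smul_mem : ∀ {W : Y.Opens} (r : Γ(Y, W)) {s}, s ∈ carrier W →
    (fun j => res (W := W ⊓ c j) inf_le_left r * s j) ∈ carrier W
  res_mem : ∀ {W W' : Y.Opens} (h : W' ≤ W) {s}, s ∈ carrier W →
    (fun j => res (inf_le_inf_right (c j) h) (s j)) ∈ carrier W'
  locality : ∀ {ι : Type u} (U : ι → Y.Opens) (s : ∀ j, Γ(Y, iSup U ⊓ c j)),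
    (∀ i, (fun j => res (inf_le_inf_right (c j) (le_iSup U i)) (s j)) ∈ carrier (U i)) →
      s ∈ carrier (iSup U)

namespace LocalFamily

variable {Y : Scheme.{u}} (F : LocalFamily Y)

instance (W : Y.Opens) : SMul Γ(Y, W) (F.carrier W) where
  smul r s := ⟨_, F.smul_mem r s.2⟩

theorem smul_apply (W : Y.Opens) (r : Γ(Y, W)) (s : F.carrier W) (j : F.J) :
    (r • s).1 j = res (W := W ⊓ F.c j) inf_le_left r * s.1 j := rfl

instance (W : Y.Opens) : Module Γ(Y, W) (F.carrier W) where
  one_smul s := by ext j; simp [smul_apply]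
  mul_smul r r' s := by ext j; simp [smul_apply, mul_assoc]
  smul_zero r := by ext j; simp [smul_apply]
  smul_add r s t := by ext j; simp [smul_apply, mul_add]
  add_smul r r' s := by ext j; simp [smul_apply, add_mul]
  zero_smul s := by ext j; simp [smul_apply]

/-- Restriction of families. -/
def restrict {W W' : Y.Opens} (h : W' ≤ W) : F.carrier W →+ F.carrier W' where
  toFun s := ⟨_, F.res_mem h s.2⟩
  map_zero' := by ext j; simp
  map_add' _ _ := by ext j; simp

theorem restrict_apply {W W' : Y.Opens} (h : W' ≤ W) (s : F.carrier W) (j : F.J) :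
    (F.restrict h s).1 j = res (inf_le_inf_right (F.c j) h) (s.1 j) := rfl

/-- The presheaf of abelian groups of admissible families. -/
def presheaf : Y.Opensᵒᵖ ⥤ Ab.{u} where
  obj W := .of (F.carrier W.unop)
  map f := AddCommGrpCat.ofHom (F.restrict f.unop.le)
  map_id W := by
    refine AddCommGrpCat.hom_ext (AddMonoidHom.ext fun s => Subtype.ext (funext fun j => ?_))
    exact res_self _ _
  map_comp f g := by
    refine AddCommGrpCat.hom_ext (AddMonoidHom.ext fun s => Subtype.ext (funext fun j => ?_))
    exact (res_res _ _ _).symm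

instance (W : Y.Opensᵒᵖ) : Module (Y.ringCatSheaf.obj.obj W) (F.presheaf.obj W) :=
  inferInstanceAs (Module Γ(Y, W.unop) (F.carrier W.unop))

theorem presheaf_isSheaf : TopCat.Presheaf.IsSheaf (X := Y.carrier) F.presheaf := by
  refine (TopCat.Presheaf.isSheaf_iff_isSheafUniqueGluing (X := Y.carrier) F.presheaf).mpr ?_
  intro κ U s hs
  change ∀ i, F.carrier (U i) at s
  have hcov : ∀ A : Y.Opens, iSup U ⊓ A ≤ ⨆ i, U i ⊓ A := fun A => by rw [iSup_inf_eq]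
  have hmap : ∀ (i : κ) (A : Y.Opens), U i ⊓ A ≤ iSup U ⊓ A := fun i A =>
    inf_le_inf_right A (le_iSup U i)
  have hglue : ∀ j, ∃ t : Γ(Y, iSup U ⊓ F.c j), ∀ i, res (hmap i (F.c j)) t = (s i).1 j := by
    intro j
    refine exists_glue (fun i => U i ⊓ F.c j) (fun i => hmap i _) (hcov _) _ fun i l => ?_
    have h := congrFun (congrArg Subtype.val (hs i l)) j
    have h' := congrArg (res (W := U i ⊓ F.c j ⊓ (U l ⊓ F.c j))
      (le_inf (inf_le_inf inf_le_left inf_le_left) (inf_le_left.trans inf_le_right))) h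
    exact (res_res _ _ _).symm.trans (h'.trans (res_res _ _ _))
  choose t ht using hglue
  refine ⟨(⟨t, F.locality U t fun i => ?_⟩ : F.carrier (iSup U)), ?_, ?_⟩
  · convert (s i).2 using 1
    exact funext fun j => ht j i
  · intro i
    exact Subtype.ext (funext fun j => ht j i)
  · intro t' ht'
    refine Subtype.ext (funext fun j => res_ext (fun i => U i ⊓ F.c j) (fun i => hmap i _)
      (hcov _) _ _ fun i => ?_)
    rw [ht, ← ht' i]
    rfl

/-- The sheaf of modules of admissible families. -/
def sheaf : Y.Modules where
  val := PresheafOfModules.ofPresheaf (R := Y.ringCatSheaf.obj) F.presheaf (by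
    intro U V f r s
    refine Subtype.ext (funext fun j => ?_)
    refine (map_mul _ _ _).trans ?_
    exact congrArg (· * res (inf_le_inf_right (F.c j) f.unop.le) (s.1 j))
      ((res_res _ _ r).trans (res_res f.unop.le inf_le_left r).symm))
  isSheaf := F.presheaf_isSheaf

end LocalFamily

end LocalFamily

/-! ### Derivations along a morphism -/

section DerAlong

theorem appLE_res {X Y : Scheme.{u}} (g : Y ⟶ X) {V V' : X.Opens} {W W' : Y.Opens} (hV : V' ≤ V)
    (e : W ≤ g ⁻¹ᵁ V) (e' : W' ≤ g ⁻¹ᵁ V') (hW : W' ≤ W) (a : Γ(X, V)) :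
    g.appLE V' W' e' (res hV a) = res hW (g.appLE V W e a) := by
  simp only [← CommRingCat.comp_apply, Scheme.Hom.appLE_map, Scheme.Hom.map_appLE]

theorem le_preimage_top {X S : Scheme.{u}} (π : X ⟶ S) (V : X.Opens) : V ≤ π ⁻¹ᵁ ⊤ := le_top

theorem inf_preimage_le {X Y : Scheme.{u}} (g : Y ⟶ X) (U V : X.Opens) :
    g ⁻¹ᵁ U ⊓ g ⁻¹ᵁ V ≤ g ⁻¹ᵁ (U ⊓ V) := le_rfl

variable {X Y S : Scheme.{u}} (π : X ⟶ S) (g : Y ⟶ X)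

/-- Derivations along `g : Y ⟶ X`: the families of maps `Γ(X, V) → Γ(Y, W ∩ g⁻¹ V)` that are
compatible with restriction, additive, satisfy the Leibniz rule and vanish on functions pulled back
from `S`. -/
structure IsDerAlong (W : Y.Opens) (s : ∀ j : (V : X.Opens) × Γ(X, V), Γ(Y, W ⊓ g ⁻¹ᵁ j.1)) :
    Prop where
  add : ∀ V a b, s ⟨V, a + b⟩ = s ⟨V, a⟩ + s ⟨V, b⟩
  mul : ∀ V a b, s ⟨V, a * b⟩ =
    g.appLE V _ inf_le_right a * s ⟨V, b⟩ + g.appLE V _ inf_le_right b * s ⟨V, a⟩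
  res : ∀ V V' (h : V' ≤ V) a, s ⟨V', res h a⟩ = res (inf_le_inf_left W (g.preimage_mono h)) (s ⟨V, a⟩)
  base : ∀ V c, s ⟨V, π.appLE ⊤ V (le_preimage_top π V) c⟩ = 0

/-- The sheaf of derivations along `g`. -/
def derFamily : LocalFamily Y where
  -- A derivation is recorded by its table of values, indexed by all local functions on X. Each
  -- axiom is then an identity between functions on Y, hence local on Y.
  J := (V : X.Opens) × Γ(X, V)
  c j := g ⁻¹ᵁ j.1
  carrier W :=
    { carrier := {s | IsDerAlong π g W s}
      zero_mem' := ⟨by simp, by simp, by simp, by simp⟩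
      add_mem' := fun {s t} hs ht => ⟨fun V a b => by simp [hs.add, ht.add]; abel,
        fun V a b => by simp [hs.mul, ht.mul]; ring, fun V V' h a => by simp [hs.res V V' h, ht.res V V' h],
        fun V c => by simp [hs.base, ht.base]⟩
      neg_mem' := fun {s} hs => ⟨fun V a b => by simp [hs.add]; abel,
        fun V a b => by simp [hs.mul]; ring, fun V V' h a => by simp [hs.res V V' h],
        fun V c => by simp [hs.base]⟩ }
  smul_mem := fun {W} r {s} hs => ⟨fun V a b => by simp only [hs.add]; ring,
        fun V a b => by simp only [hs.mul]; ring, fun V V' h a => by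
          simp only [hs.res V V' h, map_mul, res_res],
        fun V c => by simp only [hs.base]; ring⟩
  res_mem := fun {W W'} hW {s} hs => ⟨fun V a b => by simp only [hs.add, map_add],
        fun V a b => by
          simp only [hs.mul, map_add, map_mul]
          rw [← appLE_res g le_rfl _ inf_le_right, ← appLE_res g le_rfl _ inf_le_right,
            res_self, res_self],
        fun V V' h a => by
          simp only [hs.res V V' h, res_res],
        fun V c => by simp only [hs.base, map_zero]⟩
  locality := fun {ι} U s hs => by
    have hcov : ∀ A : Y.Opens, iSup U ⊓ A ≤ ⨆ i, U i ⊓ A := fun A => by rw [iSup_inf_eq]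
    have hmap : ∀ (i : ι) (A : Y.Opens), U i ⊓ A ≤ iSup U ⊓ A := fun i A =>
      inf_le_inf_right A (le_iSup U i)
    refine ⟨fun V a b => ?_, fun V a b => ?_, fun V V' h a => ?_, fun V c => ?_⟩ <;>
      refine res_ext (fun i => U i ⊓ _) (fun i => hmap i _) (hcov _) _ _ fun i => ?_
    · rw [map_add]; exact (hs i).add V a b
    · rw [map_add, map_mul, map_mul,
        ← appLE_res g le_rfl _ inf_le_right, ← appLE_res g le_rfl _ inf_le_right,
            res_self, res_self]
      exact (hs i).mul V a b
    · refine ((hs i).res V V' h a).trans ?_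
      simp only [res_res]
    · rw [map_zero]; exact (hs i).base V c

/-- Derivations along `g` over `W`. -/
abbrev Der (W : Y.Opens) : Type u := (derFamily π g).carrier W

end DerAlong
end VeryFreeCurves
end


noncomputable section

namespace VeryFreeCurves

/-! ### Extension of derivations -/

section Extension

/-- Derivations along a ring homomorphism. -/
structure IsLeibniz {A B : Type*} [CommRing A] [CommRing B] (φ : A →+* B) (d : A → B) : Prop where
  add : ∀ a b, d (a + b) = d a + d b
  mul : ∀ a b, d (a * b) = φ a * d b + φ b * d a

namespace IsLeibniz

variable {A B : Type*} [CommRing A] [CommRing B] {φ : A →+* B} {d : A → B}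

theorem zero (hd : IsLeibniz φ d) : d 0 = 0 := by simpa using hd.add 0 0

theorem one (hd : IsLeibniz φ d) : d 1 = 0 := by simpa using hd.mul 1 1

/-- The ring homomorphism `a ↦ φ a + d a ε` into dual numbers. -/
def dualHom (hd : IsLeibniz φ d) : A →+* DualNumber B where
  toFun a := TrivSqZeroExt.inl (φ a) + TrivSqZeroExt.inr (d a)
  map_one' := by ext <;> simp [hd.one]
  map_zero' := by ext <;> simp [hd.zero]
  map_add' a b := by ext <;> simp [hd.add]
  map_mul' a b := by ext <;> simp [hd.mul, mul_comm]

theorem comp {A' : Type*} [CommRing A'] (hd : IsLeibniz φ d) (ψ : A' →+* A) :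
    IsLeibniz (φ.comp ψ) (fun a => d (ψ a)) :=
  ⟨fun a b => by simp [hd.add], fun a b => by simp [hd.mul]⟩

theorem map {B' : Type*} [CommRing B'] (hd : IsLeibniz φ d) (ψ : B →+* B') :
    IsLeibniz (ψ.comp φ) (fun a => ψ (d a)) :=
  ⟨fun a b => by simp [hd.add], fun a b => by simp [hd.mul]⟩

/-- Derivations along φ are the same as lifts of φ to the dual numbers of B, and a ring homomorphism
out of a localization is determined on the original ring. -/
theorem ext_of_isLocalization {R : Type*} [CommRing R] (M : Submonoid R) [Algebra R A]
    [IsLocalization M A] {d' : A → B} (hd : IsLeibniz φ d) (hd' : IsLeibniz φ d')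
    (h : ∀ r : R, d (algebraMap R A r) = d' (algebraMap R A r)) : d = d' := by
  have key : hd.dualHom = hd'.dualHom := by
    refine IsLocalization.ringHom_ext M (RingHom.ext fun r => ?_)
    change (_ : DualNumber B) + _ = _ + _
    rw [h r]
  funext a
  simpa [dualHom] using congrArg TrivSqZeroExt.snd (DFunLike.congr_fun key a)

/-- A dual number is a unit as soon as its first component is. So the lift to dual numbers extends
over the localization by the universal property, and no quotient rule has to be checked. -/
theorem exists_of_isLocalization {R : Type*} [CommRing R] (f : R) [Algebra R A]
    [IsLocalization.Away f A] (φ : A →+* B) {e : R → B}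
    (he : IsLeibniz (φ.comp (algebraMap R A)) e) :
    ∃ d : A → B, IsLeibniz φ d ∧ ∀ r, d (algebraMap R A r) = e r := by
  have hf : IsUnit (he.dualHom f) := by
    rw [TrivSqZeroExt.isUnit_iff_isUnit_fst]
    simpa [dualHom] using (IsLocalization.Away.algebraMap_isUnit (S := A) f).map φ
  let ρ : A →+* DualNumber B := IsLocalization.Away.lift f hf
  have hρ : ∀ r, ρ (algebraMap R A r) = he.dualHom r := fun r => IsLocalization.Away.lift_eq f hf r
  have hfst : ∀ a, (ρ a).fst = φ a := by
    have : (TrivSqZeroExt.fstHom B B B).toRingHom.comp ρ = φ := by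
      refine IsLocalization.ringHom_ext (Submonoid.powers f) (RingHom.ext fun r => ?_)
      simp [hρ, dualHom]
    exact fun a => DFunLike.congr_fun this a
  refine ⟨fun a => (ρ a).snd, ⟨fun a b => by simp, fun a b => ?_⟩, fun r => ?_⟩
  · simp [hfst, mul_comm]
  · simp [hρ, dualHom]

end IsLeibniz

variable {X Y S : Scheme.{u}} {π : X ⟶ S} {g : Y ⟶ X}

theorem res_appLE_top (π : X ⟶ S) {V V' : X.Opens} (h : V' ≤ V) (c : Γ(S, ⊤)) :
    res h (π.appLE ⊤ V (le_preimage_top π V) c) = π.appLE ⊤ V' (le_preimage_top π V') c := by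
  have := appLE_res π le_rfl (le_preimage_top π V) (le_preimage_top π V') h c
  rw [res_self] at this
  exact this.symm

/-- The value of a derivation along `g` on a function `a` on `V`. -/
def Der.fn {W : Y.Opens} (δ : Der π g W) (V : X.Opens) (a : Γ(X, V)) : Γ(Y, W ⊓ g ⁻¹ᵁ V) :=
  δ.1 ⟨V, a⟩

/-- The value of a derivation along `g` on a function `a` on `V`, restricted to `W'`. -/
def Der.ev {W : Y.Opens} (δ : Der π g W) {V : X.Opens} {W' : Y.Opens} (h : W' ≤ W ⊓ g ⁻¹ᵁ V)
    (a : Γ(X, V)) : Γ(Y, W') :=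
  res h (δ.fn V a)

theorem Der.isLeibniz {W : Y.Opens} (δ : Der π g W) {V : X.Opens} {W' : Y.Opens}
    (h : W' ≤ W ⊓ g ⁻¹ᵁ V) : IsLeibniz (g.appLE V W' (h.trans inf_le_right)).hom (δ.ev h) := by
  refine ⟨fun a b => ?_, fun a b => ?_⟩
  · exact (congrArg (VeryFreeCurves.res h) (δ.2.add V a b)).trans (map_add _ _ _)
  · have hmul : δ.fn V (a * b) = g.appLE V _ inf_le_right a * δ.fn V b +
        g.appLE V _ inf_le_right b * δ.fn V a := δ.2.mul V a b
    rw [Der.ev, hmul, map_add, map_mul, map_mul, ← appLE_res g le_rfl _ (h.trans inf_le_right),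
      ← appLE_res g le_rfl _ (h.trans inf_le_right), res_self, res_self]
    rfl

theorem Der.ev_res {W : Y.Opens} (δ : Der π g W) {V V' : X.Opens} {W' : Y.Opens} (hV : V' ≤ V)
    (h : W' ≤ W ⊓ g ⁻¹ᵁ V') (a : Γ(X, V)) :
    δ.ev h (res hV a) = δ.ev (h.trans (inf_le_inf_left W (g.preimage_mono hV))) a :=
  (congrArg (VeryFreeCurves.res h) (δ.2.res V V' hV a)).trans (res_res _ _ _)

theorem Der.res_ev {W : Y.Opens} (δ : Der π g W) {V : X.Opens} {W' W'' : Y.Opens}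
    (h : W' ≤ W ⊓ g ⁻¹ᵁ V) (h' : W'' ≤ W') (a : Γ(X, V)) :
    res h' (δ.ev h a) = δ.ev (h'.trans h) a :=
  res_res _ _ _

theorem Der.ev_base {W : Y.Opens} (δ : Der π g W) {V : X.Opens} {W' : Y.Opens}
    (h : W' ≤ W ⊓ g ⁻¹ᵁ V) (c : Γ(S, ⊤)) : δ.ev h (π.appLE ⊤ V (le_preimage_top π V) c) = 0 :=
  (congrArg (VeryFreeCurves.res h) (δ.2.base V c)).trans (map_zero _)

theorem Der.restrict_ev {W : Y.Opens} (δ : Der π g W) {W₁ : Y.Opens} (hW : W₁ ≤ W) {V : X.Opens}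
    {W' : Y.Opens} (h : W' ≤ W₁ ⊓ g ⁻¹ᵁ V) (a : Γ(X, V)) :
    Der.ev (π := π) (g := g) ((derFamily π g).restrict hW δ) h a =
      δ.ev (h.trans (inf_le_inf_right _ hW)) a :=
  res_res _ _ _

theorem Der.smul_ev {W : Y.Opens} (r : Γ(Y, W)) (δ : Der π g W) {V : X.Opens}
    {W' : Y.Opens} (h : W' ≤ W ⊓ g ⁻¹ᵁ V) (a : Γ(X, V)) :
    Der.ev (r • δ) h a = res (h.trans inf_le_left) r * δ.ev h a :=
  (map_mul (VeryFreeCurves.res h) _ _).trans (congrArg (· * δ.ev h a) (res_res _ _ _))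

theorem Der.add_ev {W : Y.Opens} (δ δ' : Der π g W) {V : X.Opens}
    {W' : Y.Opens} (h : W' ≤ W ⊓ g ⁻¹ᵁ V) (a : Γ(X, V)) :
    Der.ev (δ + δ') h a = δ.ev h a + δ'.ev h a :=
  map_add (res h) _ _

theorem Der.zero_ev {W : Y.Opens} {V : X.Opens}
    {W' : Y.Opens} (h : W' ≤ W ⊓ g ⁻¹ᵁ V) (a : Γ(X, V)) :
    Der.ev (0 : Der π g W) h a = 0 :=
  map_zero (res h)

theorem Der.sum_ev {W : Y.Opens} {ι : Type*} (t : Finset ι) (δ : ι → Der π g W) {V : X.Opens}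
    {W' : Y.Opens} (h : W' ≤ W ⊓ g ⁻¹ᵁ V) (a : Γ(X, V)) :
    Der.ev (∑ i ∈ t, δ i) h a = ∑ i ∈ t, (δ i).ev h a := by
  classical
  induction t using Finset.induction_on with
  | empty => simpa using Der.zero_ev h a
  | insert i t hi ih => rw [Finset.sum_insert hi, Finset.sum_insert hi, Der.add_ev, ih]

/-- An open subset of `g⁻¹ V`, for `V` affine, is covered by the preimages of those basic open
subsets of `V` that lie in a given open subset. -/
theorem le_iSup_preimage_basicOpen (g : Y ⟶ X) {V : X.Opens} (hV : IsAffineOpen V) {W : Y.Opens}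
    (hW : W ≤ g ⁻¹ᵁ V) (V' : X.Opens) :
    W ⊓ g ⁻¹ᵁ V' ≤ ⨆ f : {f : Γ(X, V) // X.basicOpen f ≤ V'}, W ⊓ g ⁻¹ᵁ X.basicOpen f.1 := by
  intro y hy
  obtain ⟨f, hf, hyf⟩ := hV.exists_basicOpen_le (V := V') ⟨g y, hy.2⟩ (hW hy.1)
  exact Opens.mem_iSup.mpr ⟨⟨f, hf⟩, hy.1, hyf⟩

/-- A derivation along `g` over `W ⊆ g⁻¹ V`, with `V` affine, is determined by its values on
functions on `V`. -/
theorem Der.ext_of_isAffineOpen {V : X.Opens} (hV : IsAffineOpen V) {W : Y.Opens}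
    (hW : W ≤ g ⁻¹ᵁ V) {δ δ' : Der π g W}
    (h : ∀ a : Γ(X, V), δ.ev (le_inf le_rfl hW) a = δ'.ev (le_inf le_rfl hW) a) : δ = δ' := by
  refine Subtype.ext (funext fun ⟨V', b⟩ => ?_)
  refine res_ext _ (fun f => inf_le_inf_left W (g.preimage_mono f.2))
    (le_iSup_preimage_basicOpen g hV hW V') _ _ fun f => ?_
  have hle : W ⊓ g ⁻¹ᵁ X.basicOpen f.1 ≤ W ⊓ g ⁻¹ᵁ X.basicOpen f.1 := le_rfl
  have := hV.isLocalization_basicOpen f.1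
  have key := IsLeibniz.ext_of_isLocalization (Submonoid.powers f.1) (δ.isLeibniz hle)
    (δ'.isLeibniz hle) (fun a => ?_)
  · have := congrFun key (VeryFreeCurves.res f.2 b)
    rwa [Der.ev_res, Der.ev_res] at this
  · have := congrArg (VeryFreeCurves.res (W := W ⊓ g ⁻¹ᵁ X.basicOpen f.1) inf_le_left) (h a)
    rw [Der.res_ev, Der.res_ev] at this
    change δ.ev hle (VeryFreeCurves.res (X.basicOpen_le f.1) a) =
      δ'.ev hle (VeryFreeCurves.res (X.basicOpen_le f.1) a)
    rwa [Der.ev_res, Der.ev_res]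

/-- A derivation `Γ(X, V) → Γ(Y, W)`, with `V` affine and `W ⊆ g⁻¹ V`, extends to a derivation
along `g` over `W`. -/
theorem Der.exists_of_isAffineOpen {V : X.Opens} (hV : IsAffineOpen V) {W : Y.Opens}
    (hW : W ≤ g ⁻¹ᵁ V) {d : Γ(X, V) → Γ(Y, W)} (hd : IsLeibniz (g.appLE V W hW).hom d)
    (hbase : ∀ c, d (π.appLE ⊤ V (le_preimage_top π V) c) = 0) :
    ∃ δ : Der π g W, ∀ a, δ.ev (le_inf le_rfl hW) a = d a := by
  -- Every basic open subset of V corresponds to a localization, to which d extends.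
  have hloc : ∀ f : Γ(X, V), ∃ e : Γ(X, X.basicOpen f) → Γ(Y, W ⊓ g ⁻¹ᵁ X.basicOpen f),
      IsLeibniz (g.appLE _ _ inf_le_right).hom e ∧
        ∀ a, e (VeryFreeCurves.res (X.basicOpen_le f) a) = VeryFreeCurves.res inf_le_left (d a) := by
    intro f
    have := hV.isLocalization_basicOpen f
    refine IsLeibniz.exists_of_isLocalization f _ ?_
    convert hd.map (VeryFreeCurves.res (W := W ⊓ g ⁻¹ᵁ X.basicOpen f) inf_le_left) using 1
    exact RingHom.ext fun a => appLE_res g (X.basicOpen_le f) hW inf_le_right inf_le_left a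
  choose e he hea using hloc
  -- Uniqueness of the extension to a localization makes the maps on different basic open subsets
  -- compatible.
  have hmono : ∀ (f f' : Γ(X, V)) (h : X.basicOpen f' ≤ X.basicOpen f) (b : Γ(X, X.basicOpen f)),
      VeryFreeCurves.res (inf_le_inf_left W (g.preimage_mono h)) (e f b) =
        e f' (VeryFreeCurves.res h b) := by
    intro f f' h b
    have := hV.isLocalization_basicOpen f
    refine congrFun (IsLeibniz.ext_of_isLocalization
      (φ := (g.appLE (X.basicOpen f) (W ⊓ g ⁻¹ᵁ X.basicOpen f')
        (inf_le_right.trans (g.preimage_mono h))).hom) (Submonoid.powers f)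
      (d := fun b => VeryFreeCurves.res (inf_le_inf_left W (g.preimage_mono h)) (e f b))
      (d' := fun b => e f' (VeryFreeCurves.res h b)) ?_ ?_ fun a => ?_) b
    · convert (he f).map (VeryFreeCurves.res (inf_le_inf_left W (g.preimage_mono h))) using 1
      refine RingHom.ext fun a => ?_
      have := appLE_res g le_rfl (inf_le_right : W ⊓ g ⁻¹ᵁ X.basicOpen f ≤ _)
        (inf_le_right.trans (g.preimage_mono h)) (inf_le_inf_left W (g.preimage_mono h)) a
      rwa [res_self] at this
    · convert (he f').comp (VeryFreeCurves.res h) using 1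
      simp only [← CommRingCat.hom_comp, Scheme.Hom.map_appLE]
    · change VeryFreeCurves.res _ (e f (VeryFreeCurves.res (X.basicOpen_le f) a)) =
        e f' (VeryFreeCurves.res h (VeryFreeCurves.res (X.basicOpen_le f) a))
      rw [hea, res_res, res_res, hea]
  -- A function on an arbitrary V' is differentiated on the basic open subsets of V inside V', whose
  -- preimages cover W ∩ g⁻¹ V'; the results agree on D(f f').
  have hglue : ∀ (V' : X.Opens) (b : Γ(X, V')), ∃ t : Γ(Y, W ⊓ g ⁻¹ᵁ V'),
      ∀ (f : Γ(X, V)) (hf : X.basicOpen f ≤ V'),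
        VeryFreeCurves.res (inf_le_inf_left W (g.preimage_mono hf)) t =
          e f (VeryFreeCurves.res hf b) := by
    intro V' b
    refine (exists_glue
      (fun f : {f : Γ(X, V) // X.basicOpen f ≤ V'} => W ⊓ g ⁻¹ᵁ X.basicOpen f.1)
      (fun f => inf_le_inf_left W (g.preimage_mono f.2))
      (le_iSup_preimage_basicOpen g hV hW V') (fun f => e f.1 (VeryFreeCurves.res f.2 b))
      ?_).imp fun t ht f hf => ht ⟨f, hf⟩
    · intro f f'
      have h₁ : X.basicOpen (f.1 * f'.1) ≤ X.basicOpen f.1 := by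
        rw [Scheme.basicOpen_mul]; exact inf_le_left
      have h₂ : X.basicOpen (f.1 * f'.1) ≤ X.basicOpen f'.1 := by
        rw [Scheme.basicOpen_mul]; exact inf_le_right
      have hle : W ⊓ g ⁻¹ᵁ X.basicOpen f.1 ⊓ (W ⊓ g ⁻¹ᵁ X.basicOpen f'.1) ≤
          W ⊓ g ⁻¹ᵁ X.basicOpen (f.1 * f'.1) := by
        rw [Scheme.basicOpen_mul]
        exact fun y hy => ⟨hy.1.1, hy.1.2, hy.2.2⟩
      have k₁ := congrArg (VeryFreeCurves.res hle) (hmono _ _ h₁ (VeryFreeCurves.res f.2 b))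
      have k₂ := congrArg (VeryFreeCurves.res hle) (hmono _ _ h₂ (VeryFreeCurves.res f'.2 b))
      rw [res_res, res_res] at k₁ k₂
      exact k₁.trans k₂.symm
  choose s hs using hglue
  have sep : ∀ (V' : X.Opens) (t t' : Γ(Y, W ⊓ g ⁻¹ᵁ V')),
      (∀ (f : Γ(X, V)) (hf : X.basicOpen f ≤ V'),
        VeryFreeCurves.res (inf_le_inf_left W (g.preimage_mono hf)) t =
          VeryFreeCurves.res (inf_le_inf_left W (g.preimage_mono hf)) t') → t = t' :=
    fun V' t t' h => res_ext _ (fun f => inf_le_inf_left W (g.preimage_mono f.2))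
      (le_iSup_preimage_basicOpen g hV hW V') _ _ fun f => h f.1 f.2
  have happ : ∀ (V' : X.Opens) (f : Γ(X, V)) (hf : X.basicOpen f ≤ V') (a : Γ(X, V')),
      VeryFreeCurves.res (inf_le_inf_left W (g.preimage_mono hf)) (g.appLE V' _ inf_le_right a) =
        g.appLE _ (W ⊓ g ⁻¹ᵁ X.basicOpen f) inf_le_right (VeryFreeCurves.res hf a) := fun V' f hf a =>
    (appLE_res g hf _ _ _ a).symm
  have hadd : ∀ V' a b, s V' (a + b) = s V' a + s V' b := fun V' a b =>
    sep _ _ _ fun f hf => by rw [map_add, hs _ _ f hf, hs _ _ f hf, hs _ _ f hf, map_add, (he f).add]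
  have hmul : ∀ V' a b, s V' (a * b) = g.appLE V' _ inf_le_right a * s V' b +
      g.appLE V' _ inf_le_right b * s V' a := fun V' a b =>
    sep _ _ _ fun f hf => by
      rw [map_add, map_mul, map_mul, hs _ _ f hf, hs _ _ f hf, hs _ _ f hf, happ, happ, map_mul]
      exact (he f).mul _ _
  have hres : ∀ V' V'' (h : V'' ≤ V') a, s V'' (VeryFreeCurves.res h a) =
      VeryFreeCurves.res (inf_le_inf_left W (g.preimage_mono h)) (s V' a) := fun V' V'' h a =>
    sep _ _ _ fun f hf => by
      rw [hs _ _ f hf, res_res, res_res]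
      exact (hs _ _ f (hf.trans h)).symm
  have hc : ∀ V' c, s V' (π.appLE ⊤ V' (le_preimage_top π V') c) = 0 := fun V' c =>
    sep _ _ _ fun f hf => by
      have : VeryFreeCurves.res hf (π.appLE ⊤ V' (le_preimage_top π V') c) =
          VeryFreeCurves.res (X.basicOpen_le f) (π.appLE ⊤ V (le_preimage_top π V) c) := by
        rw [res_appLE_top, res_appLE_top]
      rw [hs _ _ f hf, map_zero, this, hea, hbase, map_zero]
  refine ⟨⟨fun j => s j.1 j.2, ⟨hadd, hmul, hres, hc⟩⟩, fun a => ?_⟩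
  have : s V a = VeryFreeCurves.res inf_le_left (d a) :=
    sep _ _ _ fun f hf => by rw [hs _ _ f hf, hea, res_res]
  change VeryFreeCurves.res _ (s V a) = _
  rw [this, res_res, res_self]

end Extension
end VeryFreeCurves
end


noncomputable section

namespace VeryFreeCurves

/-! ### Local coordinates on a smooth scheme -/

section Coordinates

/-- The module of differentials of a smooth algebra is finitely generated and projective. The
surjection from a free module onto it given by finitely many differentials therefore splits, and the
components of a splitting are the derivations. This is only a dual basis: n may exceed the relative
dimension. -/
theorem exists_derivation_dualBasis (R A : Type u) [CommRing R] [CommRing A] [Algebra R A]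
    [Algebra.Smooth R A] : ∃ (n : ℕ) (x : Fin n → A) (d : Fin n → Derivation R A A),
      ∀ a, KaehlerDifferential.D R A a = ∑ i, d i a • KaehlerDifferential.D R A (x i) := by
  have hspan := KaehlerDifferential.span_range_derivation R A
  have hfg : (Submodule.span A (Set.range (KaehlerDifferential.D R A))).FG := by
    rw [hspan]; exact Module.Finite.fg_top
  -- The finite generating set can be taken among the exact differentials, since these span.
  obtain ⟨s, hs, hs'⟩ := (Submodule.fg_span_iff_fg_span_finset_subset _).mp hfg
  choose! y hy using fun ω (h : ω ∈ s) => hs h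
  let e := s.equivFin
  let x : Fin s.card → A := fun i => y (e.symm i).1
  have hx : ∀ i, KaehlerDifferential.D R A (x i) = (e.symm i).1 := fun i => hy _ (e.symm i).2
  let p : (Fin s.card → A) →ₗ[A] Ω[A⁄R] :=
    Fintype.linearCombination A (fun i => KaehlerDifferential.D R A (x i))
  have hp : Function.Surjective p := by
    rw [← LinearMap.range_eq_top, Fintype.range_linearCombination, ← hspan, hs']
    congr 1
    ext ω
    simp only [Set.mem_range, hx]
    exact ⟨fun ⟨i, hi⟩ => hi ▸ (e.symm i).2, fun h => ⟨e ⟨ω, h⟩, by simp⟩⟩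
  obtain ⟨σ, hσ⟩ := Module.projective_lifting_property p LinearMap.id hp
  refine ⟨s.card, x, fun i => (LinearMap.proj i ∘ₗ σ).compDer (KaehlerDifferential.D R A),
    fun a => ?_⟩
  have := LinearMap.congr_fun hσ (KaehlerDifferential.D R A a)
  rw [LinearMap.id_apply, LinearMap.comp_apply] at this
  conv_lhs => rw [← this]
  rfl

/-- A derivation that kills R factors through an A-linear map out of the differentials, which is
then applied to the expansion of the differential of a. -/
theorem IsLeibniz.eq_sum {R A B : Type u} [CommRing R] [CommRing A] [CommRing B] [Algebra R A]
    {n : ℕ} {x : Fin n → A} {e : Fin n → Derivation R A A}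
    (h : ∀ a, KaehlerDifferential.D R A a = ∑ i, e i a • KaehlerDifferential.D R A (x i))
    {φ : A →+* B} {d : A → B} (hd : IsLeibniz φ d) (hR : ∀ r, d (algebraMap R A r) = 0) (a : A) :
    d a = ∑ i, φ (e i a) * d (x i) := by
  let : Algebra A B := φ.toAlgebra
  let : Algebra R B := (φ.comp (algebraMap R A)).toAlgebra
  have : IsScalarTower R A B := .of_algebraMap_eq fun _ => rfl
  let D : Derivation R A B := Derivation.mk'
    { toFun := d
      map_add' := hd.add
      map_smul' := fun r a => by
        rw [Algebra.smul_def, hd.mul, hR, mul_zero, add_zero]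
        exact (Algebra.smul_def (A := B) r (d a)).symm }
    (fun a b => hd.mul a b)
  have key := congrArg D.liftKaehlerDifferential (h a)
  rw [map_sum, Derivation.liftKaehlerDifferential_comp_D] at key
  refine key.trans (Finset.sum_congr rfl fun i _ => ?_)
  rw [map_smul, Derivation.liftKaehlerDifferential_comp_D]
  rfl

variable {X S : Scheme.{u}} {π : X ⟶ S}

theorem id_appLE {V V' : X.Opens} (h : V' ≤ V) (h' : V' ≤ (𝟙 X : X ⟶ X) ⁻¹ᵁ V) (a : Γ(X, V)) :
    (𝟙 X : X ⟶ X).appLE V V' h' a = res h a := by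
  simp only [Scheme.Hom.appLE, Scheme.Hom.id_app]
  rfl

/-- On a scheme over a field, a derivation along the identity is a section of the tangent
sheaf. -/
def tangentOfDer {k : Type u} [Field k] {π : X ⟶ Spec (.of k)} {U : X.Opens} (δ : Der π (𝟙 X) U) :
    tangentSections π U :=
  ⟨fun V => AddMonoidHom.mk' (δ.ev (V := V.1) (W' := V.1) (le_inf V.2 le_rfl))
      (δ.isLeibniz (V := V.1) (W' := V.1) (le_inf V.2 le_rfl)).add, by
    refine ⟨fun V W h a => ?_, fun V a b => ?_, fun V T e c => ?_⟩
    · exact (δ.ev_res h _ a).trans (δ.res_ev (V := V.1) (le_inf V.2 le_rfl) h a).symm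
    · refine ((δ.isLeibniz (V := V.1) (W' := V.1) (le_inf V.2 le_rfl)).mul a b).trans ?_
      have h : ∀ a : Γ(X, V.1), (𝟙 X : X ⟶ X).appLE V.1 V.1 le_rfl a = a := fun a =>
        (id_appLE le_rfl le_rfl a).trans (res_self _ a)
      exact congrArg₂ (· + ·) (congrArg (· * _) (h a)) (congrArg (· * _) (h b))
    -- The base is a single point, so T is everything or empty. In the second case V is empty and
    -- carries only the zero function.
    · by_cases hT : T = ⊤
      · subst hT
        exact δ.ev_base (V := V.1) (W' := V.1) (le_inf V.2 le_rfl) c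
      · have hT' : T = ⊥ := by
          refine eq_bot_iff.mpr fun t ht => (hT (eq_top_iff.mpr fun t' _ => ?_)).elim
          rwa [Subsingleton.elim t' t]
        subst hT'
        have hV : V.1 = ⊥ := le_bot_iff.mp e
        have : Subsingleton Γ(X, V.1) := by rw [hV]; infer_instance
        exact Subsingleton.elim _ _⟩

theorem tangentOfDer_apply {k : Type u} [Field k] {π : X ⟶ Spec (.of k)} {U : X.Opens}
    (δ : Der π (𝟙 X) U) (V : {V : X.Opens // V ≤ U}) (a : Γ(X, V.1)) :
    (tangentOfDer δ).1 V a = δ.ev (V := V.1) (le_inf V.2 le_rfl) a := rfl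

variable (π) in
/-- An affine open subset with functions `xᵢ` and vector fields `∂ᵢ` such that
`d a = ∑ᵢ ∂ᵢ a · d xᵢ` for all functions `a`. -/
structure Coordinates where
  /-- The affine open subset. -/
  V : X.Opens
  isAffineOpen : IsAffineOpen V
  /-- The number of functions. -/
  n : ℕ
  /-- The functions. -/
  x : Fin n → Γ(X, V)
  /-- The vector fields. -/
  d : Fin n → tangentSections π V
  expand : ∀ {B : Type u} [CommRing B] {φ : Γ(X, V) →+* B} {δ : Γ(X, V) → B}, IsLeibniz φ δ →
    (∀ c, δ (π.appLE ⊤ V (le_preimage_top π V) c) = 0) → ∀ a, δ a = ∑ i, φ ((d i).1 ⟨V, le_rfl⟩ a) * δ (x i)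

/-- The derivations of the ring of an affine neighbourhood extend to vector fields by localization,
so the algebraic dual basis becomes a geometric one. -/
theorem exists_coordinates {k : Type u} [Field k] (π : X ⟶ Spec (.of k)) [Smooth π] (p : X) :
    ∃ C : Coordinates π, p ∈ C.V := by
  obtain ⟨V, hV, hp, -⟩ := exists_isAffineOpen_mem_and_subset (x := p) (U := ⊤) trivial
  have hsm : (π.appLE ⊤ V (le_preimage_top π V)).hom.Smooth := π.smooth_appLE (isAffineOpen_top _) hV (le_preimage_top π V)
  algebraize [(π.appLE ⊤ V (le_preimage_top π V)).hom]
  obtain ⟨n, x, e, he⟩ := exists_derivation_dualBasis Γ(Spec (.of k), ⊤) Γ(X, V)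
  have hlift : ∀ i, ∃ δ : Der π (𝟙 X) V,
      ∀ a, δ.ev (V := V) (W' := V) (le_inf le_rfl le_rfl) a = e i a := fun i => by
    refine Der.exists_of_isAffineOpen hV (W := V) le_rfl ⟨fun a b => map_add _ a b, fun a b => ?_⟩
      fun c => (e i).map_algebraMap c
    have h : ∀ a : Γ(X, V), (𝟙 X : X ⟶ X).appLE V V le_rfl a = a := fun a =>
      (id_appLE le_rfl le_rfl a).trans (res_self _ a)
    refine ((e i).leibniz a b).trans ?_
    exact congrArg₂ (· + ·) (congrArg (· * _) (h a).symm) (congrArg (· * _) (h b).symm)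
  choose δ hδ using hlift
  refine ⟨⟨V, hV, n, x, fun i => tangentOfDer (δ i), fun {B _ φ d} hd hc a => ?_⟩, hp⟩
  rw [hd.eq_sum he hc a]
  refine Finset.sum_congr rfl fun i _ => congrArg (fun t => φ t * d (x i)) (hδ i a).symm

end Coordinates
end VeryFreeCurves
end


noncomputable section

namespace VeryFreeCurves

/-! ### The pullback of the tangent sheaf -/

section Pullback

/-- A morphism of sheaves of modules from its maps on sections. -/
def modulesHomMk {X : Scheme.{u}} {M N : X.Modules} (φ : ∀ U : X.Opens, Γ(M, U) →+ Γ(N, U))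
    (hres : ∀ (U V : X.Opens) (h : V ≤ U) (x : Γ(M, U)), φ V (mres M h x) = mres N h (φ U x))
    (hsmul : ∀ (U : X.Opens) (r : Γ(X, U)) (x : Γ(M, U)), φ U (r • x) = r • φ U x) : M ⟶ N :=
  SheafOfModules.Hom.mk (PresheafOfModules.homMk
    { app := fun U => AddCommGrpCat.ofHom (φ U.unop)
      naturality := fun U V f => by
        refine AddCommGrpCat.hom_ext (AddMonoidHom.ext fun x => ?_)
        exact hres U.unop V.unop f.unop.le x }
    fun U r x => hsmul U.unop r x)

theorem app_mres {X : Scheme.{u}} {M N : X.Modules} (φ : M ⟶ N) {U V : X.Opens} (h : V ≤ U)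
    (x : Γ(M, U)) : φ.app V (mres M h x) = mres N h (φ.app U x) :=
  ConcreteCategory.congr_hom (φ.mapPresheaf.naturality (homOfLE h).op) x

variable {X Y S : Scheme.{u}} (π : X ⟶ S) (g : Y ⟶ X)

/-- The sheaf of derivations along `g`. -/
def derSheaf : Y.Modules := (derFamily π g).sheaf

variable {π} in
/-- The values of the derivation along `g` induced by a vector field. -/
def pushTangent {U : X.Opens} (D : tangentSections π U) (V : X.Opens) (a : Γ(X, V)) :
    Γ(Y, g ⁻¹ᵁ U ⊓ g ⁻¹ᵁ V) :=
  g.appLE (U ⊓ V) (g ⁻¹ᵁ U ⊓ g ⁻¹ᵁ V) (inf_preimage_le g U V)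
    (D.1 ⟨U ⊓ V, inf_le_left⟩ (res inf_le_right a))

theorem appLE_res_le {V V' : X.Opens} {W : Y.Opens} (hV : V' ≤ V) (e' : W ≤ g ⁻¹ᵁ V')
    (e : W ≤ g ⁻¹ᵁ V) (a : Γ(X, V)) : g.appLE V' W e' (res hV a) = g.appLE V W e a := by
  rw [appLE_res g hV e e' le_rfl, res_self]

theorem res_appLE {V : X.Opens} {W W' : Y.Opens} (hW : W' ≤ W) (e : W ≤ g ⁻¹ᵁ V)
    (e' : W' ≤ g ⁻¹ᵁ V) (a : Γ(X, V)) : res hW (g.appLE V W e a) = g.appLE V W' e' a := by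
  rw [← appLE_res g le_rfl e e' hW, res_self]

variable {π} in
theorem pushTangent_smul {U : X.Opens} (r : Γ(X, U)) (D : tangentSections π U) (V : X.Opens)
    (a : Γ(X, V)) : pushTangent g (r • D) V a =
      res (inf_le_left : g ⁻¹ᵁ U ⊓ g ⁻¹ᵁ V ≤ _) (g.app U r) * pushTangent g D V a := by
  simp only [pushTangent]
  rw [tangentSections_smul_apply, map_mul, appLE_res_le g inf_le_left _ inf_le_left,
    Scheme.Hom.app_eq_appLE, res_appLE]

variable {π} in
theorem isDerAlong_pushTangent {U : X.Opens} (D : tangentSections π U) :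
    IsDerAlong π g (g ⁻¹ᵁ U) (fun j => pushTangent g D j.1 j.2) := by
  have hadd : ∀ V a b, pushTangent g D V (a + b) = pushTangent g D V a + pushTangent g D V b :=
    fun V a b => by simp only [pushTangent, map_add]
  have hmul : ∀ V a b, pushTangent g D V (a * b) = g.appLE V _ inf_le_right a * pushTangent g D V b
      + g.appLE V _ inf_le_right b * pushTangent g D V a := fun V a b => by
    simp only [pushTangent]
    rw [map_mul, D.2.2.1 ⟨U ⊓ V, inf_le_left⟩, map_add, map_mul, map_mul,
      appLE_res_le g inf_le_right _ inf_le_right, appLE_res_le g inf_le_right _ inf_le_right]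
  have hres : ∀ V V' (h : V' ≤ V) a, pushTangent g D V' (res h a) =
      res (inf_le_inf_left _ (g.preimage_mono h)) (pushTangent g D V a) := fun V V' h a => by
    simp only [pushTangent]
    rw [← appLE_res g (inf_le_inf_left U h) (inf_preimage_le g U V) (inf_preimage_le g U V'),
      ← D.2.1 ⟨U ⊓ V, inf_le_left⟩ ⟨U ⊓ V', inf_le_left⟩ (inf_le_inf_left U h), res_res, res_res]
  have hbase : ∀ V c, pushTangent g D V (π.appLE ⊤ V (le_preimage_top π V) c) = 0 := fun V c => by
    simp only [pushTangent]
    rw [res_appLE_top, D.2.2.2 ⟨U ⊓ V, inf_le_left⟩, map_zero]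
  exact ⟨hadd, hmul, hres, hbase⟩

variable {π} in
/-- The derivation along `g` induced by a vector field. -/
def derOfTangent {U : X.Opens} (D : tangentSections π U) : Der π g (g ⁻¹ᵁ U) :=
  ⟨fun j => pushTangent g D j.1 j.2, isDerAlong_pushTangent g D⟩

variable {π} in
theorem derOfTangent_ev {U : X.Opens} (D : tangentSections π U) {V : X.Opens} (hV : V ≤ U)
    {W : Y.Opens} (h : W ≤ g ⁻¹ᵁ U ⊓ g ⁻¹ᵁ V) (a : Γ(X, V)) :
    (derOfTangent g D).ev h a = g.appLE V W (h.trans inf_le_right) (D.1 ⟨V, hV⟩ a) := by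
  change res h (pushTangent g D V a) = _
  rw [pushTangent, D.2.1 ⟨V, hV⟩ ⟨U ⊓ V, inf_le_left⟩ inf_le_right,
    res_appLE g h _ (h.trans (inf_preimage_le g U V)), appLE_res_le]

/-- The canonical morphism from the tangent sheaf to derivations along `g`. -/
def tangentToDer : tangentSheaf π ⟶ (Scheme.Modules.pushforward g).obj (derSheaf π g) :=
  modulesHomMk
    (fun U => AddMonoidHom.mk' (fun D : tangentSections π U => derOfTangent g D) (fun D D' => by
      refine Subtype.ext (funext fun j => ?_)
      exact map_add _ _ _))
    (fun U V h D => by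
      refine Subtype.ext (funext fun ⟨V', a⟩ => ?_)
      change pushTangent g (tangentRestrict π h D) V' a =
        res (inf_le_inf_right (g ⁻¹ᵁ V') (g.preimage_mono h)) (pushTangent g D V' a)
      simp only [pushTangent]
      rw [← appLE_res g (inf_le_inf_right V' h) _ (inf_preimage_le g V V'),
        ← D.2.1 ⟨U ⊓ V', inf_le_left⟩ ⟨V ⊓ V', inf_le_left.trans h⟩, res_res]
      rfl)
    (fun U r D => by
      refine Subtype.ext (funext fun ⟨V', a⟩ => ?_)
      exact pushTangent_smul g r D V' a)

variable {π g}

/-- The expansion of a derivation in coordinates. -/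
theorem Der.eq_sum (C : Coordinates π) {W : Y.Opens} (hW : W ≤ g ⁻¹ᵁ C.V) (δ : Der π g W) :
    δ = ∑ i, δ.ev (le_inf le_rfl hW) (C.x i) •
      (derFamily π g).restrict hW (derOfTangent g (C.d i)) := by
  refine Der.ext_of_isAffineOpen C.isAffineOpen hW fun a => ?_
  rw [C.expand (δ.isLeibniz (le_inf le_rfl hW)) (δ.ev_base (le_inf le_rfl hW)), Der.sum_ev]
  refine Finset.sum_congr rfl fun i _ => ?_
  rw [Der.smul_ev, res_self, Der.restrict_ev, derOfTangent_ev g (C.d i) le_rfl, mul_comm]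

/-- The same expansion for functions on an open subset of the coordinate chart, which need not be
affine; this is what comparing two charts requires. -/
theorem Der.ev_eq_sum (C : Coordinates π) {W : Y.Opens} (δ : Der π g W) {V : X.Opens}
    (hV : V ≤ C.V) {W' : Y.Opens} (h : W' ≤ W ⊓ g ⁻¹ᵁ V) (a : Γ(X, V)) :
    δ.ev h a = ∑ i, δ.ev (h.trans (inf_le_inf_left W (g.preimage_mono hV))) (C.x i) *
      g.appLE V W' (h.trans inf_le_right) ((C.d i).1 ⟨V, hV⟩ a) := by
  have hW' : W' ≤ g ⁻¹ᵁ C.V := h.trans (inf_le_right.trans (g.preimage_mono hV))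
  have hV' : W' ≤ W' ⊓ g ⁻¹ᵁ V := le_inf le_rfl (h.trans inf_le_right)
  have key := Der.eq_sum C hW' ((derFamily π g).restrict (h.trans inf_le_left) δ)
  have key' := congrArg (fun δ' : Der π g W' => δ'.ev hV' a) key
  simp only [Der.sum_ev, Der.restrict_ev, Der.smul_ev, res_self,
    derOfTangent_ev g (C.d _) hV] at key'
  exact key'

/-- A vector field is a derivation along the identity, so the expansion of derivations applies with
g = 𝟙. -/
theorem tangent_eq_sum (C : Coordinates π) {U : X.Opens} (hU : U ≤ C.V) (D : tangentSections π U) :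
    D = ∑ i, D.1 ⟨U, le_rfl⟩ (res hU (C.x i)) • tangentRestrict π hU (C.d i) := by
  refine Subtype.ext (funext fun V => AddMonoidHom.ext fun a => ?_)
  have h : V.1 ≤ (𝟙 X : X ⟶ X) ⁻¹ᵁ U ⊓ (𝟙 X : X ⟶ X) ⁻¹ᵁ V.1 := le_inf V.2 le_rfl
  have key := Der.ev_eq_sum C (derOfTangent (𝟙 X) D) (V.2.trans hU) h a
  rw [derOfTangent_ev _ D V.2, id_appLE le_rfl, res_self] at key
  rw [key]
  have hsum : ∀ t : Finset (Fin C.n), (∑ i ∈ t, D.1 ⟨U, le_rfl⟩ (res hU (C.x i)) •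
      tangentRestrict π hU (C.d i)).1 V a = ∑ i ∈ t, res V.2 (D.1 ⟨U, le_rfl⟩ (res hU (C.x i))) *
        (C.d i).1 ⟨V.1, V.2.trans hU⟩ a := by
    intro t
    induction t using Finset.induction_on with
    | empty => rfl
    | insert i t hi ih => rw [Finset.sum_insert hi, Finset.sum_insert hi, ← ih]; rfl
  rw [hsum]
  refine Finset.sum_congr rfl fun i _ => ?_
  have h' : V.1 ≤ (𝟙 X : X ⟶ X) ⁻¹ᵁ U ⊓ (𝟙 X : X ⟶ X) ⁻¹ᵁ U := le_inf V.2 V.2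
  rw [id_appLE le_rfl, res_self, ← Der.ev_res (derOfTangent (𝟙 X) D) hU h',
    derOfTangent_ev _ D le_rfl, id_appLE V.2]

end Pullback
end VeryFreeCurves
end


noncomputable section

namespace VeryFreeCurves

/-! ### The universal property of the sheaf of derivations -/

section Universal

/-- An object with the universal property of `F A`, for a left adjoint `F`, is isomorphic
to `F A`. -/
theorem nonempty_iso_of_isUniversal {C D : Type*} [Category* C] [Category* D] {F : C ⥤ D}
    {G : D ⥤ C} (adj : F ⊣ G) {A : C} {B : D} (φ : A ⟶ G.obj B)
    (hext : ∀ {M : D} (u v : B ⟶ M), φ ≫ G.map u = φ ≫ G.map v → u = v)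
    (hex : ∀ {M : D} (ψ : A ⟶ G.obj M), ∃ u : B ⟶ M, φ ≫ G.map u = ψ) :
    Nonempty (F.obj A ≅ B) := by
  let α : F.obj A ⟶ B := (adj.homEquiv _ _).symm φ
  have hα : adj.unit.app A ≫ G.map α = φ :=
    (adj.homEquiv_unit (X := A) (f := α)).symm.trans ((adj.homEquiv _ _).apply_symm_apply _)
  obtain ⟨β, hβ⟩ := hex (adj.unit.app A)
  refine ⟨⟨α, β, ?_, ?_⟩⟩
  · apply (adj.homEquiv _ _).injective
    rw [adj.homEquiv_unit, adj.homEquiv_unit, Functor.map_comp, ← Category.assoc, hα, hβ,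
      CategoryTheory.Functor.map_id]
    exact (Category.comp_id _).symm
  · apply hext
    rw [Functor.map_comp, ← Category.assoc, hβ, hα, CategoryTheory.Functor.map_id, Category.comp_id]

variable {X Y S : Scheme.{u}} {π : X ⟶ S} {g : Y ⟶ X} {M : Y.Modules}

/-- The map on sections of a morphism from the tangent sheaf to a pushforward. -/
def tangentMap (ψ : tangentSheaf π ⟶ (Scheme.Modules.pushforward g).obj M) (U : X.Opens) :
    tangentSections π U →+ Γ(M, g ⁻¹ᵁ U) :=
  (ψ.app U).hom

theorem tangentMap_smul (ψ : tangentSheaf π ⟶ (Scheme.Modules.pushforward g).obj M) (U : X.Opens)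
    (r : Γ(X, U)) (D : tangentSections π U) :
    tangentMap ψ U (r • D) = g.app U r • tangentMap ψ U D :=
  ψ.app_smul (U := U) r D

theorem tangentMap_restrict (ψ : tangentSheaf π ⟶ (Scheme.Modules.pushforward g).obj M)
    {U V : X.Opens} (h : V ≤ U) (D : tangentSections π U) :
    tangentMap ψ V (tangentRestrict π h D) = mres M (g.preimage_mono h) (tangentMap ψ U D) :=
  app_mres ψ h D

/-- The map on sections of a morphism from the sheaf of derivations. -/
def derMap (u : derSheaf π g ⟶ M) (W : Y.Opens) : Der π g W →+ Γ(M, W) :=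
  (u.app W).hom

theorem derMap_smul (u : derSheaf π g ⟶ M) (W : Y.Opens) (r : Γ(Y, W)) (δ : Der π g W) :
    derMap u W (r • δ) = r • derMap u W δ :=
  u.app_smul (U := W) r δ

theorem derMap_restrict (u : derSheaf π g ⟶ M) {W W' : Y.Opens} (h : W' ≤ W) (δ : Der π g W) :
    derMap u W' ((derFamily π g).restrict h δ) = mres M h (derMap u W δ) :=
  app_mres u h δ

theorem tangentMap_comp (u : derSheaf π g ⟶ M) (U : X.Opens) (D : tangentSections π U) :
    tangentMap (tangentToDer π g ≫ (Scheme.Modules.pushforward g).map u) U D =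
      derMap u (g ⁻¹ᵁ U) (derOfTangent g D) := rfl

theorem le_iSup_coordinates (g : Y ⟶ X) (hC : ∀ p, ∃ C : Coordinates π, p ∈ C.V) (W : Y.Opens) :
    W ≤ ⨆ C : Coordinates π, W ⊓ g ⁻¹ᵁ C.V := by
  intro y hy
  obtain ⟨C, h⟩ := hC (g y)
  exact Opens.mem_iSup.mpr ⟨C, hy, h⟩

/-- A morphism from the sheaf of derivations is determined by its values on vector fields. -/
theorem derSheaf_hom_ext (hC : ∀ p, ∃ C : Coordinates π, p ∈ C.V) {u v : derSheaf π g ⟶ M}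
    (h : tangentToDer π g ≫ (Scheme.Modules.pushforward g).map u =
      tangentToDer π g ≫ (Scheme.Modules.pushforward g).map v) : u = v := by
  refine Scheme.Modules.hom_ext _ _ fun W => AddCommGrpCat.hom_ext (AddMonoidHom.ext fun δ => ?_)
  change Der π g W at δ
  change derMap u W δ = derMap v W δ
  refine mres_ext M (fun C : Coordinates π => W ⊓ g ⁻¹ᵁ C.V) (fun _ => inf_le_left)
    (le_iSup_coordinates g hC W) _ _ fun C => ?_
  -- Over a coordinate chart every derivation is a combination of images of vector fields, and on
  -- those u and v agree.
  rw [← derMap_restrict, ← derMap_restrict, Der.eq_sum C inf_le_right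
    ((derFamily π g).restrict (W' := W ⊓ g ⁻¹ᵁ C.V) inf_le_left δ), map_sum, map_sum]
  refine Finset.sum_congr rfl fun i _ => ?_
  rw [derMap_smul, derMap_smul, derMap_restrict, derMap_restrict, ← tangentMap_comp,
    ← tangentMap_comp, h]

/-- The value on a derivation of the morphism with given values on vector fields, in
coordinates. -/
def coordinateSum (ψ : tangentSheaf π ⟶ (Scheme.Modules.pushforward g).obj M) {W : Y.Opens}
    (δ : Der π g W) (C : Coordinates π) {W' : Y.Opens} (h : W' ≤ W ⊓ g ⁻¹ᵁ C.V) : Γ(M, W') :=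
  ∑ i, δ.ev h (C.x i) • mres M (h.trans inf_le_right) (tangentMap ψ C.V (C.d i))

theorem mres_coordinateSum (ψ : tangentSheaf π ⟶ (Scheme.Modules.pushforward g).obj M)
    {W : Y.Opens} (δ : Der π g W) (C : Coordinates π) {W' W'' : Y.Opens}
    (h : W' ≤ W ⊓ g ⁻¹ᵁ C.V) (h' : W'' ≤ W') :
    mres M h' (coordinateSum ψ δ C h) = coordinateSum ψ δ C (h'.trans h) := by
  simp only [coordinateSum, map_sum]
  refine Finset.sum_congr rfl fun i _ => ?_
  rw [mres_smul, Der.res_ev, mres_mres]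

/-- This is the change of coordinates: ∂'ⱼ = ∑ᵢ (∂'ⱼ xᵢ) ∂ᵢ and δ xᵢ = ∑ⱼ δ x'ⱼ · ∂'ⱼ xᵢ turn both
sides into the same double sum, by the linearity of ψ. -/
theorem coordinateSum_eq (ψ : tangentSheaf π ⟶ (Scheme.Modules.pushforward g).obj M)
    {W : Y.Opens} (δ : Der π g W) (C C' : Coordinates π) {W' : Y.Opens}
    (h : W' ≤ W ⊓ g ⁻¹ᵁ C.V) (h' : W' ≤ W ⊓ g ⁻¹ᵁ C'.V) :
    coordinateSum ψ δ C h = coordinateSum ψ δ C' h' := by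
  have hV : C.V ⊓ C'.V ≤ C.V := inf_le_left
  have hV' : C.V ⊓ C'.V ≤ C'.V := inf_le_right
  have hW : W' ≤ g ⁻¹ᵁ (C.V ⊓ C'.V) := le_inf (h.trans inf_le_right) (h'.trans inf_le_right)
  have hW' : W' ≤ W ⊓ g ⁻¹ᵁ (C.V ⊓ C'.V) := le_inf (h.trans inf_le_left) hW
  let c : Fin C'.n → Fin C.n → Γ(X, C.V ⊓ C'.V) := fun j i =>
    (C'.d j).1 ⟨C.V ⊓ C'.V, hV'⟩ (res hV (C.x i))
  have h₁ : ∀ j, mres M (h'.trans inf_le_right) (tangentMap ψ C'.V (C'.d j)) =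
      ∑ i, g.appLE _ W' hW (c j i) •
        mres M (h.trans inf_le_right) (tangentMap ψ C.V (C.d i)) := by
    intro j
    rw [← mres_mres M (g.preimage_mono hV') hW, ← tangentMap_restrict _ hV',
      tangent_eq_sum C hV (tangentRestrict π hV' (C'.d j)), map_sum, map_sum]
    refine Finset.sum_congr rfl fun i _ => ?_
    rw [tangentMap_smul, tangentMap_restrict, mres_smul, mres_mres, Scheme.Hom.app_eq_appLE,
      res_appLE g hW le_rfl hW]
    rfl
  have h₂ : ∀ i, δ.ev h (C.x i) = ∑ j, δ.ev h' (C'.x j) * g.appLE _ W' hW (c j i) := by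
    intro i
    have := Der.ev_eq_sum C' δ hV' hW' (res hV (C.x i))
    rw [Der.ev_res] at this
    exact this
  simp only [coordinateSum, h₁, h₂, Finset.sum_smul, Finset.smul_sum, mul_smul]
  exact Finset.sum_comm

/-- A morphism from the tangent sheaf to a pushforward extends to derivations. -/
theorem exists_derSheaf_hom (hC : ∀ p, ∃ C : Coordinates π, p ∈ C.V)
    (ψ : tangentSheaf π ⟶ (Scheme.Modules.pushforward g).obj M) :
    ∃ u : derSheaf π g ⟶ M, tangentToDer π g ≫ (Scheme.Modules.pushforward g).map u = ψ := by
  have hglue : ∀ (W : Y.Opens) (δ : Der π g W), ∃ m : Γ(M, W), ∀ C : Coordinates π,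
      mres M (W := W ⊓ g ⁻¹ᵁ C.V) inf_le_left m = coordinateSum ψ δ C le_rfl := by
    intro W δ
    refine exists_mglue M (fun C : Coordinates π => W ⊓ g ⁻¹ᵁ C.V) (fun _ => inf_le_left)
      (le_iSup_coordinates g hC W) _ fun C C' => ?_
    rw [mres_coordinateSum, mres_coordinateSum]
    exact coordinateSum_eq _ _ _ _ _ _
  choose m hm using hglue
  have sep : ∀ (W : Y.Opens) (x y : Γ(M, W)), (∀ C : Coordinates π,
      mres M (W := W ⊓ g ⁻¹ᵁ C.V) inf_le_left x = mres M inf_le_left y) → x = y :=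
    fun W x y => mres_ext M (fun C : Coordinates π => W ⊓ g ⁻¹ᵁ C.V) (fun _ => inf_le_left)
      (le_iSup_coordinates g hC W) x y
  have hadd : ∀ W δ δ', m W (δ + δ') = m W δ + m W δ' := fun W δ δ' => sep _ _ _ fun C => by
    rw [map_add, hm, hm, hm]
    simp only [coordinateSum, Der.add_ev, add_smul, Finset.sum_add_distrib]
  have hsmul : ∀ W (r : Γ(Y, W)) δ, m W (r • δ) = r • m W δ := fun W r δ => sep _ _ _ fun C => by
    rw [mres_smul, hm, hm]
    simp only [coordinateSum, Der.smul_ev, mul_smul, Finset.smul_sum]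
  have hres : ∀ W W' (h : W' ≤ W) δ, m W' ((derFamily π g).restrict h δ) = mres M h (m W δ) :=
    fun W W' h δ => sep _ _ _ fun C => by
      rw [hm, mres_mres, ← mres_mres M (W := W ⊓ g ⁻¹ᵁ C.V) inf_le_left
        (inf_le_inf_right (g ⁻¹ᵁ C.V) h), hm, mres_coordinateSum]
      simp only [coordinateSum, Der.restrict_ev]
  refine ⟨modulesHomMk (fun W => AddMonoidHom.mk' (m W) (hadd W)) hres hsmul, ?_⟩
  refine Scheme.Modules.hom_ext _ _ fun U => AddCommGrpCat.hom_ext (AddMonoidHom.ext fun D => ?_)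
  change tangentSections π U at D
  change m (g ⁻¹ᵁ U) (derOfTangent g D) = tangentMap ψ U D
  -- The factorization is checked over U ∩ C.V, where the vector field D itself expands in the
  -- coordinates of C.
  refine sep _ _ _ fun C => ?_
  have hV : U ⊓ C.V ≤ C.V := inf_le_right
  have hV' : U ⊓ C.V ≤ U := inf_le_left
  have hW : g ⁻¹ᵁ U ⊓ g ⁻¹ᵁ C.V ≤ g ⁻¹ᵁ (U ⊓ C.V) := le_rfl
  have hW' : g ⁻¹ᵁ U ⊓ g ⁻¹ᵁ C.V ≤ g ⁻¹ᵁ U ⊓ g ⁻¹ᵁ (U ⊓ C.V) := le_inf inf_le_left hW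
  rw [hm, ← mres_mres M (g.preimage_mono hV') hW, ← tangentMap_restrict _ hV',
    tangent_eq_sum C hV (tangentRestrict π hV' D), map_sum, map_sum]
  refine Finset.sum_congr rfl fun i _ => ?_
  rw [tangentMap_smul, tangentMap_restrict, mres_smul, mres_mres, Scheme.Hom.app_eq_appLE,
    res_appLE g hW le_rfl hW]
  congr 1
  have := Der.ev_res (derOfTangent g D) hV hW' (C.x i)
  rw [derOfTangent_ev g D hV'] at this
  exact this.symm

/-- The pullback of the tangent sheaf is the sheaf of derivations. -/
theorem nonempty_pullback_tangentSheaf_iso (hC : ∀ p, ∃ C : Coordinates π, p ∈ C.V) :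
    Nonempty ((Scheme.Modules.pullback g).obj (tangentSheaf π) ≅ derSheaf π g) :=
  nonempty_iso_of_isUniversal (Scheme.Modules.pullbackPushforwardAdjunction g) (tangentToDer π g)
    (fun _ _ h => derSheaf_hom_ext hC h) (fun ψ => exists_derSheaf_hom hC ψ)

end Universal
end VeryFreeCurves
end


noncomputable section

namespace VeryFreeCurves

/-! ### The normal sheaf along a morphism -/

section Normal

variable {X D Y S : Scheme.{u}}

/-- The families of `𝒪_X`-linear maps `I(V) → Γ(Y, W ∩ g⁻¹ V)` that are compatible with
restriction, where `I` is the ideal sheaf of `i : D ⟶ X`. -/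
structure IsNormalAlong (i : D ⟶ X) (g : Y ⟶ X) (W : Y.Opens)
    (s : ∀ j : (V : X.Opens) × RingHom.ker (i.app V).hom, Γ(Y, W ⊓ g ⁻¹ᵁ j.1)) : Prop where
  add : ∀ V b b', s ⟨V, b + b'⟩ = s ⟨V, b⟩ + s ⟨V, b'⟩
  smul : ∀ V (a : Γ(X, V)) b, s ⟨V, a • b⟩ = g.appLE V _ inf_le_right a * s ⟨V, b⟩
  res : ∀ V V' (h : V' ≤ V) b b', b'.1 = res h b.1 →
    s ⟨V', b'⟩ = res (inf_le_inf_left W (g.preimage_mono h)) (s ⟨V, b⟩)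

/-- The normal sheaf of `i : D ⟶ X` along `g : Y ⟶ X`. -/
def normalFamily (i : D ⟶ X) (g : Y ⟶ X) : LocalFamily Y where
  J := (V : X.Opens) × RingHom.ker (i.app V).hom
  c j := g ⁻¹ᵁ j.1
  carrier W :=
    { carrier := {s | IsNormalAlong i g W s}
      zero_mem' := ⟨by simp, by simp, by simp⟩
      add_mem' := fun {s t} hs ht => ⟨fun V b b' => by simp [hs.add, ht.add]; abel,
        fun V a b => by simp [hs.smul, ht.smul]; ring,
        fun V V' h b b' hb => by simp [hs.res V V' h b b' hb, ht.res V V' h b b' hb]⟩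
      neg_mem' := fun {s} hs => ⟨fun V b b' => by simp [hs.add]; abel,
        fun V a b => by simp [hs.smul],
        fun V V' h b b' hb => by simp [hs.res V V' h b b' hb]⟩ }
  smul_mem := fun {W} r {s} hs => ⟨fun V b b' => by simp only [hs.add]; ring,
        fun V a b => by simp only [hs.smul]; ring, fun V V' h b b' hb => by
          simp only [hs.res V V' h b b' hb, map_mul, res_res]⟩
  res_mem := fun {W W'} hW {s} hs => ⟨fun V b b' => by simp only [hs.add, map_add],
        fun V a b => by
          simp only [hs.smul, map_mul]
          rw [res_appLE g _ _ inf_le_right],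
        fun V V' h b b' hb => by simp only [hs.res V V' h b b' hb, res_res]⟩
  locality := fun {ι} U s hs => by
    have hcov : ∀ A : Y.Opens, iSup U ⊓ A ≤ ⨆ i, U i ⊓ A := fun A => by rw [iSup_inf_eq]
    have hmap : ∀ (i : ι) (A : Y.Opens), U i ⊓ A ≤ iSup U ⊓ A := fun i A =>
      inf_le_inf_right A (le_iSup U i)
    refine ⟨fun V b b' => ?_, fun V a b => ?_, fun V V' h b b' hb => ?_⟩ <;>
      refine res_ext (fun i => U i ⊓ _) (fun i => hmap i _) (hcov _) _ _ fun i => ?_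
    · rw [map_add]; exact (hs i).add V b b'
    · rw [map_mul, res_appLE g _ _ inf_le_right]
      exact (hs i).smul V a b
    · refine ((hs i).res V V' h b b' hb).trans ?_
      simp only [res_res]

/-- Sections over `W` of the normal sheaf along `g`. -/
abbrev Normal (i : D ⟶ X) (g : Y ⟶ X) (W : Y.Opens) : Type u := (normalFamily i g).carrier W

/-- The normal sheaf along `g`. -/
def normalSheaf (i : D ⟶ X) (g : Y ⟶ X) : Y.Modules := (normalFamily i g).sheaf

variable {i : D ⟶ X} {g : Y ⟶ X}

/-- The value of a section of the normal sheaf on a function vanishing on `D`. -/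
def Normal.fn {W : Y.Opens} (s : Normal i g W) (V : X.Opens) (b : Γ(X, V)) (hb : i.app V b = 0) :
    Γ(Y, W ⊓ g ⁻¹ᵁ V) :=
  s.1 ⟨V, ⟨b, hb⟩⟩

/-- The value of a section of the normal sheaf on a function vanishing on `D`, restricted
to `W'`. -/
def Normal.ev {W : Y.Opens} (s : Normal i g W) {V : X.Opens} {W' : Y.Opens}
    (h : W' ≤ W ⊓ g ⁻¹ᵁ V) (b : Γ(X, V)) (hb : i.app V b = 0) : Γ(Y, W') :=
  res h (s.fn V b hb)

theorem Normal.ev_mul {W : Y.Opens} (s : Normal i g W) {V : X.Opens} {W' : Y.Opens}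
    (h : W' ≤ W ⊓ g ⁻¹ᵁ V) (a b : Γ(X, V)) (hb : i.app V b = 0) (hab : i.app V (a * b) = 0) :
    s.ev h (a * b) hab = g.appLE V W' (h.trans inf_le_right) a * s.ev h b hb := by
  have : s.fn V (a * b) hab = g.appLE V _ inf_le_right a * s.fn V b hb := s.2.smul V a ⟨b, hb⟩
  rw [Normal.ev, this, map_mul, res_appLE g _ _ (h.trans inf_le_right)]
  rfl

theorem Normal.ev_congr {W : Y.Opens} (s : Normal i g W) {V V' : X.Opens} {W' : Y.Opens}
    (hV : V' ≤ V) (h : W' ≤ W ⊓ g ⁻¹ᵁ V') {b : Γ(X, V)} (hb : i.app V b = 0) {b' : Γ(X, V')}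
    (hb' : i.app V' b' = 0) (hbb' : b' = res hV b) :
    s.ev h b' hb' = s.ev (h.trans (inf_le_inf_left W (g.preimage_mono hV))) b hb :=
  (congrArg (VeryFreeCurves.res h) (s.2.res V V' hV ⟨b, hb⟩ ⟨b', hb'⟩ hbb')).trans (res_res _ _ _)

theorem Normal.res_ev {W : Y.Opens} (s : Normal i g W) {V : X.Opens} {W' W'' : Y.Opens}
    (h : W' ≤ W ⊓ g ⁻¹ᵁ V) (h' : W'' ≤ W') (b : Γ(X, V)) (hb : i.app V b = 0) :
    res h' (s.ev h b hb) = s.ev (h'.trans h) b hb :=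
  res_res _ _ _

theorem Normal.restrict_ev {W : Y.Opens} (s : Normal i g W) {W₁ : Y.Opens} (hW : W₁ ≤ W)
    {V : X.Opens} {W' : Y.Opens} (h : W' ≤ W₁ ⊓ g ⁻¹ᵁ V) (b : Γ(X, V)) (hb : i.app V b = 0) :
    Normal.ev (i := i) (g := g) ((normalFamily i g).restrict hW s) h b hb =
      s.ev (h.trans (inf_le_inf_right _ hW)) b hb :=
  res_res _ _ _

theorem Normal.smul_ev {W : Y.Opens} (r : Γ(Y, W)) (s : Normal i g W) {V : X.Opens}
    {W' : Y.Opens} (h : W' ≤ W ⊓ g ⁻¹ᵁ V) (b : Γ(X, V)) (hb : i.app V b = 0) :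
    Normal.ev (r • s) h b hb = res (h.trans inf_le_left) r * s.ev h b hb :=
  (map_mul (VeryFreeCurves.res h) _ _).trans (congrArg (· * s.ev h b hb) (res_res _ _ _))

/-- The ideal sheaf of `i` is freely generated over `V` by `a`. -/
structure IsIdealGenerator (i : D ⟶ X) (V : X.Opens) (a : Γ(X, V)) : Prop where
  app_eq_zero : i.app V a = 0
  existsUnique : ∀ (V' : X.Opens) (h : V' ≤ V) (b : Γ(X, V')), i.app V' b = 0 →
    ∃! c : Γ(X, V'), b = c * res h a

theorem app_res {V V' : X.Opens} (h : V' ≤ V) {a : Γ(X, V)} (ha : i.app V a = 0) :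
    i.app V' (res h a) = 0 := by
  rw [Scheme.Hom.app_eq_appLE, appLE_res i h le_rfl le_rfl (i.preimage_mono h),
    ← Scheme.Hom.app_eq_appLE, ha, map_zero]

/-- Since W lies over V, the set W ∩ g⁻¹ V' lies over V' ∩ V. There a function vanishing on D is c ·
a, and linearity reduces its value to the value at a. -/
theorem Normal.ext_of_isIdealGenerator {V : X.Opens} {a : Γ(X, V)} (ha : IsIdealGenerator i V a)
    {W : Y.Opens} (hW : W ≤ g ⁻¹ᵁ V) {s t : Normal i g W}
    (h : s.ev (le_inf le_rfl hW) a ha.app_eq_zero = t.ev (le_inf le_rfl hW) a ha.app_eq_zero) :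
    s = t := by
  have key : ∀ (V' : X.Opens) (b : Γ(X, V')) (hb : i.app V' b = 0), s.fn V' b hb = t.fn V' b hb := by
    intro V' b hb
    have hle : W ⊓ g ⁻¹ᵁ V' ≤ W ⊓ g ⁻¹ᵁ (V' ⊓ V) :=
      le_inf inf_le_left (le_inf inf_le_right (inf_le_left.trans hW))
    obtain ⟨c, hc, -⟩ := ha.existsUnique (V' ⊓ V) inf_le_right (VeryFreeCurves.res inf_le_left b)
      (app_res _ hb)
    have hca : i.app (V' ⊓ V) (c * VeryFreeCurves.res inf_le_right a) = 0 := hc ▸ app_res _ hb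
    have hval : ∀ u : Normal i g W, u.fn V' b hb = g.appLE (V' ⊓ V) _ (hle.trans inf_le_right) c *
        VeryFreeCurves.res inf_le_left (u.ev (le_inf le_rfl hW) a ha.app_eq_zero) := by
      intro u
      have h₁ := u.ev_congr inf_le_left hle hb hca hc.symm
      have h₂ := u.ev_congr inf_le_right hle ha.app_eq_zero (app_res _ ha.app_eq_zero) rfl
      rw [u.ev_mul hle _ _ (app_res _ ha.app_eq_zero), h₂] at h₁
      rw [u.res_ev]
      refine Eq.trans ?_ h₁.symm
      exact (res_self _ _).symm
    rw [hval s, hval t, h]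
  exact Subtype.ext (funext fun j => key j.1 j.2.1 j.2.2)

/-- The value at b is the pullback of the coefficient c in b = c · a, multiplied by r. Uniqueness of
c makes this additive, linear and compatible with restriction. With the preceding lemma, the normal
sheaf is free of rank one where the ideal has a generator. -/
theorem Normal.exists_of_isIdealGenerator {V : X.Opens} {a : Γ(X, V)}
    (ha : IsIdealGenerator i V a) {W : Y.Opens} (hW : W ≤ g ⁻¹ᵁ V) (r : Γ(Y, W)) :
    ∃ s : Normal i g W, s.ev (le_inf le_rfl hW) a ha.app_eq_zero = r := by
  have hle : ∀ V' : X.Opens, W ⊓ g ⁻¹ᵁ V' ≤ g ⁻¹ᵁ (V' ⊓ V) := fun V' =>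
    le_inf inf_le_right (inf_le_left.trans hW)
  choose c hc hc' using fun (V' : X.Opens) (b : RingHom.ker (i.app V').hom) =>
    ha.existsUnique (V' ⊓ V) inf_le_right (VeryFreeCurves.res inf_le_left b.1) (app_res _ b.2)
  beta_reduce at hc hc'
  let s : ∀ (V' : X.Opens) (b : RingHom.ker (i.app V').hom), Γ(Y, W ⊓ g ⁻¹ᵁ V') := fun V' b =>
    g.appLE (V' ⊓ V) _ (hle V') (c V' b) * VeryFreeCurves.res inf_le_left r
  have hadd : ∀ V' b b', s V' (b + b') = s V' b + s V' b' := fun V' b b' => by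
    have : c V' (b + b') = c V' b + c V' b' :=
      (hc' V' (b + b') _ (by rw [add_mul, ← hc, ← hc, ← map_add]; rfl)).symm
    simp only [s, this, map_add, add_mul]
  have hsmul : ∀ V' (a' : Γ(X, V')) b, s V' (a' • b) =
      g.appLE V' _ inf_le_right a' * s V' b := fun V' a' b => by
    have : c V' (a' • b) = VeryFreeCurves.res inf_le_left a' * c V' b :=
      (hc' V' (a' • b) _ (by rw [mul_assoc, ← hc, ← map_mul]; rfl)).symm
    simp only [s, this, map_mul]
    rw [appLE_res_le g inf_le_left _ inf_le_right, mul_assoc]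
  have hres : ∀ V₁ V₂ (h : V₂ ≤ V₁) b b', b'.1 = VeryFreeCurves.res h b.1 →
      s V₂ b' = VeryFreeCurves.res (inf_le_inf_left W (g.preimage_mono h)) (s V₁ b) := by
    intro V₁ V₂ h b b' hbb'
    have : c V₂ b' = VeryFreeCurves.res (inf_le_inf_right V h) (c V₁ b) := by
      refine (hc' V₂ b' _ ?_).symm
      have := congrArg (VeryFreeCurves.res (inf_le_inf_right V h)) (hc V₁ b)
      rw [map_mul, res_res, res_res] at this
      rw [← this, hbb', res_res]
    simp only [s, this, map_mul]
    rw [res_res, res_appLE g _ _ ((inf_le_inf_left W (g.preimage_mono h)).trans (hle V₁)),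
      appLE_res_le]
  refine ⟨⟨fun j => s j.1 j.2, ⟨hadd, hsmul, hres⟩⟩, ?_⟩
  have h1 : c V ⟨a, ha.app_eq_zero⟩ = 1 := (hc' V _ _ (by rw [one_mul])).symm
  change VeryFreeCurves.res _ (s V ⟨a, ha.app_eq_zero⟩) = r
  simp only [s, h1, map_one, one_mul]
  rw [res_res, res_self]

end Normal
end VeryFreeCurves
end


noncomputable section

namespace VeryFreeCurves

/-! ### The normal sequence -/

section NormalSequence

variable {X D Y S : Scheme.{u}}

/-- A sequence of sheaves of modules is short exact: left exact on sections and locally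
surjective. -/
structure SectionExact {A B C : Y.Modules} (f : A ⟶ B) (q : B ⟶ C) : Prop where
  injective : ∀ W, Function.Injective (f.app W)
  zero : ∀ W x, q.app W (f.app W x) = 0
  exact : ∀ W x, q.app W x = 0 → ∃ y, f.app W y = x
  surjective : ∀ (W : Y.Opens) (x : Γ(C, W)) (p : Y), p ∈ W →
    ∃ (W' : Y.Opens) (h : W' ≤ W), p ∈ W' ∧ ∃ y : Γ(B, W'), q.app W' y = mres C h x

/-- Sections that are locally in the image of an injective morphism are in the image. -/
theorem exists_of_locally_exists {A B : Y.Modules} {f : A ⟶ B}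
    (hf : ∀ W, Function.Injective (f.app W)) (W : Y.Opens) (x : Γ(B, W))
    (h : ∀ p ∈ W, ∃ (W' : Y.Opens) (h : W' ≤ W), p ∈ W' ∧ ∃ y : Γ(A, W'), f.app W' y = mres B h x) :
    ∃ y, f.app W y = x := by
  choose W' hW' hp y hy using fun p : W => h p.1 p.2
  have hcov : W ≤ iSup W' := fun p hpW => Opens.mem_iSup.mpr ⟨⟨p, hpW⟩, hp _⟩
  obtain ⟨z, hz⟩ := exists_mglue A W' hW' hcov y fun p p' => by
    apply hf
    rw [app_mres, app_mres, hy, hy, mres_mres, mres_mres]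
  refine ⟨z, mres_ext B W' hW' hcov _ _ fun p => ?_⟩
  rw [← app_mres, hz, hy]

variable (π : X ⟶ S) (i : D ⟶ X) (h : Y ⟶ D)

theorem comp_appLE_apply (V : X.Opens) (W : Y.Opens) (e : W ≤ (h ≫ i) ⁻¹ᵁ V) (a : Γ(X, V)) :
    (h ≫ i).appLE V W e a = h.appLE (i ⁻¹ᵁ V) W e (i.app V a) := by
  rw [Scheme.Hom.comp_appLE]
  rfl

/-- Composition of a derivation along `h` with restriction of functions to `D`. -/
def derComp {W : Y.Opens} (δ : Der (i ≫ π) h W) : Der π (h ≫ i) W :=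
  ⟨fun j => δ.fn (i ⁻¹ᵁ j.1) (i.app j.1 j.2), by
    have hadd : ∀ (V : X.Opens) (a b : Γ(X, V)), δ.fn (i ⁻¹ᵁ V) (i.app V (a + b)) =
        δ.fn (i ⁻¹ᵁ V) (i.app V a) + δ.fn (i ⁻¹ᵁ V) (i.app V b) := fun V a b => by
      rw [map_add]; exact δ.2.add _ _ _
    have hmul : ∀ (V : X.Opens) (a b : Γ(X, V)), δ.fn (i ⁻¹ᵁ V) (i.app V (a * b)) =
        (h ≫ i).appLE V (W ⊓ h ⁻¹ᵁ i ⁻¹ᵁ V) inf_le_right a * δ.fn (i ⁻¹ᵁ V) (i.app V b) +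
        (h ≫ i).appLE V (W ⊓ h ⁻¹ᵁ i ⁻¹ᵁ V) inf_le_right b * δ.fn (i ⁻¹ᵁ V) (i.app V a) :=
      fun V a b => by
        rw [map_mul]
        refine (δ.2.mul _ _ _).trans ?_
        exact congrArg₂ (· + ·)
          (congrArg (· * δ.fn (i ⁻¹ᵁ V) (i.app V b)) (comp_appLE_apply i h V _ _ a).symm)
          (congrArg (· * δ.fn (i ⁻¹ᵁ V) (i.app V a)) (comp_appLE_apply i h V _ _ b).symm)
    have hres : ∀ (V V' : X.Opens) (e : V' ≤ V) (a : Γ(X, V)),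
        δ.fn (i ⁻¹ᵁ V') (i.app V' (res e a)) =
          res (inf_le_inf_left W ((h ≫ i).preimage_mono e)) (δ.fn (i ⁻¹ᵁ V) (i.app V a)) :=
      fun V V' e a => by
        have : i.app V' (res e a) = res (i.preimage_mono e) (i.app V a) := by
          rw [Scheme.Hom.app_eq_appLE, Scheme.Hom.app_eq_appLE]
          exact appLE_res i e le_rfl le_rfl (i.preimage_mono e) a
        rw [this]
        exact δ.2.res _ _ (i.preimage_mono e) _
    have hbase : ∀ (V : X.Opens) (c : Γ(S, ⊤)),
        δ.fn (i ⁻¹ᵁ V) (i.app V (π.appLE ⊤ V (le_preimage_top π V) c)) = 0 := fun V c => by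
      refine Eq.trans ?_ (δ.2.base (i ⁻¹ᵁ V) c)
      refine congrArg (δ.fn (i ⁻¹ᵁ V)) ?_
      rw [← CommRingCat.comp_apply, Scheme.Hom.app_eq_appLE, Scheme.Hom.appLE_comp_appLE]
    exact ⟨hadd, hmul, hres, hbase⟩⟩

theorem derComp_ev {W : Y.Opens} (δ : Der (i ≫ π) h W) {V : X.Opens} {W' : Y.Opens}
    (e : W' ≤ W ⊓ (h ≫ i) ⁻¹ᵁ V) (a : Γ(X, V)) :
    (derComp π i h δ).ev e a = δ.ev (V := i ⁻¹ᵁ V) e (i.app V a) := rfl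

/-- The inclusion of the derivations along `h : Y ⟶ D` into those along `h ≫ i : Y ⟶ X`. -/
def derCompHom : derSheaf (i ≫ π) h ⟶ derSheaf π (h ≫ i) :=
  modulesHomMk (fun W => AddMonoidHom.mk' (fun δ : Der (i ≫ π) h W => derComp π i h δ)
    (fun _ _ => rfl)) (fun _ _ _ _ => rfl) (fun _ _ _ => rfl)

/-- The restriction of a derivation to functions vanishing on `D`. -/
def derToNormal {W : Y.Opens} (δ : Der π (h ≫ i) W) : Normal i (h ≫ i) W :=
  ⟨fun j => δ.fn j.1 j.2.1, by
    have hsmul : ∀ (V : X.Opens) (a b : Γ(X, V)) (_ : i.app V b = 0), δ.fn V (a * b) =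
        (h ≫ i).appLE V (W ⊓ (h ≫ i) ⁻¹ᵁ V) inf_le_right a * δ.fn V b := fun V a b hb => by
      have hm : δ.fn V (a * b) = (h ≫ i).appLE V (W ⊓ (h ≫ i) ⁻¹ᵁ V) inf_le_right a * δ.fn V b +
          (h ≫ i).appLE V (W ⊓ (h ≫ i) ⁻¹ᵁ V) inf_le_right b * δ.fn V a := δ.2.mul V a b
      have : (h ≫ i).appLE V (W ⊓ (h ≫ i) ⁻¹ᵁ V) inf_le_right b = 0 := by
        rw [comp_appLE_apply, hb, map_zero]
      rw [hm, this, zero_mul, add_zero]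
    exact ⟨fun V b b' => δ.2.add V b.1 b'.1, fun V a b => hsmul V a b.1 b.2,
      fun V V' e b b' hb => (congrArg (δ.fn V') hb).trans (δ.2.res V V' e b.1)⟩⟩

theorem derToNormal_ev {W : Y.Opens} (δ : Der π (h ≫ i) W) {V : X.Opens} {W' : Y.Opens}
    (e : W' ≤ W ⊓ (h ≫ i) ⁻¹ᵁ V) (b : Γ(X, V)) (hb : i.app V b = 0) :
    (derToNormal π i h δ).ev e b hb = δ.ev e b := rfl

/-- The restriction of derivations to functions vanishing on `D`. -/
def derToNormalHom : derSheaf π (h ≫ i) ⟶ normalSheaf i (h ≫ i) :=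
  modulesHomMk (fun W => AddMonoidHom.mk' (fun δ : Der π (h ≫ i) W => derToNormal π i h δ)
    (fun _ _ => rfl)) (fun _ _ _ _ => rfl) (fun _ _ _ => rfl)

/-- A generator of the ideal of `D` on an affine open subset, with a normal vector field
along `D`. -/
structure NormalChart where
  /-- The affine open subset. -/
  V : X.Opens
  isAffineOpen : IsAffineOpen V
  /-- The equation of `D`. -/
  a : Γ(X, V)
  isIdealGenerator : IsIdealGenerator i V a
  /-- The normal vector field. -/
  θ : Γ(X, V) → Γ(D, i ⁻¹ᵁ V)
  isLeibniz : IsLeibniz (i.app V).hom θ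
  θ_base : ∀ c, θ (π.appLE ⊤ V (le_preimage_top π V) c) = 0
  θ_a : θ a = 1

theorem le_iSup_isAffineOpen (g : Y ⟶ X) (W : Y.Opens) (p : Y) (hp : p ∈ W) :
    ∃ V : X.Opens, IsAffineOpen V ∧ p ∈ W ⊓ g ⁻¹ᵁ V := by
  obtain ⟨V, hV, hpV, -⟩ := exists_isAffineOpen_mem_and_subset (x := g p) (U := ⊤) trivial
  exact ⟨V, hV, hp, hpV⟩

/-- Over an affine V, every function on D ∩ V lifts to V, so a derivation of functions on D is
determined by its values on restrictions from X. -/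
theorem derComp_injective [IsClosedImmersion i] (W : Y.Opens) :
    Function.Injective (derComp π i h (W := W)) := by
  intro δ δ' hδ
  refine Subtype.ext (funext fun ⟨V', b⟩ => ?_)
  choose V hV hp using le_iSup_isAffineOpen (h ≫ i) W
  have hcov : W ⊓ h ⁻¹ᵁ V' ≤ ⨆ p : W, W ⊓ h ⁻¹ᵁ V' ⊓ (h ≫ i) ⁻¹ᵁ V p.1 p.2 := fun p hpW =>
    Opens.mem_iSup.mpr ⟨⟨p, hpW.1⟩, hpW, (hp p hpW.1).2⟩
  refine res_ext _ (fun p => inf_le_left) hcov _ _ fun p => ?_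
  set V₀ := V p.1 p.2
  have haff : IsAffineOpen (i ⁻¹ᵁ V₀) := (hV p.1 p.2).preimage i
  have key : (derFamily (i ≫ π) h).restrict (W' := W ⊓ (h ≫ i) ⁻¹ᵁ V₀) inf_le_left δ =
      (derFamily (i ≫ π) h).restrict inf_le_left δ' := by
    refine Der.ext_of_isAffineOpen haff (W := W ⊓ (h ≫ i) ⁻¹ᵁ V₀) inf_le_right fun a => ?_
    obtain ⟨a, rfl⟩ := i.app_surjective V₀ (hV p.1 p.2) a
    rw [Der.restrict_ev, Der.restrict_ev]
    have := congrArg (fun ε : Der π (h ≫ i) W => ε.ev (V := V₀) (W' := W ⊓ (h ≫ i) ⁻¹ᵁ V₀) le_rfl a) hδ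
    exact this
  have hle : W ⊓ h ⁻¹ᵁ V' ⊓ (h ≫ i) ⁻¹ᵁ V₀ ≤ W ⊓ (h ≫ i) ⁻¹ᵁ V₀ ⊓ h ⁻¹ᵁ V' :=
    le_inf (inf_le_inf_right _ inf_le_left) (inf_le_left.trans inf_le_right)
  have := congrArg (fun ε : Der (i ≫ π) h (W ⊓ (h ≫ i) ⁻¹ᵁ V₀) => ε.ev (V := V') hle b) key
  simp only [Der.restrict_ev] at this
  exact this

/-- In the middle, a derivation that kills the ideal of D descends to functions on D. On the right,
a normal vector field with value 1 on the equation provides local lifts. -/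
theorem sectionExact_normal [IsClosedImmersion i]
    (hN : ∀ p : D, ∃ C : NormalChart π i, i p ∈ C.V) :
    SectionExact (derCompHom π i h) (derToNormalHom π i h) := by
  have hinj : ∀ W, Function.Injective ((derCompHom π i h).app W) := fun W =>
    derComp_injective π i h W
  refine ⟨hinj, fun W δ => ?_, fun W δ hδ => ?_, fun W s p hp => ?_⟩
  · change Der (i ≫ π) h W at δ
    have : ∀ (V : X.Opens) (b : Γ(X, V)) (hb : i.app V b = 0),
        (derToNormal π i h (derComp π i h δ)).fn V b hb = 0 := fun V b hb => by
      change δ.fn (i ⁻¹ᵁ V) (i.app V b) = 0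
      rw [hb]
      have h0 := (δ.isLeibniz (V := i ⁻¹ᵁ V) (W' := W ⊓ h ⁻¹ᵁ (i ⁻¹ᵁ V)) le_rfl).zero
      rw [Der.ev, res_self] at h0
      exact h0
    exact Subtype.ext (funext fun j => this j.1 j.2.1 j.2.2)
  · change Der π (h ≫ i) W at δ
    have hδ' : ∀ (V : X.Opens) (b : Γ(X, V)) (_ : i.app V b = 0) (W' : Y.Opens)
        (e : W' ≤ W ⊓ (h ≫ i) ⁻¹ᵁ V), δ.ev e b = 0 := fun V b hb W' e => by
      have := congrArg (fun s : Normal i (h ≫ i) W => s.ev e b hb) hδ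
      exact this.trans (map_zero (res e))
    refine exists_of_locally_exists hinj W δ fun p hp => ?_
    obtain ⟨V, hV, hpV⟩ := le_iSup_isAffineOpen (h ≫ i) W p hp
    refine ⟨W ⊓ (h ≫ i) ⁻¹ᵁ V, inf_le_left, hpV, ?_⟩
    have haff : IsAffineOpen (i ⁻¹ᵁ V) := hV.preimage i
    have hsurj := i.app_surjective V hV
    let W' := W ⊓ (h ≫ i) ⁻¹ᵁ V
    have hL := δ.isLeibniz (V := V) (W' := W') le_rfl
    -- The lift to V is chosen arbitrarily; two lifts differ by a function vanishing on D, which δ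
    -- kills.
    let d : Γ(D, i ⁻¹ᵁ V) → Γ(Y, W') := fun b => δ.ev le_rfl (Function.surjInv hsurj b)
    have hd : ∀ a : Γ(X, V), d (i.app V a) = δ.ev le_rfl a := fun a => by
      have h0 : i.app V (Function.surjInv hsurj (i.app V a) - a) = 0 := by
        rw [map_sub, Function.surjInv_eq hsurj, sub_self]
      have h1 := hL.add (Function.surjInv hsurj (i.app V a) - a) a
      rw [sub_add_cancel, hδ' V _ h0, zero_add] at h1
      exact h1
    have hLd : IsLeibniz (h.appLE (i ⁻¹ᵁ V) W' inf_le_right).hom d := by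
      refine ⟨fun b b' => ?_, fun b b' => ?_⟩ <;> obtain ⟨a, rfl⟩ := hsurj b <;>
        obtain ⟨a', rfl⟩ := hsurj b'
      · rw [← map_add, hd, hd, hd, hL.add]
      · rw [← map_mul, hd, hd, hd, hL.mul]
        change (h ≫ i).appLE V W' _ a * _ + (h ≫ i).appLE V W' _ a' * _ = _
        rw [comp_appLE_apply, comp_appLE_apply]
    obtain ⟨ε, hε⟩ := Der.exists_of_isAffineOpen (π := i ≫ π) haff (W := W') inf_le_right hLd
      fun c => by
        have : (i ≫ π).appLE ⊤ (i ⁻¹ᵁ V) (le_preimage_top _ _) c =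
            i.app V (π.appLE ⊤ V (le_preimage_top π V) c) := by
          rw [← CommRingCat.comp_apply, Scheme.Hom.app_eq_appLE, Scheme.Hom.appLE_comp_appLE]
        rw [this, hd, δ.ev_base]
    refine ⟨ε, ?_⟩
    change derComp π i h ε = (derFamily π (h ≫ i)).restrict inf_le_left δ
    refine Der.ext_of_isAffineOpen hV inf_le_right fun a => ?_
    rw [derComp_ev, Der.restrict_ev]
    exact (hε _).trans (hd a)
  · change Normal i (h ≫ i) W at s
    obtain ⟨C, hC⟩ := hN (h p)
    let W' := W ⊓ (h ≫ i) ⁻¹ᵁ C.V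
    refine ⟨W', inf_le_left, ⟨hp, hC⟩, ?_⟩
    -- The normal vector field pulled back to the curve has value 1 on the equation. Multiplied by
    -- the value r of s on the equation, it lifts s, because a section of the normal sheaf is
    -- determined by that value.
    have hLd : IsLeibniz ((h ≫ i).appLE C.V W' inf_le_right).hom
        (fun a => h.appLE (i ⁻¹ᵁ C.V) W' inf_le_right (C.θ a)) := by
      convert C.isLeibniz.map (h.appLE (i ⁻¹ᵁ C.V) W' inf_le_right).hom using 1
      exact RingHom.ext fun a => comp_appLE_apply i h C.V W' _ a
    obtain ⟨ε, hε⟩ := Der.exists_of_isAffineOpen (π := π) C.isAffineOpen (W := W') inf_le_right hLd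
      fun c => by rw [C.θ_base, map_zero]
    let r : Γ(Y, W') := s.ev le_rfl C.a C.isIdealGenerator.app_eq_zero
    refine ⟨(r • ε : Der π (h ≫ i) W'), ?_⟩
    change derToNormal π i h (r • ε) = (normalFamily i (h ≫ i)).restrict inf_le_left s
    refine Normal.ext_of_isIdealGenerator C.isIdealGenerator inf_le_right ?_
    rw [derToNormal_ev, Normal.restrict_ev, Der.smul_ev, hε, C.θ_a, map_one, mul_one, res_self]

end NormalSequence
end VeryFreeCurves
end


noncomputable section

namespace VeryFreeCurves

/-! ### Cohomology -/

section Cohomology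

open Abelian

variable {Y : Scheme.{u}}

variable (Y) in
/-- Sheaves of abelian groups on a scheme. -/
abbrev AbSheaf := Sheaf (Opens.grothendieckTopology Y) AddCommGrpCat.{u}

/-- The underlying sheaf of abelian groups. -/
abbrev toAbSheaf (M : Y.Modules) : AbSheaf Y := ⟨M.presheaf, M.isSheaf⟩

/-- The underlying morphism of sheaves of abelian groups. -/
abbrev toAbSheafMap {M N : Y.Modules} (f : M ⟶ N) : toAbSheaf M ⟶ toAbSheaf N := ⟨f.mapPresheaf⟩

/-- Restriction of sections of a sheaf of abelian groups. -/
abbrev sres (F : AbSheaf Y) {U V : Y.Opens} (h : V ≤ U) :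
    F.obj.obj (op U) →+ F.obj.obj (op V) :=
  (F.obj.map (homOfLE h).op).hom

theorem sres_sres (F : AbSheaf Y) {U V W : Y.Opens} (h : V ≤ U) (h' : W ≤ V)
    (x : F.obj.obj (op U)) : sres F h' (sres F h x) = sres F (h'.trans h) x := by
  simp only [← AddCommGrpCat.comp_apply, ← Functor.map_comp]; rfl

theorem app_sres {F G : AbSheaf Y} (f : F ⟶ G) {U V : Y.Opens} (h : V ≤ U)
    (x : F.obj.obj (op U)) : f.hom.app (op V) (sres F h x) = sres G h (f.hom.app (op U) x) :=
  ConcreteCategory.congr_hom (f.hom.naturality (homOfLE h).op) x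

theorem sres_ext (F : AbSheaf Y) {ι : Type*} {V : Y.Opens} (U : ι → Y.Opens)
    (hU : ∀ j, U j ≤ V) (hV : V ≤ iSup U) (s t : F.obj.obj (op V))
    (h : ∀ j, sres F (hU j) s = sres F (hU j) t) : s = t :=
  TopCat.Sheaf.eq_of_locally_eq' F U V (fun j => homOfLE (hU j)) hV s t h

theorem exists_sglue (F : AbSheaf Y) {ι : Type*} {V : Y.Opens} (U : ι → Y.Opens)
    (hU : ∀ j, U j ≤ V) (hV : V ≤ iSup U) (s : ∀ j, F.obj.obj (op (U j)))
    (h : ∀ j l, sres F (V := U j ⊓ U l) inf_le_left (s j) = sres F inf_le_right (s l)) :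
    ∃ t : F.obj.obj (op V), ∀ j, sres F (hU j) t = s j :=
  (TopCat.Sheaf.existsUnique_gluing' F U V (fun j => homOfLE (hU j)) hV s h).exists

/-- A short exact sequence of sheaves of abelian groups is left exact on sections. -/
theorem exists_of_shortExact {S : ShortComplex (AbSheaf Y)} (hS : S.ShortExact) (U : Y.Opens)
    (x : S.X₂.obj.obj (op U)) (hx : S.g.hom.app (op U) x = 0) :
    ∃ y, S.f.hom.app (op U) y = x := by
  let Φ : AbSheaf Y ⥤ AddCommGrpCat.{u} :=
    sheafToPresheaf (Opens.grothendieckTopology Y) AddCommGrpCat.{u} ⋙ (evaluation _ _).obj (op U)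
  have := hS.mono_f
  have : Φ.PreservesZeroMorphisms := ⟨fun _ _ => rfl⟩
  have h := hS.exact.map_of_mono_of_preservesKernel Φ inferInstance inferInstance
  rw [ShortComplex.ab_exact_iff] at h
  exact h x hx

/-- In a short exact sequence of sheaves of abelian groups, sections of the quotient lift
locally. -/
theorem exists_local_lift_of_shortExact {S : ShortComplex (AbSheaf Y)} (hS : S.ShortExact)
    (U : Y.Opens) (x : S.X₃.obj.obj (op U)) (p : Y) (hp : p ∈ U) :
    ∃ (V : Y.Opens) (h : V ≤ U), p ∈ V ∧ ∃ y, S.g.hom.app (op V) y = sres S.X₃ h x := by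
  have hloc : Sheaf.IsLocallySurjective S.g :=
    (Sheaf.isLocallySurjective_iff_epi' AddCommGrpCat.{u} S.g).mpr hS.epi_g
  obtain ⟨V, f, ⟨y, hy⟩, hpV⟩ := Presheaf.imageSieve_mem (Opens.grothendieckTopology Y) S.g.hom
    (U := op U) x p hp
  exact ⟨V, f.le, hpV, y, hy⟩

/-- Injectivity on sections and local surjectivity give a monomorphism and an epimorphism of abelian
sheaves. Left exactness on sections makes the first map a kernel of the second. -/
theorem shortExact_of_sectionExact {A B C : Y.Modules} {f : A ⟶ B} {q : B ⟶ C}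
    (hfq : SectionExact f q) : ∃ w : toAbSheafMap f ≫ toAbSheafMap q = 0,
      (ShortComplex.mk (toAbSheafMap f) (toAbSheafMap q) w).ShortExact := by
  have w : toAbSheafMap f ≫ toAbSheafMap q = 0 := by
    refine Sheaf.hom_ext (NatTrans.ext (funext fun U => AddCommGrpCat.hom_ext
      (AddMonoidHom.ext fun x => ?_)))
    exact hfq.zero U.unop x
  have hmono : Mono (toAbSheafMap f) := by
    have h1 : ∀ U, Mono ((toAbSheafMap f).hom.app U) := fun U =>
      (AddCommGrpCat.mono_iff_injective _).mpr (hfq.injective U.unop)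
    have h2 : Mono (toAbSheafMap f).hom := NatTrans.mono_of_mono_app _
    exact (sheafToPresheaf (Opens.grothendieckTopology Y) AddCommGrpCat.{u}).mono_of_mono_map h2
  have hepi : Epi (toAbSheafMap q) := by
    rw [← Sheaf.isLocallySurjective_iff_epi' AddCommGrpCat.{u}]
    refine ⟨fun {U} x p hp => ?_⟩
    obtain ⟨V, h, hpV, y, hy⟩ := hfq.surjective U x p hp
    exact ⟨V, homOfLE h, ⟨y, hy⟩, hpV⟩
  refine ⟨w, ShortComplex.ShortExact.mk' ?_ hmono hepi⟩
  refine ShortComplex.exact_of_f_is_kernel _ (Limits.KernelFork.IsLimit.ofι' _ _ fun {T} k hk => ?_)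
  -- A map killed by the quotient factors section by section; the lifts are unique, hence additive
  -- and natural.
  have hk' : ∀ (U : Y.Opens) (t : T.obj.obj (op U)), ∃ y, f.app U y = k.hom.app (op U) t :=
    fun U t => hfq.exact U _ (ConcreteCategory.congr_hom
      (NatTrans.congr_app (congrArg (fun φ => φ.hom) hk) (op U)) t)
  choose l hl using hk'
  have hladd : ∀ (U : Y.Opens) (t t' : T.obj.obj (op U)), l U (t + t') = l U t + l U t' :=
    fun U t t' => hfq.injective U (by
      refine (hl U _).trans ((map_add (k.hom.app (op U)).hom t t').trans ?_)
      refine Eq.trans ?_ (map_add (f.app U).hom (l U t) (l U t')).symm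
      exact congrArg₂ (· + ·) (hl U t).symm (hl U t').symm)
  refine ⟨⟨{ app := fun U => AddCommGrpCat.ofHom (AddMonoidHom.mk' (l U.unop) (hladd U.unop)),
             naturality := fun U V φ => ?_ }⟩, ?_⟩
  · refine AddCommGrpCat.hom_ext (AddMonoidHom.ext fun t => ?_)
    apply hfq.injective V.unop
    change f.app V.unop (l V.unop (sres T φ.unop.le t)) =
      f.app V.unop (mres A φ.unop.le (l U.unop t))
    rw [app_mres, hl, hl]
    exact app_sres k φ.unop.le t
  · refine Sheaf.hom_ext (NatTrans.ext (funext fun U => AddCommGrpCat.hom_ext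
      (AddMonoidHom.ext fun t => ?_)))
    exact hl U.unop t

/-- In a short exact sequence, if the first cohomology of the outer terms vanishes, so does that
of the middle term. -/
theorem subsingleton_cohomology_of_sectionExact {A B C : Y.Modules} {f : A ⟶ B} {q : B ⟶ C}
    (hfq : SectionExact f q) (hA : Subsingleton (cohomology A 1))
    (hC : Subsingleton (cohomology C 1)) : Subsingleton (cohomology B 1) := by
  obtain ⟨w, hS⟩ := shortExact_of_sectionExact hfq
  refine subsingleton_of_forall_eq 0 fun x => ?_
  obtain ⟨y, hy⟩ := Ext.covariant_sequence_exact₂ _ hS x (hC.elim _ _)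
  rw [← hy, hA.elim y 0, Ext.zero_comp]

/-- The first cohomology vanishes if global sections lift along every epimorphism with the given
kernel. -/
theorem subsingleton_H_one_of_lift (F : AbSheaf Y)
    (h : ∀ S : ShortComplex (AbSheaf Y), S.ShortExact → S.X₁ = F →
      ∀ x : S.X₃.obj.obj (op ⊤), ∃ y, S.g.hom.app (op ⊤) y = x) : Subsingleton (Sheaf.H F 1) := by
  -- An embedding into an injective sheaf. Since the latter has no H¹, every class in H¹(F) is the
  -- connecting image of a global section of the quotient, and it vanishes if this section lifts.
  let S : ShortComplex (AbSheaf Y) :=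
    ShortComplex.mk (Injective.ι F) (Limits.cokernel.π (Injective.ι F)) (by simp)
  have hS : S.ShortExact := ShortComplex.ShortExact.mk'
    (ShortComplex.exact_of_g_is_cokernel _ (Limits.cokernelIsCokernel _))
    (inferInstanceAs (Mono (Injective.ι F))) (inferInstanceAs (Epi (Limits.cokernel.π _)))
  refine subsingleton_of_forall_eq 0 fun x => ?_
  have hinj : Subsingleton (Sheaf.H (Injective.under F) (0 + 1)) := inferInstance
  obtain ⟨z, hz⟩ := Ext.covariant_sequence_exact₁ _ hS x (hinj.elim _ _) (n₀ := 0) rfl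
  have hT : Limits.IsTerminal (⊤ : Y.Opens) := Limits.isTerminalTop
  obtain ⟨y, hy⟩ := h S hS rfl (Sheaf.H.equiv₀ S.X₃ hT z)
  have hy' : Sheaf.H.map S.g 0 ((Sheaf.H.equiv₀ S.X₂ hT).symm y) = z := by
    rw [Sheaf.H.equiv₀_symm_naturality, hy, AddEquiv.symm_apply_apply]
  rw [← hz, ← hy', Sheaf.H.map_apply, Ext.comp_assoc_of_second_deg_zero,
    ShortComplex.ShortExact.comp_extClass, Ext.comp_zero]

theorem subsingleton_cohomology_of_iso {M N : Y.Modules} (e : M ≅ N) (n : ℕ)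
    (h : Subsingleton (cohomology M n)) : Subsingleton (cohomology N n) := by
  refine subsingleton_of_forall_eq 0 fun x => ?_
  have key : Sheaf.H.map (toAbSheafMap e.hom) n (Sheaf.H.map (toAbSheafMap e.inv) n x) = x := by
    rw [← Sheaf.H.map_comp_apply]
    have : toAbSheafMap e.inv ≫ toAbSheafMap e.hom = 𝟙 _ := by
      refine Sheaf.hom_ext (NatTrans.ext (funext fun U => AddCommGrpCat.hom_ext
        (AddMonoidHom.ext fun x => ?_)))
      exact ConcreteCategory.congr_hom
        (congrArg (fun φ => Scheme.Modules.Hom.app φ U.unop) e.inv_hom_id) x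
    rw [this, Sheaf.H.map_id_apply]
  rw [← key, h.elim (Sheaf.H.map (toAbSheafMap e.inv) n x) 0, map_zero]

end Cohomology
end VeryFreeCurves
end


noncomputable section

namespace VeryFreeCurves

/-! ### Twists -/

section TwistFunctor

variable {Y : Scheme.{u}}

/-- `σ` is a generator of the sheaf of modules `M` over `U`: it is free of rank one there. -/
def IsGenerator (M : Y.Modules) (U : Y.Opens) (σ : Γ(M, U)) : Prop :=
  ∀ (W : Y.Opens) (h : W ≤ U), Function.Bijective fun r : Γ(Y, W) => r • mres M h σ

theorem IsGenerator.mres {M : Y.Modules} {U V : Y.Opens} {σ : Γ(M, U)} (hσ : IsGenerator M U σ)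
    (h : V ≤ U) : IsGenerator M V (mres M h σ) := fun W h' => by
  rw [mres_mres]
  exact hσ W _

variable {ι : Type} {c : ι → Y.Opens} {g : ∀ i : ι, ι → Γ(Y, c i)}

/-- The functions `gᵢⱼ` form a cocycle for the covering `c`. -/
structure IsCocycle (c : ι → Y.Opens) (g : ∀ i : ι, ι → Γ(Y, c i)) : Prop where
  cover : ∀ p : Y, ∃ i, p ∈ c i
  self : ∀ i, g i i = 1
  mul : ∀ i j l, res (W := c i ⊓ c j) inf_le_left (g i l) =
    res inf_le_left (g i j) * res inf_le_right (g j l)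

theorem IsCocycle.mul_res (hg : IsCocycle c g) {W : Y.Opens} (i j l : ι) (hi : W ≤ c i)
    (hj : W ≤ c j) : res hi (g i l) = res hi (g i j) * res hj (g j l) := by
  have := congrArg (res (le_inf hi hj)) (hg.mul i j l)
  rwa [map_mul, res_res, res_res, res_res] at this

/-- The section of the twisted sheaf over a subset of `cᵢ` with prescribed `i`-th component. -/
def twistOf (hg : IsCocycle c g) (F : Y.Modules) (i : ι) {W : Y.Opens} (h : W ≤ c i)
    (y : Γ(F, W)) : twistSections c g F W :=
  ⟨fun j => res (inf_le_left.trans h : W ⊓ c j ≤ c i) (g i j) • mres F inf_le_left y,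
    fun j l => by
      rw [mres_smul, mres_smul, res_res, res_res, mres_mres, mres_mres, smul_smul, mul_comm,
        hg.mul_res i j l _ (inf_le_right.trans inf_le_left)]⟩

theorem twistOf_self (hg : IsCocycle c g) (F : Y.Modules) (i : ι) {W : Y.Opens} (h : W ≤ c i)
    (y : Γ(F, W)) : (twistOf hg F i h y).1 i = mres F inf_le_left y := by
  simp only [twistOf]
  rw [hg.self, map_one, one_smul]

/-- Over a subset of cᵢ, the relation sⱼ = gᵢⱼ sᵢ recovers every component from the i-th one. -/
theorem twistSections_ext {F : Y.Modules} (i : ι) {W : Y.Opens} (h : W ≤ c i)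
    {s t : twistSections c g F W} (hst : s.1 i = t.1 i) : s = t := by
  refine Subtype.ext (funext fun j => ?_)
  have hle : W ⊓ c j ≤ W ⊓ (c i ⊓ c j) :=
    le_inf inf_le_left (le_inf (inf_le_left.trans h) inf_le_right)
  have h1 := congrArg (mres F hle) (s.2 i j)
  have h2 := congrArg (mres F hle) (t.2 i j)
  rw [hst] at h1
  have := h1.trans h2.symm
  rwa [mres_mres, mres_mres, mres_self, mres_self] at this

/-- Functoriality of twisting on sections. -/
def twistMap {A B : Y.Modules} (f : A ⟶ B) (W : Y.Opens) :
    twistSections c g A W →+ twistSections c g B W where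
  toFun s := ⟨fun i => f.app _ (s.1 i), fun i j => by
    have := congrArg (f.app _) (s.2 i j)
    rw [Scheme.Modules.Hom.app_smul, app_mres, app_mres] at this
    exact this⟩
  map_zero' := Subtype.ext (funext fun i => map_zero (f.app _).hom)
  map_add' s t := Subtype.ext (funext fun i => map_add (f.app _).hom (s.1 i) (t.1 i))

variable (c g) in
/-- Functoriality of twisting. -/
def twistHom {A B : Y.Modules} (f : A ⟶ B) : twist c g A ⟶ twist c g B :=
  modulesHomMk (M := twist c g A) (N := twist c g B) (fun W => twistMap f W)
    (fun U V h s => by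
      change twistSections c g A U at s
      exact Subtype.ext (funext fun i => app_mres f (inf_le_inf_right (c i) h) (s.1 i)))
    (fun U r s => by
      change twistSections c g A U at s
      exact Subtype.ext (funext fun i => Scheme.Modules.Hom.app_smul f _ (s.1 i)))

variable (c g) in
/-- Twists of isomorphic sheaves are isomorphic. -/
def twistIso {A B : Y.Modules} (e : A ≅ B) : twist c g A ≅ twist c g B where
  hom := twistHom c g e.hom
  inv := twistHom c g e.inv
  hom_inv_id := by
    ext W s
    change twistSections c g A W at s
    refine Subtype.ext (funext fun i => ?_)
    exact ConcreteCategory.congr_hom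
      (congrArg (fun φ => Scheme.Modules.Hom.app φ (W ⊓ c i)) e.hom_inv_id) (s.1 i)
  inv_hom_id := by
    ext W s
    change twistSections c g B W at s
    refine Subtype.ext (funext fun i => ?_)
    exact ConcreteCategory.congr_hom
      (congrArg (fun φ => Scheme.Modules.Hom.app φ (W ⊓ c i)) e.inv_hom_id) (s.1 i)

/-- Injectivity and left exactness hold componentwise. For local surjectivity one shrinks into some
cᵢ, lifts the i-th component and extends it by the cocycle. -/
theorem SectionExact.twist (hg : IsCocycle c g) {A B C : Y.Modules} {f : A ⟶ B} {q : B ⟶ C}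
    (hfq : SectionExact f q) : SectionExact (twistHom c g f) (twistHom c g q) where
  injective W s t hst := by
    change twistSections c g A W at s t
    refine Subtype.ext (funext fun i => hfq.injective _ ?_)
    exact congrFun (congrArg Subtype.val (hst : twistMap f W s = twistMap f W t)) i
  zero W s := by
    change twistSections c g A W at s
    exact Subtype.ext (funext fun i => hfq.zero _ (s.1 i))
  exact W s hs := by
    change twistSections c g B W at s
    choose y hy using fun i => hfq.exact (W ⊓ c i) (s.1 i)
      (congrFun (congrArg Subtype.val (hs : twistMap q W s = 0)) i)
    refine ⟨(⟨y, fun i j => ?_⟩ : twistSections c g A W), ?_⟩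
    · apply hfq.injective
      rw [Scheme.Modules.Hom.app_smul, app_mres, app_mres, hy, hy]
      exact s.2 i j
    · exact Subtype.ext (funext hy)
  surjective W s p hp := by
    change twistSections c g C W at s
    obtain ⟨i, hi⟩ := hg.cover p
    obtain ⟨W', h, hpW', y, hy⟩ := hfq.surjective (W ⊓ c i) (s.1 i) p ⟨hp, hi⟩
    refine ⟨W', h.trans inf_le_left, hpW', twistOf hg B i (h.trans inf_le_right) y, ?_⟩
    refine twistSections_ext (g := g) i (h.trans inf_le_right) ?_
    have h1 : q.app (W' ⊓ c i) ((twistOf hg B i (h.trans inf_le_right) y).1 i) =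
        mres C (inf_le_inf_right (c i) (h.trans inf_le_left)) (s.1 i) := by
      rw [twistOf_self, app_mres, hy, mres_mres]
    exact h1

theorem twistOf_smul (hg : IsCocycle c g) (F : Y.Modules) (i : ι) {W : Y.Opens} (h : W ≤ c i)
    (r : Γ(Y, W)) (y : Γ(F, W)) : twistOf hg F i h (r • y) = r • twistOf hg F i h y := by
  refine twistSections_ext i h ?_
  rw [twistSections_smul_apply, twistOf_self, twistOf_self, mres_smul]

theorem twistRestrict_twistOf (hg : IsCocycle c g) (F : Y.Modules) (i : ι) {W V : Y.Opens}
    (h : W ≤ c i) (h' : V ≤ W) (y : Γ(F, W)) :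
    twistRestrict c g F h' (twistOf hg F i h y) = twistOf hg F i (h'.trans h) (mres F h' y) := by
  refine twistSections_ext i (h'.trans h) ?_
  rw [twistOf_self]
  change mres F _ ((twistOf hg F i h y).1 i) = _
  rw [twistOf_self, mres_mres, mres_mres]

theorem exists_twistOf (hg : IsCocycle c g) (F : Y.Modules) (i : ι) {W : Y.Opens} (h : W ≤ c i)
    (s : twistSections c g F W) : ∃ y, twistOf hg F i h y = s := by
  refine ⟨mres F (le_inf le_rfl h) (s.1 i), twistSections_ext i h ?_⟩
  rw [twistOf_self, mres_mres, mres_self]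

theorem twistOf_injective (hg : IsCocycle c g) (F : Y.Modules) (i : ι) {W : Y.Opens}
    (h : W ≤ c i) : Function.Injective (twistOf hg F i h) := fun y z hyz => by
  have := congrArg (mres F (le_inf le_rfl h)) (congrFun (congrArg Subtype.val hyz) i)
  rwa [twistOf_self, twistOf_self, mres_mres, mres_mres, mres_self, mres_self] at this

/-- Over cᵢ, `twistOf` identifies F with its twist linearly, so it carries generators to generators.
-/
theorem IsGenerator.twist (hg : IsCocycle c g) {F : Y.Modules} {i : ι} {U : Y.Opens} (h : U ≤ c i)
    {σ : Γ(F, U)} (hσ : IsGenerator F U σ) :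
    IsGenerator (twist c g F) U (twistOf hg F i h σ) := fun W hW => by
  have key : (fun r : Γ(Y, W) => (r • twistRestrict c g F hW (twistOf hg F i h σ) :
      twistSections c g F W)) = twistOf hg F i (hW.trans h) ∘ fun r => r • VeryFreeCurves.mres F hW σ := by
    funext r
    rw [Function.comp, twistRestrict_twistOf, twistOf_smul]
  change Function.Bijective (fun r : Γ(Y, W) => (r • twistRestrict c g F hW (twistOf hg F i h σ) :
      twistSections c g F W))
  rw [key]
  exact Function.Bijective.comp
    ⟨twistOf_injective hg F i _, exists_twistOf hg F i _⟩ (hσ W hW)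

/-- Change of generators in a twisted sheaf. -/
theorem mres_twistOf_eq (hg : IsCocycle c g) {F : Y.Modules} {i j : ι} {U V W : Y.Opens}
    (hU : U ≤ c i) (hV : V ≤ c j) (hWU : W ≤ U) (hWV : W ≤ V) {σ : Γ(F, U)} {τ : Γ(F, V)}
    {u : Γ(Y, W)} (hu : mres F hWV τ = u • mres F hWU σ) :
    (mres (VeryFreeCurves.twist c g F) hWV (twistOf hg F j hV τ) :
      Γ(VeryFreeCurves.twist c g F, W)) =
      (res (hWV.trans hV) (g j i) * u) •
        mres (VeryFreeCurves.twist c g F) hWU (twistOf hg F i hU σ) := by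
  have key : twistRestrict c g F hWV (twistOf hg F j hV τ) =
      (res (hWV.trans hV) (g j i) * u) • twistRestrict c g F hWU (twistOf hg F i hU σ) := by
    rw [twistRestrict_twistOf, twistRestrict_twistOf, hu, ← twistOf_smul]
    refine twistSections_ext i (hWU.trans hU) ?_
    rw [twistOf_self]
    simp only [twistOf]
    rw [mul_smul, mres_smul F inf_le_left (res _ (g j i)), res_res]
  exact key

end TwistFunctor
end VeryFreeCurves
end


noncomputable section

namespace VeryFreeCurves

/-! ### Vanishing of the first cohomology -/

section Vanishing

variable {Y : Scheme.{u}}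

theorem injective_of_shortExact {S : ShortComplex (AbSheaf Y)} (hS : S.ShortExact) (U : Y.Opens) :
    Function.Injective (S.f.hom.app (op U)) := by
  let Φ : AbSheaf Y ⥤ AddCommGrpCat.{u} :=
    sheafToPresheaf (Opens.grothendieckTopology Y) AddCommGrpCat.{u} ⋙ (evaluation _ _).obj (op U)
  have := hS.mono_f
  exact (AddCommGrpCat.mono_iff_injective _).mp (inferInstanceAs (Mono (Φ.map S.f)))

/-- Functions on an integral scheme that agree on a nonempty open subset are equal. -/
theorem res_injective [IsIntegral Y] {V W : Y.Opens} (h : W ≤ V) (hW : (W : Set Y).Nonempty) :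
    Function.Injective (res h) := by
  have : Nonempty W := hW.to_subtype
  exact map_injective_of_isIntegral Y (homOfLE h)

/-- Clearing denominators. The open subset W is kept as a variable equal to D(f), so that it can be
an intersection of two basic open subsets. -/
theorem exists_pow_mul_eq_res {V : Y.Opens} (hV : IsAffineOpen V) (f : Γ(Y, V)) {W : Y.Opens}
    (h : W ≤ V) (hW : W = Y.basicOpen f) (m : Γ(Y, W)) :
    ∃ (N : ℕ) (n : Γ(Y, V)), res h n = res h f ^ N * m := by
  subst hW
  have := hV.isLocalization_basicOpen f
  obtain ⟨N, n, hn⟩ := IsLocalization.Away.surj f m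
  refine ⟨N, n, ?_⟩
  rw [mul_comm]
  exact hn.symm

/-- Every additive cocycle of functions on a finite covering of an affine open subset by basic open
subsets is a coboundary. -/
theorem exists_coboundary [IsIntegral Y] {U : Y.Opens} (hU : IsAffineOpen U) {J : Type*} [Finite J]
    (f : J → Γ(Y, U)) (hne : ∀ j, (Y.basicOpen (f j) : Set Y).Nonempty)
    (hf : Ideal.span (Set.range f) = ⊤)
    (m : ∀ j l : J, Γ(Y, Y.basicOpen (f j) ⊓ Y.basicOpen (f l)))
    (hm : ∀ (j l q : J) (W : Y.Opens) (hj : W ≤ Y.basicOpen (f j)) (hl : W ≤ Y.basicOpen (f l))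
      (hq : W ≤ Y.basicOpen (f q)),
      res (le_inf hj hl) (m j l) + res (le_inf hl hq) (m l q) = res (le_inf hj hq) (m j q)) :
    ∃ c : ∀ j, Γ(Y, Y.basicOpen (f j)),
      ∀ j l, m j l = res inf_le_left (c j) - res inf_le_right (c l) := by
  classical
  have := Fintype.ofFinite J
  have hle : ∀ j, Y.basicOpen (f j) ≤ U := fun j => Y.basicOpen_le _
  choose N₀ n₀ hn₀ using fun j l => exists_pow_mul_eq_res (hU.basicOpen (f j)) (res (hle j) (f l))
    (W := Y.basicOpen (f j) ⊓ Y.basicOpen (f l)) inf_le_left (Y.basicOpen_res _ _).symm (m j l)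
  obtain ⟨N, hN⟩ : ∃ N, ∀ j l, N₀ j l ≤ N := by
    -- One exponent serves all pairs because the covering is finite.
    refine ⟨Finset.univ.sup fun p : J × J => N₀ p.1 p.2, fun j l => ?_⟩
    exact Finset.le_sup (f := fun p : J × J => N₀ p.1 p.2) (Finset.mem_univ (j, l))
  obtain ⟨n, hn⟩ : ∃ n : ∀ j _ : J, Γ(Y, Y.basicOpen (f j)), ∀ j l,
      res inf_le_left (n j l) = res (inf_le_left.trans (hle j)) (f l) ^ N * m j l := by
    refine ⟨fun j l => res (hle j) (f l) ^ (N - N₀ j l) * n₀ j l, fun j l => ?_⟩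
    rw [map_mul, hn₀, map_pow, res_res, ← mul_assoc, ← pow_add, Nat.sub_add_cancel (hN j l)]
  have hspan : Ideal.span (Set.range fun j => f j ^ N) = ⊤ := by
    have := Ideal.span_pow_eq_top _ hf N
    rwa [← Set.range_comp] at this
  -- The powers f_lᴺ still generate the unit ideal: ∑ a_l f_lᴺ = 1. The cochain will be c_j = ∑ a_l
  -- n_jl, where n_jl extends f_lᴺ m_jl to D(f_j).
  obtain ⟨a, ha⟩ := (Ideal.mem_span_range_iff_exists_fun (x := (1 : Γ(Y, U)))).mp
    (hspan ▸ Submodule.mem_top)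
  have hne₂ : ∀ j l, ((Y.basicOpen (f j) ⊓ Y.basicOpen (f l) : Y.Opens) : Set Y).Nonempty :=
    fun j l => nonempty_preirreducible_inter (Y.basicOpen (f j)).2 (Y.basicOpen (f l)).2 (hne j)
      (hne l)
  have key : ∀ j q l, res (inf_le_left : Y.basicOpen (f j) ⊓ Y.basicOpen (f q) ≤ _) (n j l) -
      res inf_le_right (n q l) = res (inf_le_left.trans (hle j)) (f l) ^ N * m j q := by
    intro j q l
    have hne₃ := nonempty_preirreducible_inter (Y.basicOpen (f j) ⊓ Y.basicOpen (f q)).2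
      (Y.basicOpen (f l)).2 (hne₂ j q) (hne l)
    -- The identity may be tested after restriction to D(f_l), because Y is integral; there it is
    -- f_lᴺ times the cocycle relation.
    refine res_injective (W := Y.basicOpen (f j) ⊓ Y.basicOpen (f q) ⊓ Y.basicOpen (f l))
      inf_le_left hne₃ ?_
    have h1 := congrArg (res (W := Y.basicOpen (f j) ⊓ Y.basicOpen (f q) ⊓ Y.basicOpen (f l))
      (le_inf (inf_le_left.trans inf_le_left) inf_le_right)) (hn j l)
    have h2 := congrArg (res (W := Y.basicOpen (f j) ⊓ Y.basicOpen (f q) ⊓ Y.basicOpen (f l))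
      (le_inf (inf_le_left.trans inf_le_right) inf_le_right)) (hn q l)
    have h3 := hm j q l (Y.basicOpen (f j) ⊓ Y.basicOpen (f q) ⊓ Y.basicOpen (f l))
      (inf_le_left.trans inf_le_left) (inf_le_left.trans inf_le_right) inf_le_right
    rw [map_mul, map_pow, res_res, res_res] at h1 h2
    rw [map_sub, map_mul, map_pow, res_res, res_res, res_res, h1, h2, ← h3]
    ring
  refine ⟨fun j => ∑ l, res (hle j) (a l) * n j l, fun j q => ?_⟩
  rw [map_sum, map_sum, ← Finset.sum_sub_distrib]
  have h1 := congrArg (res (inf_le_left.trans (hle j) : Y.basicOpen (f j) ⊓ Y.basicOpen (f q) ≤ U))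
    ha
  rw [map_one, map_sum] at h1
  calc m j q = 1 * m j q := (one_mul _).symm
    _ = _ := by
      rw [← h1, Finset.sum_mul]
      refine Finset.sum_congr rfl fun l _ => ?_
      rw [map_mul, map_mul, map_mul, map_pow, mul_assoc, ← key, res_res, res_res, mul_sub]

/-- This is the vanishing of H¹ of a free sheaf on an affine open subset. Local lifts differ by
multiples of the generator σ, whose coefficients form an additive cocycle; writing it as a
coboundary corrects the lifts so that they glue. -/
theorem exists_lift_of_isAffineOpen [IsIntegral Y] {M : Y.Modules} {B C : AbSheaf Y}
    {φ : toAbSheaf M ⟶ B} {ψ : B ⟶ C} {w : φ ≫ ψ = 0} (hS : (ShortComplex.mk φ ψ w).ShortExact)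
    {U : Y.Opens} (hU : IsAffineOpen U) {σ : Γ(M, U)} (hσ : IsGenerator M U σ)
    (x : C.obj.obj (op U)) : ∃ y, ψ.hom.app (op U) y = x := by
  have hinj : ∀ W : Y.Opens, Function.Injective (φ.hom.app (op W)) := injective_of_shortExact hS
  have hex : ∀ (W : Y.Opens) (y : B.obj.obj (op W)), ψ.hom.app (op W) y = 0 →
      ∃ z : Γ(M, W), φ.hom.app (op W) z = y := exists_of_shortExact hS
  have hzero : ∀ (W : Y.Opens) (z : Γ(M, W)), ψ.hom.app (op W) (φ.hom.app (op W) z) = 0 :=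
    fun W z => ConcreteCategory.congr_hom (NatTrans.congr_app (congrArg (fun φ => φ.hom) w) (op W)) z
  -- Only nonempty basic open subsets are used, as integrality arguments on their intersections
  -- require; they still cover U.
  let s : Set Γ(Y, U) := {f | (Y.basicOpen f : Set Y).Nonempty ∧ ∃ y : B.obj.obj (op (Y.basicOpen f)),
    ψ.hom.app (op (Y.basicOpen f)) y = sres C (Y.basicOpen_le f) x}
  have hs : Ideal.span s = ⊤ := by
    rw [← hU.self_le_iSup_basicOpen_iff]
    intro p hp
    obtain ⟨V, hV, hpV, y, hy⟩ := exists_local_lift_of_shortExact hS U x p hp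
    obtain ⟨f, hf, hpf⟩ := hU.exists_basicOpen_le ⟨p, hpV⟩ hp
    refine Opens.mem_iSup.mpr ⟨⟨f, ⟨p, hpf⟩, sres B hf y, ?_⟩, hpf⟩
    rw [app_sres]
    refine (congrArg (sres C hf) hy).trans (sres_sres C hV hf x)
  obtain ⟨t, hts, ht⟩ := (Ideal.span_eq_top_iff_finite s).mp hs
  choose hne y hy using fun j : t => hts j.2
  have hle : ∀ j : t, Y.basicOpen j.1 ≤ U := fun j => Y.basicOpen_le _
  have hm₀ : ∀ j l : t, ∃ m : Γ(Y, Y.basicOpen j.1 ⊓ Y.basicOpen l.1),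
      φ.hom.app (op (Y.basicOpen j.1 ⊓ Y.basicOpen l.1))
        (m • mres M (W := Y.basicOpen j.1 ⊓ Y.basicOpen l.1) (inf_le_left.trans (hle j)) σ) =
        sres B inf_le_left (y j) - sres B inf_le_right (y l) := by
    intro j l
    obtain ⟨z, hz⟩ := hex _ (sres B (inf_le_left : Y.basicOpen j.1 ⊓ Y.basicOpen l.1 ≤ _) (y j) -
      sres B inf_le_right (y l)) (by
        refine (map_sub (ψ.hom.app _).hom _ _).trans ?_
        refine (congrArg₂ (· - ·) (app_sres ψ _ _) (app_sres ψ _ _)).trans ?_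
        rw [hy, hy, sres_sres, sres_sres, sub_self])
    obtain ⟨m, hm⟩ := (hσ _ (inf_le_left.trans (hle j))).2 z
    exact ⟨m, (congrArg _ hm).trans hz⟩
  choose m hm using hm₀
  have hmW : ∀ (j l : t) (W : Y.Opens) (hj : W ≤ Y.basicOpen j.1) (hl : W ≤ Y.basicOpen l.1),
      φ.hom.app (op W) ((res (le_inf hj hl) (m j l) • mres M (hj.trans (hle j)) σ :) : Γ(M, W)) =
        sres B hj (y j) - sres B hl (y l) := by
    intro j l W hj hl
    have h1 := congrArg (sres B (le_inf hj hl)) (hm j l)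
    rw [← app_sres, map_sub, sres_sres, sres_sres] at h1
    rw [← h1]
    refine congrArg _ ?_
    refine Eq.trans ?_ (mres_smul M _ _ _).symm
    rw [mres_mres]
  obtain ⟨c, hc⟩ := exists_coboundary hU (fun j : t => j.1) hne (by simpa using ht) m (by
    intro j l q W hj hl hq
    refine (hσ W (hj.trans (hle j))).1 (hinj W ?_)
    beta_reduce
    rw [add_smul]
    refine (map_add (φ.hom.app _).hom _ _).trans ?_
    refine (congrArg₂ (· + ·) (hmW j l W hj hl) (hmW l q W hl hq)).trans ?_
    refine Eq.trans ?_ (hmW j q W hj hq).symm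
    abel)
  have hcW : ∀ (j : t) (W : Y.Opens) (hj : W ≤ Y.basicOpen j.1),
      sres B hj (φ.hom.app (op (Y.basicOpen j.1)) ((c j • mres M (hle j) σ :) : Γ(M, _))) =
      φ.hom.app (op W) ((res hj (c j) • mres M (hj.trans (hle j)) σ :) : Γ(M, W)) := by
    intro j W hj
    rw [← app_sres]
    refine congrArg _ ?_
    refine (mres_smul M _ _ _).trans ?_
    rw [mres_mres]
  have hcov : U ≤ ⨆ j : t, Y.basicOpen j.1 := by
    have h := hU.self_le_iSup_basicOpen_iff.mpr ht
    exact h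
  obtain ⟨z, hz⟩ := exists_sglue B (fun j : t => Y.basicOpen j.1) hle hcov
    (fun j => y j - φ.hom.app (op (Y.basicOpen j.1)) ((c j • mres M (hle j) σ :) : Γ(M, _))) (by
      intro j l
      rw [map_sub, map_sub, hcW, hcW, sub_eq_sub_iff_sub_eq_sub]
      refine (hmW j l _ inf_le_left inf_le_right).symm.trans ?_
      rw [hc, map_sub, res_res, res_res, sub_smul]
      exact map_sub (φ.hom.app _).hom _ _)
  refine ⟨z, sres_ext C (fun j : t => Y.basicOpen j.1) hle hcov _ _ fun j => ?_⟩
  rw [← app_sres, hz, ← hy j]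
  refine (map_sub (ψ.hom.app _).hom _ _).trans ?_
  exact (congrArg (_ - ·) (hzero _ _)).trans (sub_zero _)

/-- The first cohomology of a sheaf of modules vanishes if it is free of rank one on the members of
an affine covering by two subsets and the corresponding first Čech cohomology vanishes. -/
theorem subsingleton_cohomology_one [IsIntegral Y] {M : Y.Modules} {U₀ U₁ : Y.Opens}
    (hU₀ : IsAffineOpen U₀) (hU₁ : IsAffineOpen U₁) (hU : U₀ ⊔ U₁ = ⊤) {σ₀ : Γ(M, U₀)}
    {σ₁ : Γ(M, U₁)} (hσ₀ : IsGenerator M U₀ σ₀) (hσ₁ : IsGenerator M U₁ σ₁)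
    (h : ∀ m : Γ(M, U₀ ⊓ U₁), ∃ m₀ m₁, m = mres M inf_le_left m₀ + mres M inf_le_right m₁) :
    Subsingleton (cohomology M 1) := by
  refine subsingleton_H_one_of_lift _ ?_
  rintro ⟨φ, ψ, w⟩ hS rfl x
  change (ShortComplex.mk φ ψ w).ShortExact at hS
  rename_i B C
  obtain ⟨y₀, hy₀⟩ := exists_lift_of_isAffineOpen hS hU₀ hσ₀ (sres C le_top x)
  obtain ⟨y₁, hy₁⟩ := exists_lift_of_isAffineOpen hS hU₁ hσ₁ (sres C le_top x)
  obtain ⟨z, hz⟩ : ∃ z : Γ(M, U₀ ⊓ U₁), φ.hom.app (op (U₀ ⊓ U₁)) z =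
      sres B inf_le_left y₀ - sres B inf_le_right y₁ := by
    refine exists_of_shortExact hS _ _ ?_
    refine (map_sub (ψ.hom.app _).hom _ _).trans ?_
    refine (congrArg₂ (· - ·) (app_sres ψ _ _) (app_sres ψ _ _)).trans ?_
    rw [hy₀, hy₁, sres_sres, sres_sres, sub_self]
  have hzero : ∀ (W : Y.Opens) (z : Γ(M, W)), ψ.hom.app (op W) (φ.hom.app (op W) z) = 0 :=
    fun W z => ConcreteCategory.congr_hom (NatTrans.congr_app (congrArg (fun φ => φ.hom) w) (op W)) z
  obtain ⟨m₀, m₁, hm⟩ := h z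
  have hφ₀ : sres B (inf_le_left : U₀ ⊓ U₁ ≤ U₀) (φ.hom.app (op U₀) m₀) =
      φ.hom.app (op (U₀ ⊓ U₁)) (mres M inf_le_left m₀) := (app_sres φ _ _).symm
  have hφ₁ : sres B (inf_le_right : U₀ ⊓ U₁ ≤ U₁) (φ.hom.app (op U₁) m₁) =
      φ.hom.app (op (U₀ ⊓ U₁)) (mres M inf_le_right m₁) := (app_sres φ _ _).symm
  -- The Čech decomposition z = m₀ + m₁ splits the discrepancy y₀ - y₁ between the lifts, so
  -- subtracting m₀ from one and adding m₁ to the other makes them agree.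
  have hoverlap : sres B (inf_le_left : U₀ ⊓ U₁ ≤ U₀) (y₀ - φ.hom.app (op U₀) m₀) =
      sres B (inf_le_right : U₀ ⊓ U₁ ≤ U₁) (y₁ + φ.hom.app (op U₁) m₁) := by
    have h1 := (congrArg (φ.hom.app (op (U₀ ⊓ U₁))) hm).symm.trans hz
    have h2 := (map_add (φ.hom.app (op (U₀ ⊓ U₁))).hom (mres M inf_le_left m₀)
      (mres M inf_le_right m₁)).symm.trans h1
    rw [map_sub, map_add, hφ₀, hφ₁, sub_eq_iff_eq_add, add_assoc, add_comm (φ.hom.app _ _),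
      ← sub_eq_iff_eq_add']
    exact h2.symm
  let U : Bool → Y.Opens := fun b => bif b then U₀ else U₁
  have hcov : (⊤ : Y.Opens) ≤ iSup U := by
    rw [iSup_bool_eq]
    exact hU.ge
  let s : ∀ b, B.obj.obj (op (U b))
    | true => y₀ - φ.hom.app (op U₀) m₀
    | false => y₁ + φ.hom.app (op U₁) m₁
  obtain ⟨y, hy⟩ := exists_sglue B U (fun _ => le_top) hcov s (by
    rintro (_ | _) (_ | _)
    · rfl
    · have h1 := congrArg (sres B (le_inf inf_le_right inf_le_left : U₁ ⊓ U₀ ≤ U₀ ⊓ U₁)) hoverlap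
      rw [sres_sres, sres_sres] at h1
      exact h1.symm
    · exact hoverlap
    · rfl)
  refine ⟨y, sres_ext C U (fun _ => le_top) hcov _ _ ?_⟩
  rintro (_ | _)
  · refine (app_sres ψ _ _).symm.trans ?_
    rw [hy false, ← hy₁]
    refine (map_add (ψ.hom.app _).hom _ _).trans ?_
    exact (congrArg (_ + ·) (hzero _ _)).trans (add_zero _)
  · refine (app_sres ψ _ _).symm.trans ?_
    rw [hy true, ← hy₀]
    refine (map_sub (ψ.hom.app _).hom _ _).trans ?_
    exact (congrArg (_ - ·) (hzero _ _)).trans (sub_zero _)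

end Vanishing
end VeryFreeCurves
end


noncomputable section

namespace VeryFreeCurves

/-! ### Sheaves of rank one on the spectrum of a principal ideal domain -/

section Principal

variable {Y : Scheme.{u}}

/-- Being a generator is a local property. -/
theorem isGenerator_of_cover {M : Y.Modules} {J : Type*} {U : Y.Opens} (V : J → Y.Opens)
    (hV : ∀ j, V j ≤ U) (hU : U ≤ iSup V) {σ : Γ(M, U)}
    (hσ : ∀ j, IsGenerator M (V j) (mres M (hV j) σ)) : IsGenerator M U σ := by
  intro W hW
  have hcov : W ≤ ⨆ j, W ⊓ V j := by
    rw [← inf_iSup_eq]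
    exact le_inf le_rfl (hW.trans hU)
  have hσ' : ∀ (j : J) (W' : Y.Opens) (h : W' ≤ U) (_ : W' ≤ V j),
      Function.Bijective fun r : Γ(Y, W') => r • mres M h σ := fun j W' h hj => by
    have := hσ j W' hj
    rwa [mres_mres] at this
  constructor
  · intro r r' hr
    refine res_ext (fun j => W ⊓ V j) (fun _ => inf_le_left) hcov _ _ fun j => ?_
    refine (hσ' j (W ⊓ V j) (inf_le_left.trans hW) inf_le_right).1 ?_
    have := congrArg (mres M (inf_le_left : W ⊓ V j ≤ W)) hr
    beta_reduce at this
    rwa [mres_smul, mres_smul, mres_mres] at this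
  · intro m
    choose r hr using fun j => (hσ' j (W ⊓ V j) (inf_le_left.trans hW) inf_le_right).2
      (mres M inf_le_left m)
    beta_reduce at hr
    obtain ⟨s, hs⟩ := exists_glue (fun j => W ⊓ V j) (fun _ => inf_le_left) hcov r fun j l => by
      refine (hσ' j (W ⊓ V j ⊓ (W ⊓ V l)) (inf_le_left.trans (inf_le_left.trans hW))
        (inf_le_left.trans inf_le_right)).1 ?_
      have h1 := congrArg (mres M (inf_le_left : W ⊓ V j ⊓ (W ⊓ V l) ≤ W ⊓ V j)) (hr j)
      have h2 := congrArg (mres M (inf_le_right : W ⊓ V j ⊓ (W ⊓ V l) ≤ W ⊓ V l)) (hr l)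
      rw [mres_smul, mres_mres, mres_mres] at h1 h2
      exact h1.trans h2.symm
    refine ⟨s, mres_ext M (fun j => W ⊓ V j) (fun _ => inf_le_left) hcov _ _ fun j => ?_⟩
    rw [mres_smul, hs, mres_mres, hr]

theorem IsGenerator.smul {M : Y.Modules} {U : Y.Opens} {σ : Γ(M, U)} (hσ : IsGenerator M U σ)
    {v : Γ(Y, U)} (hv : IsUnit v) : IsGenerator M U (v • σ) := fun W h => by
  have : (fun r : Γ(Y, W) => r • VeryFreeCurves.mres M h (v • σ)) =
      (fun r : Γ(Y, W) => r • VeryFreeCurves.mres M h σ) ∘ fun r => r * res h v := by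
    funext r
    rw [mres_smul, Function.comp, mul_smul]
  rw [this]
  exact (hσ W h).comp (IsUnit.isUnit_iff_mulRight_bijective.mp (hv.map (res h)))

variable [IsIntegral Y]

/-- The rational function defined by a function on a nonempty open subset. -/
def toRat {W : Y.Opens} (hW : (W : Set Y).Nonempty) : Γ(Y, W) →+* Y.functionField :=
  haveI : Nonempty W := hW.to_subtype
  (Y.germToFunctionField W).hom

theorem toRat_injective {W : Y.Opens} (hW : (W : Set Y).Nonempty) :
    Function.Injective (toRat hW) :=
  haveI : Nonempty W := hW.to_subtype
  Scheme.germToFunctionField_injective Y W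

theorem toRat_res {V W : Y.Opens} (hV : (V : Set Y).Nonempty) (hW : (W : Set Y).Nonempty)
    (h : W ≤ V) (a : Γ(Y, V)) : toRat hW (res h a) = toRat hV a := by
  have : Nonempty W := hW.to_subtype
  exact TopCat.Presheaf.germ_res_apply Y.presheaf (homOfLE h) _ _ a

theorem nonempty_inf {V W : Y.Opens} (hV : (V : Set Y).Nonempty) (hW : (W : Set Y).Nonempty) :
    ((V ⊓ W : Y.Opens) : Set Y).Nonempty :=
  nonempty_preirreducible_inter V.2 W.2 hV hW

/-- A finite family of rational functions generates a principal module over a principal ideal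
domain of functions. -/
theorem exists_principal {U : Y.Opens} (hU : IsAffineOpen U) (hne : (U : Set Y).Nonempty)
    [IsPrincipalIdealRing Γ(Y, U)] {J : Type*} [Fintype J] (e : J → Y.functionField) :
    ∃ (x : Y.functionField) (a b : J → Γ(Y, U)),
      (∀ j, e j = toRat hne (a j) * x) ∧ x = ∑ j, toRat hne (b j) * e j := by
  have : Nonempty U := hne.to_subtype
  have := functionField_isFractionRing_of_isAffineOpen Y U hU
  have hfrac : IsFractional (nonZeroDivisors Γ(Y, U)) (Submodule.span Γ(Y, U) (Set.range e)) :=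
    FractionalIdeal.isFractional_of_fg (Submodule.fg_span (Set.finite_range e))
  obtain ⟨x, hx⟩ := (FractionalIdeal.isPrincipal
    (⟨_, hfrac⟩ : FractionalIdeal (nonZeroDivisors Γ(Y, U)) Y.functionField)).principal
  change Submodule.span Γ(Y, U) (Set.range e) = _ at hx
  have h1 : ∀ j, ∃ a : Γ(Y, U), e j = toRat hne a * x := fun j => by
    have : e j ∈ Submodule.span Γ(Y, U) (Set.range e) := Submodule.subset_span ⟨j, rfl⟩
    rw [hx] at this
    obtain ⟨a, ha⟩ := Submodule.mem_span_singleton.mp this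
    exact ⟨a, ha.symm⟩
  have h2 : x ∈ Submodule.span Γ(Y, U) (Set.range e) := hx ▸ Submodule.mem_span_singleton_self x
  obtain ⟨b, hb⟩ := (Submodule.mem_span_range_iff_exists_fun _).mp h2
  choose a ha using h1
  exact ⟨x, a, b, ha, hb.symm⟩

/-- A multiplicative cocycle of functions on a finite covering by basic open subsets of the spectrum
of a principal ideal domain is a coboundary. -/
theorem exists_mul_coboundary {U : Y.Opens} (hU : IsAffineOpen U)
    [IsPrincipalIdealRing Γ(Y, U)] {J : Type*} [Finite J] [Nonempty J]
    (f : J → Γ(Y, U)) (hne : ∀ j, (Y.basicOpen (f j) : Set Y).Nonempty)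
    (m : ∀ j l : J, Γ(Y, Y.basicOpen (f j) ⊓ Y.basicOpen (f l))) (hone : ∀ j, m j j = 1)
    (hm : ∀ (j l q : J) (W : Y.Opens) (hj : W ≤ Y.basicOpen (f j)) (hl : W ≤ Y.basicOpen (f l))
      (hq : W ≤ Y.basicOpen (f q)),
      res (le_inf hj hl) (m j l) * res (le_inf hl hq) (m l q) = res (le_inf hj hq) (m j q)) :
    ∃ v : ∀ j, Γ(Y, Y.basicOpen (f j)), (∀ j, IsUnit (v j)) ∧
      ∀ j l, res inf_le_left (v j) * m j l = res inf_le_right (v l) := by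
  classical
  have := Fintype.ofFinite J
  have hle : ∀ j, Y.basicOpen (f j) ≤ U := fun j => Y.basicOpen_le _
  let o : J := Classical.arbitrary J
  have hUne : (U : Set Y).Nonempty := (hne o).mono (hle o)
  have hne₂ := fun j l => nonempty_inf (hne j) (hne l)
  -- Over the function field the cocycle is already a coboundary: E_j = m_jo for a fixed index o, so
  -- that m_jl E_l = E_j. It remains to correct the E_j to units.
  let E : J → Y.functionField := fun j => toRat (hne₂ j o) (m j o)
  have hE : ∀ j l, toRat (hne₂ j l) (m j l) * E l = E j := by
    intro j l
    have hne₃ := nonempty_inf (hne₂ j l) (hne o)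
    have h := congrArg (toRat hne₃) (hm j l o (Y.basicOpen (f j) ⊓ Y.basicOpen (f l) ⊓
      Y.basicOpen (f o)) (inf_le_left.trans inf_le_left) (inf_le_left.trans inf_le_right)
      inf_le_right)
    rwa [map_mul, toRat_res (hne₂ j l), toRat_res (hne₂ l o), toRat_res (hne₂ j o)] at h
  have hE0 : ∀ j, E j ≠ 0 := fun j h0 => by
    have h := hE o j
    rw [h0, mul_zero] at h
    have h1 : E o = 1 := by
      change toRat _ (m o o) = 1
      rw [hone, map_one]
    exact one_ne_zero (h1.symm.trans h.symm)
  choose N₀ n₀ hn₀ using fun j l => exists_pow_mul_eq_res (hU.basicOpen (f l)) (res (hle l) (f j))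
    (W := Y.basicOpen (f j) ⊓ Y.basicOpen (f l)) inf_le_right
    ((inf_comm _ _).trans (Y.basicOpen_res _ _).symm) (m j l)
  obtain ⟨N, hN⟩ : ∃ N, ∀ j l, N₀ j l ≤ N := by
    refine ⟨Finset.univ.sup fun p : J × J => N₀ p.1 p.2, fun j l => ?_⟩
    exact Finset.le_sup (f := fun p : J × J => N₀ p.1 p.2) (Finset.mem_univ (j, l))
  obtain ⟨n, hn⟩ : ∃ n : ∀ _ l : J, Γ(Y, Y.basicOpen (f l)), ∀ j l,
      toRat (hne l) (n j l) * E l = toRat hUne (f j) ^ N * E j := by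
    refine ⟨fun j l => res (hle l) (f j) ^ (N - N₀ j l) * n₀ j l, fun j l => ?_⟩
    have h := congrArg (toRat (hne₂ j l)) (hn₀ j l)
    rw [map_mul, map_pow, toRat_res (hne l), toRat_res (hne l), toRat_res hUne] at h
    rw [map_mul, map_pow, toRat_res hUne, h, mul_assoc, mul_assoc, hE, ← mul_assoc, ← pow_add,
      Nat.sub_add_cancel (hN j l)]
  -- The fractional ideal spanned by the f_jᴺ E_j is principal; the cochain is v_l = x / E_l. It is
  -- regular on D(f_l) because f_jᴺ E_j = n_jl E_l there.
  obtain ⟨x, a, b, ha, hb⟩ := exists_principal hU hUne fun j => toRat hUne (f j) ^ N * E j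
  let v : ∀ j, Γ(Y, Y.basicOpen (f j)) := fun l => ∑ j, res (hle l) (b j) * n j l
  have hv : ∀ l, toRat (hne l) (v l) * E l = x := by
    intro l
    rw [hb, map_sum, Finset.sum_mul]
    refine Finset.sum_congr rfl fun j _ => ?_
    rw [map_mul, toRat_res hUne, mul_assoc, hn]
  refine ⟨v, fun l => ?_, fun j l => ?_⟩
  -- From f_lᴺ E_l = a_l x it follows that a_l v_l = f_lᴺ, which is invertible on D(f_l).
  · have h1 : res (hle l) (a l) * v l = res (hle l) (f l) ^ N := by
      apply toRat_injective (hne l)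
      apply mul_right_cancel₀ (hE0 l)
      rw [map_mul, mul_assoc, hv, map_pow, toRat_res hUne, toRat_res hUne, ha]
    have h2 : IsUnit (res (hle l) (f l)) := RingedSpace.isUnit_res_basicOpen _ _
    exact isUnit_of_mul_isUnit_right (h1 ▸ h2.pow N)
  · apply toRat_injective (hne₂ j l)
    apply mul_right_cancel₀ (hE0 l)
    rw [map_mul, mul_assoc, hE, toRat_res (hne j), toRat_res (hne l), hv, hv]

/-- A sheaf of modules that is locally free of rank one is free on the spectrum of a principal ideal
domain. -/
theorem exists_isGenerator {M : Y.Modules} (hM : ∀ p : Y, ∃ (W : Y.Opens) (σ : Γ(M, W)), p ∈ W ∧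
    IsGenerator M W σ) {U : Y.Opens} (hU : IsAffineOpen U) (hne : (U : Set Y).Nonempty)
    [IsPrincipalIdealRing Γ(Y, U)] : ∃ σ : Γ(M, U), IsGenerator M U σ := by
  let s : Set Γ(Y, U) := {f | (Y.basicOpen f : Set Y).Nonempty ∧ ∃ σ : Γ(M, Y.basicOpen f),
    IsGenerator M _ σ}
  have hs : Ideal.span s = ⊤ := by
    rw [← hU.self_le_iSup_basicOpen_iff]
    intro p hp
    obtain ⟨V, σ, hpV, hσ⟩ := hM p
    obtain ⟨f, hf, hpf⟩ := hU.exists_basicOpen_le ⟨p, hpV⟩ hp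
    exact Opens.mem_iSup.mpr ⟨⟨f, ⟨p, hpf⟩, mres M hf σ, hσ.mres hf⟩, hpf⟩
  obtain ⟨t, hts, ht⟩ := (Ideal.span_eq_top_iff_finite s).mp hs
  choose hne' σ hσ using fun j : t => hts j.2
  have hle : ∀ j : t, Y.basicOpen j.1 ≤ U := fun j => Y.basicOpen_le _
  have hcov : U ≤ ⨆ j : t, Y.basicOpen j.1 := hU.self_le_iSup_basicOpen_iff.mpr ht
  obtain ⟨p, hp⟩ := hne
  have : Nonempty t := ⟨(Opens.mem_iSup.mp (hcov hp)).choose⟩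
  choose m hm using fun j l : t => (hσ l (Y.basicOpen j.1 ⊓ Y.basicOpen l.1) inf_le_right).2
    (mres M inf_le_left (σ j))
  beta_reduce at hm
  have hmW : ∀ (j l : t) (W : Y.Opens) (hj : W ≤ Y.basicOpen j.1) (hl : W ≤ Y.basicOpen l.1),
      res (le_inf hj hl) (m j l) • mres M hl (σ l) = mres M hj (σ j) := by
    intro j l W hj hl
    have h1 := congrArg (mres M (le_inf hj hl)) (hm j l)
    rwa [mres_smul, mres_mres, mres_mres] at h1
  obtain ⟨v, hv, hvm⟩ := exists_mul_coboundary hU (fun j : t => j.1) hne' m (fun j => by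
      refine (hσ j _ inf_le_right).1 ?_
      beta_reduce
      rw [hm, one_smul]) (fun j l q W hj hl hq => by
      refine (hσ q W hq).1 ?_
      beta_reduce
      rw [mul_smul, hmW l q W hl hq, hmW j l W hj hl, hmW j q W hj hq])
  -- The relation v_j m_jl = v_l says exactly that the rescaled generators v_j σ_j agree on
  -- overlaps.
  obtain ⟨τ, hτ⟩ := exists_mglue M (fun j : t => Y.basicOpen j.1) hle hcov
    (fun j => v j • σ j) fun j l => by
      rw [mres_smul, mres_smul, ← hm j l, smul_smul, hvm]
  refine ⟨τ, isGenerator_of_cover (fun j : t => Y.basicOpen j.1) hle hcov fun j => ?_⟩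
  rw [hτ]
  exact (hσ j).smul (hv j)

end Principal
end VeryFreeCurves
end


noncomputable section

namespace VeryFreeCurves

/-! ### The projective line -/

section ProjectiveLine

open LaurentPolynomial HomogeneousLocalization

theorem eval₂_mul_of_isHomogeneous {R S σ : Type*} [CommRing R] [CommRing S] [Fintype σ]
    {φ : MvPolynomial σ R} {n : ℕ} (hφ : φ.IsHomogeneous n) (f : R →+* S) (g : σ → S) (c : S) :
    φ.eval₂ f (fun i => c * g i) = c ^ n * φ.eval₂ f g := by
  rw [MvPolynomial.eval₂_eq', MvPolynomial.eval₂_eq', Finset.mul_sum]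
  refine Finset.sum_congr rfl fun d hd => ?_
  have : ∑ i, d i = n := by
    rw [hφ.degree_eq_sum_deg_support hd]
    refine (Finset.sum_subset (Finset.subset_univ _) fun i _ hi => ?_).symm
    simpa using hi
  simp only [mul_pow, Finset.prod_mul_distrib, Finset.prod_pow_eq_pow_sum, this]
  ring

variable (k : Type u) [Field k]

/-- The standard grading of `k[x₀, x₁]`. -/
abbrev grading := MvPolynomial.homogeneousSubmodule (Fin 2) k

/-- The evaluation `x₀ ↦ 1`, `x₁ ↦ T`. -/
def evalLaurent : MvPolynomial (Fin 2) k →+* k[T;T⁻¹] := MvPolynomial.eval₂Hom C ![1, T 1]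

variable {k}

@[simp] theorem evalLaurent_X_zero : evalLaurent k (MvPolynomial.X 0) = 1 := by
  simp [evalLaurent]

@[simp] theorem evalLaurent_X_one : evalLaurent k (MvPolynomial.X 1) = T 1 := by
  simp [evalLaurent]

@[simp] theorem evalLaurent_C (a : k) : evalLaurent k (MvPolynomial.C a) = C a := by
  simp [evalLaurent]

/-- A homogeneous polynomial is recovered from its dehomogenization by x(x₀, x₁) = x₀ⁿ x(1, x₁ /
x₀), read in the fraction field. -/
theorem eq_zero_of_evalLaurent_eq_zero {x : MvPolynomial (Fin 2) k} {n : ℕ}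
    (hx : x.IsHomogeneous n) (h : evalLaurent k x = 0) : x = 0 := by
  let F := FractionRing (MvPolynomial (Fin 2) k)
  let a : Fin 2 → F := fun i => algebraMap (MvPolynomial (Fin 2) k) F (MvPolynomial.X i)
  have ha : ∀ i, a i ≠ 0 := fun i =>
    (map_ne_zero_iff _ (IsFractionRing.injective _ F)).mpr (MvPolynomial.X_ne_zero i)
  let θ : k[T;T⁻¹] →+* F := LaurentPolynomial.eval₂ ((algebraMap (MvPolynomial (Fin 2) k) F).comp MvPolynomial.C)
    (Units.mk0 (a 1 / a 0) (div_ne_zero (ha 1) (ha 0)))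
  have h1 : θ.comp (evalLaurent k) = MvPolynomial.eval₂Hom ((algebraMap (MvPolynomial (Fin 2) k) F).comp MvPolynomial.C)
      ![1, a 1 / a 0] := by
    refine MvPolynomial.ringHom_ext (fun c => ?_) fun i => ?_
    · simp [θ]
    · fin_cases i
      · simp [θ]
      · simp [θ]
  have h2 : MvPolynomial.eval₂Hom ((algebraMap (MvPolynomial (Fin 2) k) F).comp MvPolynomial.C)
      (fun i => a 0 * (![1, a 1 / a 0] : Fin 2 → F) i) = algebraMap (MvPolynomial (Fin 2) k) F := by
    refine MvPolynomial.ringHom_ext (fun c => ?_) fun i => ?_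
    · simp
    · fin_cases i
      · simp [a]
      · simpa using mul_div_cancel₀ (a 1) (ha 0)
  apply IsFractionRing.injective _ F
  rw [map_zero, ← h2, MvPolynomial.coe_eval₂Hom, eval₂_mul_of_isHomogeneous hx]
  have h3 := DFunLike.congr_fun h1 x
  rw [RingHom.comp_apply, h, map_zero] at h3
  rw [← MvPolynomial.coe_eval₂Hom, ← h3, mul_zero]

/-- The expansion of a homogeneous fraction of degree zero as a Laurent polynomial. -/
def awayLaurent (f : MvPolynomial (Fin 2) k) (hf : IsUnit (evalLaurent k f)) :
    Away (grading k) f →+* k[T;T⁻¹] :=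
  (IsLocalization.Away.lift f hf : Localization.Away f →+* k[T;T⁻¹]).comp
    (algebraMap (Away (grading k) f) (Localization.Away f))

theorem awayLaurent_mk {f : MvPolynomial (Fin 2) k} (hf : IsUnit (evalLaurent k f)) {d : ℕ}
    (hd : f ∈ grading k d) (n : ℕ) (x : MvPolynomial (Fin 2) k) (hx : x ∈ grading k (n • d)) :
    awayLaurent f hf (Away.mk (grading k) hd n x hx) * evalLaurent k f ^ n = evalLaurent k x := by
  rw [awayLaurent, RingHom.comp_apply, HomogeneousLocalization.algebraMap_apply, Away.val_mk]
  have h1 : Localization.mk x (⟨f ^ n, n, rfl⟩ : Submonoid.powers f) *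
      algebraMap _ (Localization.Away f) (f ^ n) = algebraMap _ (Localization.Away f) x := by
    rw [Localization.mk_eq_mk']
    exact IsLocalization.mk'_spec (M := Submonoid.powers f) _ x ⟨f ^ n, n, rfl⟩
  have h2 := congrArg (IsLocalization.Away.lift f hf : Localization.Away f →+* k[T;T⁻¹]) h1
  rw [map_mul, IsLocalization.Away.lift_eq, IsLocalization.Away.lift_eq, map_pow] at h2
  exact h2

theorem awayLaurent_injective {f : MvPolynomial (Fin 2) k} (hf : IsUnit (evalLaurent k f)) {d : ℕ}
    (hd : f ∈ grading k d) : Function.Injective (awayLaurent f hf) := by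
  refine (injective_iff_map_eq_zero _).mpr fun z hz => ?_
  obtain ⟨n, x, hx, rfl⟩ := Away.mk_surjective (grading k) hd z
  have h := awayLaurent_mk hf hd n x hx
  rw [hz, zero_mul] at h
  have hx0 := eq_zero_of_evalLaurent_eq_zero hx h.symm
  apply HomogeneousLocalization.val_injective
  rw [Away.val_mk, hx0, Localization.mk_zero, HomogeneousLocalization.val_zero]

theorem awayLaurent_awayMap {f g x : MvPolynomial (Fin 2) k} (hf : IsUnit (evalLaurent k f))
    (hx' : IsUnit (evalLaurent k x)) {d e : ℕ} (hd : f ∈ grading k d) (hg : g ∈ grading k e)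
    (hx : x = f * g) (a : Away (grading k) f) :
    awayLaurent x hx' (awayMap (grading k) hg hx a) = awayLaurent f hf a := by
  obtain ⟨n, y, hy, rfl⟩ := Away.mk_surjective (grading k) hd a
  rw [awayMap_mk]
  apply (hx'.pow n).mul_left_injective
  beta_reduce
  rw [awayLaurent_mk, map_mul, ← awayLaurent_mk hf hd n y hy, hx, map_mul, map_pow, mul_pow,
    mul_assoc]

theorem isUnit_evalLaurent_X (i : Fin 2) : IsUnit (evalLaurent k (MvPolynomial.X i)) := by
  fin_cases i
  · simp
  · simp [isUnit_T]

theorem X_mem_grading (i : Fin 2) : (MvPolynomial.X i : MvPolynomial (Fin 2) k) ∈ grading k 1 :=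
  MvPolynomial.isHomogeneous_X k i

theorem isUnit_evalLaurent_X_mul_X :
    IsUnit (evalLaurent k (MvPolynomial.X 0 * MvPolynomial.X 1)) := by
  rw [map_mul]
  exact (isUnit_evalLaurent_X 0).mul (isUnit_evalLaurent_X 1)

theorem X_mul_X_mem_grading :
    (MvPolynomial.X 0 * MvPolynomial.X 1 : MvPolynomial (Fin 2) k) ∈ grading k 2 :=
  SetLike.mul_mem_graded (X_mem_grading 0) (X_mem_grading 1)

theorem C_mem_grading (c : k) {d : ℕ} : MvPolynomial.C c ∈ grading k (0 • d) := by
  rw [zero_smul]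
  exact MvPolynomial.isHomogeneous_C _ c

theorem C_mem_range_awayLaurent {f : MvPolynomial (Fin 2) k} (hf : IsUnit (evalLaurent k f))
    {d : ℕ} (hd : f ∈ grading k d) (c : k) : C c ∈ (awayLaurent f hf).range := by
  refine ⟨Away.mk (grading k) hd 0 (MvPolynomial.C c) (C_mem_grading c), ?_⟩
  have h := awayLaurent_mk hf hd 0 (MvPolynomial.C c) (C_mem_grading c)
  rwa [pow_zero, mul_one, evalLaurent_C] at h

/-- With T = x₁ / x₀, functions on the chart x₀ ≠ 0 are the polynomials in T; on the other chart
they are the polynomials in T⁻¹. -/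
theorem range_awayLaurent_X_zero : (awayLaurent (k := k) _ (isUnit_evalLaurent_X 0)).range =
    (Polynomial.toLaurent (R := k)).range := by
  apply le_antisymm
  · rintro _ ⟨z, rfl⟩
    obtain ⟨n, x, hx, rfl⟩ := Away.mk_surjective (grading k) (X_mem_grading 0) z
    have h := awayLaurent_mk (isUnit_evalLaurent_X 0) (X_mem_grading 0) n x hx
    rw [evalLaurent_X_zero, one_pow, mul_one] at h
    rw [h]
    refine ⟨MvPolynomial.eval₂Hom Polynomial.C ![1, Polynomial.X] x, ?_⟩
    rw [← RingHom.comp_apply]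
    refine DFunLike.congr_fun (MvPolynomial.ringHom_ext (fun c => ?_) fun i => ?_) x
    · simp
    · fin_cases i <;> simp
  · rintro _ ⟨p, rfl⟩
    have hT : (T 1 : k[T;T⁻¹]) ∈ (awayLaurent (k := k) _ (isUnit_evalLaurent_X 0)).range := by
      refine ⟨Away.mk (grading k) (X_mem_grading 0) 1 (MvPolynomial.X 1)
        (by simpa using X_mem_grading 1), ?_⟩
      have h := awayLaurent_mk (isUnit_evalLaurent_X (k := k) 0) (X_mem_grading 0) 1
        (MvPolynomial.X 1) (by simpa using X_mem_grading 1)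
      rwa [evalLaurent_X_zero, one_pow, mul_one, evalLaurent_X_one] at h
    induction p using Polynomial.induction_on' with
    | add p q hp hq => rw [map_add]; exact add_mem hp hq
    | monomial n c =>
      rw [← Polynomial.C_mul_X_pow_eq_monomial, map_mul, map_pow, Polynomial.toLaurent_C,
        Polynomial.toLaurent_X]
      exact mul_mem (C_mem_range_awayLaurent _ (X_mem_grading 0) c) (pow_mem hT n)

theorem range_awayLaurent_X_one : (awayLaurent (k := k) _ (isUnit_evalLaurent_X 1)).range =
    ((invert (R := k) : k[T;T⁻¹] →+* k[T;T⁻¹]).comp Polynomial.toLaurent).range := by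
  apply le_antisymm
  · rintro _ ⟨z, rfl⟩
    obtain ⟨n, x, hx, rfl⟩ := Away.mk_surjective (grading k) (X_mem_grading 1) z
    have h := awayLaurent_mk (isUnit_evalLaurent_X 1) (X_mem_grading 1) n x hx
    refine ⟨MvPolynomial.eval₂Hom Polynomial.C ![Polynomial.X, 1] x, ?_⟩
    apply ((isUnit_evalLaurent_X (k := k) 1).pow n).mul_left_injective
    beta_reduce
    rw [h, evalLaurent, MvPolynomial.coe_eval₂Hom]
    -- Homogeneity of degree n gives x(1, T) = Tⁿ x(T⁻¹, 1), so dividing by x₁ⁿ leaves a polynomial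
    -- in T⁻¹.
    have h1 := eval₂_mul_of_isHomogeneous (n := n) (by simpa using hx) (C (R := k))
      ![T (-1), 1] (T 1)
    have h2 : (fun i : Fin 2 => (T 1 : k[T;T⁻¹]) * (![T (-1), 1] : Fin 2 → k[T;T⁻¹]) i) =
        ![1, T 1] := by
      funext i
      fin_cases i
      · exact (T_add 1 (-1)).symm.trans T_zero
      · exact mul_one _
    rw [h2] at h1
    refine Eq.trans ?_ h1.symm
    rw [mul_comm, MvPolynomial.eval₂Hom_X']
    congr 1
    rw [← MvPolynomial.coe_eval₂Hom, ← MvPolynomial.coe_eval₂Hom, ← RingHom.comp_apply]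
    refine DFunLike.congr_fun (MvPolynomial.ringHom_ext (fun c => ?_) fun i => ?_) x
    · simp
    · fin_cases i <;> simp
  · rintro _ ⟨p, rfl⟩
    have hT : (T (-1) : k[T;T⁻¹]) ∈ (awayLaurent (k := k) _ (isUnit_evalLaurent_X 1)).range := by
      refine ⟨Away.mk (grading k) (X_mem_grading 1) 1 (MvPolynomial.X 0)
        (by simpa using X_mem_grading 0), ?_⟩
      have h := awayLaurent_mk (isUnit_evalLaurent_X (k := k) 1) (X_mem_grading 1) 1
        (MvPolynomial.X 0) (by simpa using X_mem_grading 0)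
      rw [evalLaurent_X_one, pow_one, evalLaurent_X_zero] at h
      apply (isUnit_T (R := k) 1).mul_left_injective
      beta_reduce
      rw [h, ← T_add]
      simp
    induction p using Polynomial.induction_on' with
    | add p q hp hq => rw [map_add]; exact add_mem hp hq
    | monomial n c =>
      rw [← Polynomial.C_mul_X_pow_eq_monomial, map_mul, map_pow, RingHom.comp_apply,
        RingHom.comp_apply, Polynomial.toLaurent_C, Polynomial.toLaurent_X]
      refine mul_mem ?_ (pow_mem ?_ n)
      · simpa using C_mem_range_awayLaurent (isUnit_evalLaurent_X 1) (X_mem_grading 1) c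
      · simpa using hT

/-- The image contains the images of both charts, hence all polynomials in T and in T⁻¹, and these
generate. -/
theorem awayLaurent_X_mul_X_surjective :
    Function.Surjective (awayLaurent (k := k) _ isUnit_evalLaurent_X_mul_X) := by
  rw [← RingHom.range_eq_top, eq_top_iff]
  have h0 : (awayLaurent (k := k) _ (isUnit_evalLaurent_X 0)).range ≤
      (awayLaurent (k := k) _ isUnit_evalLaurent_X_mul_X).range := by
    rintro _ ⟨z, rfl⟩
    exact ⟨_, awayLaurent_awayMap (isUnit_evalLaurent_X 0) isUnit_evalLaurent_X_mul_X
      (X_mem_grading 0) (X_mem_grading 1) rfl z⟩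
  have h1 : (awayLaurent (k := k) _ (isUnit_evalLaurent_X 1)).range ≤
      (awayLaurent (k := k) _ isUnit_evalLaurent_X_mul_X).range := by
    rintro _ ⟨z, rfl⟩
    exact ⟨_, awayLaurent_awayMap (isUnit_evalLaurent_X 1) isUnit_evalLaurent_X_mul_X
      (X_mem_grading 1) (X_mem_grading 0) (mul_comm _ _) z⟩
  rw [range_awayLaurent_X_zero] at h0
  rw [range_awayLaurent_X_one] at h1
  intro p _
  induction p using LaurentPolynomial.induction_on' with
  | add p q hp hq => exact add_mem (hp trivial) (hq trivial)
  | C_mul_T n a =>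
    refine mul_mem (h0 ⟨Polynomial.C a, by simp⟩) ?_
    obtain ⟨m, rfl | rfl⟩ := n.eq_nat_or_neg
    · exact h0 ⟨Polynomial.X ^ m, by simp⟩
    · exact h1 ⟨Polynomial.X ^ m, by simp⟩

end ProjectiveLine
end VeryFreeCurves
end


noncomputable section

namespace VeryFreeCurves

/-! ### Functions on the projective line -/

section ProjectiveLineFunctions

open LaurentPolynomial HomogeneousLocalization

theorem isDomain_homogeneousLocalization {A : Type*} [CommRing A] [IsDomain A] {σ : Type*}
    [SetLike σ A] [AddSubgroupClass σ A] (𝒜 : ℕ → σ) [GradedRing 𝒜] (P : Ideal A) [P.IsPrime] :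
    IsDomain (HomogeneousLocalization.AtPrime 𝒜 P) := by
  have : IsDomain (Localization.AtPrime P) :=
    IsLocalization.isDomain_localization P.primeCompl_le_nonZeroDivisors
  exact Function.Injective.isDomain (algebraMap (HomogeneousLocalization.AtPrime 𝒜 P)
    (Localization.AtPrime P)) (HomogeneousLocalization.val_injective _)

/-- The generic point of projective space. -/
def projSpaceGenericPoint (n : ℕ) (k : Type u) [Field k] : projSpace n k where
  asHomogeneousIdeal := ⊥
  isPrime := by
    rw [HomogeneousIdeal.toIdeal_bot]
    exact Ideal.isPrime_bot
  not_irrelevant_le h := by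
    have h1 : (MvPolynomial.X 0 : MvPolynomial (Fin (n + 1)) k) ∈
        HomogeneousIdeal.irrelevant (MvPolynomial.homogeneousSubmodule (Fin (n + 1)) k) := by
      rw [HomogeneousIdeal.mem_irrelevant_iff, GradedRing.proj_apply]
      exact DirectSum.decompose_of_mem_ne _ (MvPolynomial.isHomogeneous_X k 0) one_ne_zero
    have h2 := h h1
    exact MvPolynomial.X_ne_zero (R := k) (0 : Fin (n + 1)) h2

/-- Stalks are subrings of localizations of a domain, hence reduced, and the zero ideal is a point
lying in every nonempty open subset. -/
instance isIntegral_projSpace (n : ℕ) (k : Type u) [Field k] : IsIntegral (projSpace n k) := by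
  have : ∀ x : projSpace n k, _root_.IsReduced ((projSpace n k).presheaf.stalk x) := fun x => by
    have := x.isPrime
    have := isDomain_homogeneousLocalization (MvPolynomial.homogeneousSubmodule (Fin (n + 1)) k)
      x.asHomogeneousIdeal.toIdeal
    exact isReduced_of_injective (Proj.stalkIso _ x).hom.hom
      (ConcreteCategory.bijective_of_isIso (Proj.stalkIso _ x).hom).1
  have : IsReduced (projSpace n k) := isReduced_of_isReduced_stalk _
  have hgen : ∀ U : Set (projSpace n k), IsOpen U → U.Nonempty → projSpaceGenericPoint n k ∈ U := by
    rintro U hU ⟨x, hx⟩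
    have : x ∈ closure {projSpaceGenericPoint n k} :=
      (ProjectiveSpectrum.le_iff_mem_closure _ _ _).mp (bot_le (a := x.asHomogeneousIdeal))
    obtain ⟨y, hyU, hy⟩ := mem_closure_iff.mp this U hU hx
    rwa [Set.mem_singleton_iff.mp hy] at hyU
  have : IrreducibleSpace (projSpace n k) :=
    { toNonempty := ⟨projSpaceGenericPoint n k⟩
      isPreirreducible_univ := fun U V hU hV h h' =>
        ⟨projSpaceGenericPoint n k, trivial, hgen U hU (by simpa using h),
          hgen V hV (by simpa using h')⟩ }
  exact isIntegral_of_irreducibleSpace_of_isReduced _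

variable {n : ℕ} {k : Type u} [Field k]

theorem isAffineOpen_chart (i : Fin (n + 1)) : IsAffineOpen (chart (k := k) i) :=
  Proj.isAffineOpen_basicOpen _ _ (MvPolynomial.isHomogeneous_X k i) one_pos

theorem nonempty_chart (i : Fin (n + 1)) : ((chart (k := k) i : (projSpace n k).Opens) :
    Set (projSpace n k)).Nonempty := by
  refine ⟨projSpaceGenericPoint n k, ?_⟩
  exact fun h => MvPolynomial.X_ne_zero (R := k) i h

theorem iSup_chart : ⨆ i, chart (k := k) (n := n) i = ⊤ := by
  refine Proj.iSup_basicOpen_eq_top' _ _ (fun i => ⟨1, MvPolynomial.isHomogeneous_X k i⟩) ?_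
  rw [eq_top_iff]
  intro p _
  induction p using MvPolynomial.induction_on with
  | C a =>
    let c : MvPolynomial.homogeneousSubmodule (Fin (n + 1)) k 0 :=
      ⟨MvPolynomial.C a, MvPolynomial.isHomogeneous_C _ a⟩
    exact Subalgebra.algebraMap_mem _ c
  | add p q hp hq => exact add_mem (hp trivial) (hq trivial)
  | mul_X p i hp => exact mul_mem (hp trivial) (Algebra.subset_adjoin ⟨i, rfl⟩)

theorem chart_sup_chart : chart (k := k) (n := 1) 0 ⊔ chart 1 = ⊤ := by
  rw [← iSup_chart]
  refine le_antisymm (sup_le (le_iSup _ _) (le_iSup _ _)) (iSup_le fun i => ?_)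
  fin_cases i
  · exact le_sup_left
  · exact le_sup_right

/-- The expansion of a function on a basic open subset as a Laurent polynomial. -/
def sectionLaurent (f : MvPolynomial (Fin 2) k) (hf : IsUnit (evalLaurent k f)) {d : ℕ}
    (hd : f ∈ grading k d) (hpos : 0 < d) :
    Γ(projSpace 1 k, Proj.basicOpen (grading k) f) →+* k[T;T⁻¹] :=
  (awayLaurent f hf).comp (Proj.basicOpenIsoAway (grading k) f hd hpos).inv.hom

theorem sectionLaurent_awayToSection {f : MvPolynomial (Fin 2) k} (hf : IsUnit (evalLaurent k f))
    {d : ℕ} (hd : f ∈ grading k d) (hpos : 0 < d) (a : Away (grading k) f) :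
    sectionLaurent f hf hd hpos (Proj.awayToSection (grading k) f a) = awayLaurent f hf a :=
  congrArg (awayLaurent f hf)
    (ConcreteCategory.congr_hom (Proj.basicOpenIsoAway (grading k) f hd hpos).hom_inv_id a)

theorem exists_awayToSection {f : MvPolynomial (Fin 2) k}
    {d : ℕ} (hd : f ∈ grading k d) (hpos : 0 < d)
    (s : Γ(projSpace 1 k, Proj.basicOpen (grading k) f)) :
    ∃ a, Proj.awayToSection (grading k) f a = s :=
  ⟨_, ConcreteCategory.congr_hom (Proj.basicOpenIsoAway (grading k) f hd hpos).inv_hom_id s⟩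

theorem range_sectionLaurent {f : MvPolynomial (Fin 2) k} (hf : IsUnit (evalLaurent k f))
    {d : ℕ} (hd : f ∈ grading k d) (hpos : 0 < d) :
    (sectionLaurent f hf hd hpos).range = (awayLaurent f hf).range := by
  apply le_antisymm
  · rintro _ ⟨s, rfl⟩
    exact ⟨_, rfl⟩
  · rintro _ ⟨a, rfl⟩
    exact ⟨_, sectionLaurent_awayToSection hf hd hpos a⟩

theorem sectionLaurent_injective {f : MvPolynomial (Fin 2) k} (hf : IsUnit (evalLaurent k f))
    {d : ℕ} (hd : f ∈ grading k d) (hpos : 0 < d) :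
    Function.Injective (sectionLaurent f hf hd hpos) :=
  (awayLaurent_injective hf hd).comp (ConcreteCategory.bijective_of_isIso
    (Proj.basicOpenIsoAway (grading k) f hd hpos).inv).1

/-- The expansion of a function on a standard chart of the projective line as a Laurent
polynomial in `x₁ / x₀`. -/
def chartLaurent (i : Fin 2) : Γ(projSpace 1 k, chart i) →+* k[T;T⁻¹] :=
  sectionLaurent (MvPolynomial.X i) (isUnit_evalLaurent_X i) (X_mem_grading i) one_pos

theorem basicOpen_X_mul_X : Proj.basicOpen (grading k) (MvPolynomial.X 0 * MvPolynomial.X 1) =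
    chart (k := k) (n := 1) 0 ⊓ chart 1 :=
  Proj.basicOpen_mul _ _ _

/-- The expansion of a function on the intersection of the standard charts of the projective line
as a Laurent polynomial in `x₁ / x₀`. -/
def overlapLaurent : Γ(projSpace 1 k, chart (n := 1) 0 ⊓ chart 1) →+* k[T;T⁻¹] :=
  (sectionLaurent _ isUnit_evalLaurent_X_mul_X X_mul_X_mem_grading two_pos).comp
    (res basicOpen_X_mul_X.le)

theorem chartLaurent_injective (i : Fin 2) : Function.Injective (chartLaurent (k := k) i) :=
  sectionLaurent_injective _ _ _

theorem overlapLaurent_bijective : Function.Bijective (overlapLaurent (k := k)) := by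
  constructor
  · refine (sectionLaurent_injective isUnit_evalLaurent_X_mul_X X_mul_X_mem_grading
      two_pos).comp ?_
    intro a b hab
    have := congrArg (res basicOpen_X_mul_X.ge) hab
    rwa [res_res, res_res, res_self, res_self] at this
  · intro p
    obtain ⟨a, ha⟩ := awayLaurent_X_mul_X_surjective p
    refine ⟨res basicOpen_X_mul_X.ge (Proj.awayToSection (grading k) _ a), ?_⟩
    rw [overlapLaurent, RingHom.comp_apply, res_res, res_self, sectionLaurent_awayToSection, ha]

theorem sectionLaurent_res {f g x : MvPolynomial (Fin 2) k} (hf : IsUnit (evalLaurent k f))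
    (hx' : IsUnit (evalLaurent k x)) {d e l : ℕ} (hd : f ∈ grading k d) (hg : g ∈ grading k e)
    (hl : x ∈ grading k l) (hpos : 0 < d) (hpos' : 0 < l) (hx : x = f * g)
    (h : Proj.basicOpen (grading k) x ≤ Proj.basicOpen (grading k) f)
    (r : Γ(Proj (grading k), Proj.basicOpen (grading k) f)) :
    sectionLaurent x hx' hl hpos' (res h r) = sectionLaurent f hf hd hpos r := by
  obtain ⟨a, rfl⟩ := exists_awayToSection hd hpos r
  rw [sectionLaurent_awayToSection, ← awayLaurent_awayMap hf hx' hd hg hx a,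
    ← sectionLaurent_awayToSection hx' hl hpos']
  refine congrArg _ ?_
  exact (ConcreteCategory.congr_hom (Proj.awayMap_awayToSection (grading k) hg hx) a).symm

theorem overlapLaurent_res_zero (r : Γ(projSpace 1 k, chart 0)) :
    overlapLaurent (res inf_le_left r) = chartLaurent 0 r := by
  rw [overlapLaurent, RingHom.comp_apply, res_res]
  exact sectionLaurent_res (isUnit_evalLaurent_X 0) isUnit_evalLaurent_X_mul_X
    (X_mem_grading 0) (X_mem_grading 1) X_mul_X_mem_grading one_pos two_pos rfl
    (basicOpen_X_mul_X.le.trans inf_le_left) r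

theorem overlapLaurent_res_one (r : Γ(projSpace 1 k, chart 1)) :
    overlapLaurent (res inf_le_right r) = chartLaurent 1 r := by
  rw [overlapLaurent, RingHom.comp_apply, res_res]
  exact sectionLaurent_res (isUnit_evalLaurent_X 1) isUnit_evalLaurent_X_mul_X
    (X_mem_grading 1) (X_mem_grading 0) X_mul_X_mem_grading one_pos two_pos (mul_comm _ _)
    (basicOpen_X_mul_X.le.trans inf_le_right) r

theorem mem_range_chartLaurent_zero {p : k[T;T⁻¹]} :
    (∃ r, chartLaurent 0 r = p) ↔ ∃ q, Polynomial.toLaurent q = p := by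
  have : (chartLaurent (k := k) 0).range = _ :=
    (range_sectionLaurent _ _ _).trans range_awayLaurent_X_zero
  exact SetLike.ext_iff.mp this p

theorem mem_range_chartLaurent_one {p : k[T;T⁻¹]} :
    (∃ r, chartLaurent 1 r = p) ↔ ∃ q, invert (Polynomial.toLaurent q) = p := by
  have : (chartLaurent (k := k) 1).range = _ :=
    (range_sectionLaurent _ _ _).trans range_awayLaurent_X_one
  exact SetLike.ext_iff.mp this p

theorem chartLaurent_ratio (i j : Fin 2) : chartLaurent i (ratio (k := k) (n := 1) i j) *
    evalLaurent k (MvPolynomial.X i) = evalLaurent k (MvPolynomial.X j) := by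
  have h := awayLaurent_mk (isUnit_evalLaurent_X (k := k) i) (X_mem_grading i) 1
    (MvPolynomial.X j) (by simpa using X_mem_grading j)
  rw [pow_one] at h
  exact (congrArg (· * _)
    (sectionLaurent_awayToSection (isUnit_evalLaurent_X i) (X_mem_grading i) one_pos _)).trans h

/-- A is isomorphic to its image, which is also the image of the principal ideal ring B. Both charts
of the projective line are handled this way, with B = k[X]. -/
theorem isPrincipalIdealRing_of_range_eq {A B R : Type*} [CommRing A] [CommRing B] [CommRing R]
    [IsPrincipalIdealRing B] (f : A →+* R) (hf : Function.Injective f) (g : B →+* R)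
    (h : ∀ x, (∃ a, f a = x) ↔ ∃ b, g b = x) : IsPrincipalIdealRing A := by
  let e : A ≃+* f.range := RingEquiv.ofBijective f.rangeRestrict
    ⟨fun a b hab => hf (congrArg Subtype.val hab), f.rangeRestrict_surjective⟩
  let g' : B →+* f.range := g.codRestrict f.range fun b => (h _).mpr ⟨b, rfl⟩
  refine IsPrincipalIdealRing.of_surjective ((e.symm : f.range →+* A).comp g') ?_
  refine e.symm.surjective.comp fun x => ?_
  obtain ⟨b, hb⟩ := (h x).mp x.2
  exact ⟨b, Subtype.ext hb⟩

instance isPrincipalIdealRing_chart (i : Fin 2) :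
    IsPrincipalIdealRing Γ(projSpace 1 k, chart i) := by
  fin_cases i
  · exact isPrincipalIdealRing_of_range_eq (chartLaurent 0) (chartLaurent_injective 0)
      Polynomial.toLaurent fun _ => mem_range_chartLaurent_zero
  · exact isPrincipalIdealRing_of_range_eq (chartLaurent 1) (chartLaurent_injective 1)
      ((invert (R := k) : k[T;T⁻¹] →+* k[T;T⁻¹]).comp Polynomial.toLaurent)
      fun _ => mem_range_chartLaurent_one

end ProjectiveLineFunctions
end VeryFreeCurves
end


noncomputable section

namespace VeryFreeCurves

/-! ### Laurent polynomials -/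

section Laurent

open LaurentPolynomial

variable {k : Type u} [Field k]

/-- After multiplication by powers of T, the unit and its inverse are polynomials whose product is a
power of the prime X. -/
theorem exists_eq_C_mul_T_of_isUnit {u : k[T;T⁻¹]} (hu : IsUnit u) :
    ∃ c : k, c ≠ 0 ∧ ∃ m : ℤ, u = C c * T m := by
  obtain ⟨v, hv⟩ := hu.exists_right_inv
  obtain ⟨a, p, hp⟩ := u.exists_T_pow
  obtain ⟨b, q, hq⟩ := v.exists_T_pow
  have h1 : p * q = Polynomial.X ^ (a + b) := by
    apply Polynomial.toLaurent_injective
    rw [map_mul, hp, hq, map_pow, Polynomial.toLaurent_X, T_pow, mul_mul_mul_comm, hv, one_mul,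
      ← T_add]
    push_cast
    ring_nf
  obtain ⟨m, _, hm⟩ := (dvd_prime_pow Polynomial.prime_X (a + b)).mp (Dvd.intro q h1)
  obtain ⟨w, hw⟩ := hm.symm
  obtain ⟨c, hc, hcw⟩ := Polynomial.isUnit_iff.mp w.isUnit
  refine ⟨c, hc.ne_zero, m - a, ?_⟩
  have h2 : u = Polynomial.toLaurent p * T (-a) := by
    rw [hp, mul_assoc, ← T_add, add_neg_cancel, T_zero, mul_one]
  rw [h2, ← hw, ← hcw, map_mul, map_pow, Polynomial.toLaurent_X, Polynomial.toLaurent_C, T_pow,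
    T_sub, mul_one, mul_comm (T _) (C c), mul_assoc]

/-- The right side involves only exponents at most l. -/
theorem coeff_eq_zero_of_toLaurent_eq {p q : Polynomial k} {c : k} {l : ℤ}
    (h : Polynomial.toLaurent p = C c * T l * invert (Polynomial.toLaurent q)) (e : ℕ)
    (he : l < e) : p.coeff e = 0 := by
  have h1 := congrArg (fun f : k[T;T⁻¹] => f.coeff (e : ℤ)) h
  beta_reduce at h1
  rw [← single_eq_C_mul_T, AddMonoidAlgebra.coeff_single_mul_apply, invert_apply, coeff_toLaurent,
    coeff_toLaurent, Finsupp.mapDomain_of_notMem_range q.toFinsupp.coeff, mul_zero] at h1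
  · exact (Finsupp.mapDomain_apply (f := (Nat.castEmbedding : ℕ ↪ ℤ)) Nat.castEmbedding.injective
      p.toFinsupp.coeff e).symm.trans h1
  · rintro ⟨n, hn⟩
    have : (n : ℤ) = -(-l + e) := hn
    omega

/-- This is the vanishing of the Čech H¹ of 𝒪(m). The first chart supplies the exponents n ≥ 0 and
the second those with n ≤ m; no exponent is missed exactly because m ≥ -1. -/
theorem exists_eq_toLaurent_add (f : k[T;T⁻¹]) {c : k} (hc : c ≠ 0) {m : ℤ} (hm : -1 ≤ m) :
    ∃ p q : Polynomial k, f = Polynomial.toLaurent p +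
      C c * T m * invert (Polynomial.toLaurent q) := by
  induction f using LaurentPolynomial.induction_on' with
  | add f g hf hg =>
    obtain ⟨p, q, rfl⟩ := hf
    obtain ⟨p', q', rfl⟩ := hg
    exact ⟨p + p', q + q', by simp only [map_add]; ring⟩
  | C_mul_T n a =>
    rcases le_or_gt 0 n with hn | hn
    · lift n to ℕ using hn
      exact ⟨Polynomial.C a * Polynomial.X ^ n, 0, by simp⟩
    · refine ⟨0, Polynomial.C (c⁻¹ * a) * Polynomial.X ^ (m - n).toNat, ?_⟩
      have h1 : T n = T m * T (-((m - n).toNat : ℤ)) (R := k) := by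
        rw [← T_add]
        congr 1
        omega
      rw [map_zero, zero_add, map_mul, map_mul, map_pow, map_pow, Polynomial.toLaurent_C,
        Polynomial.toLaurent_X, invert_C, invert_T, T_pow, h1, map_mul]
      have h2 : C c * C c⁻¹ = (1 : k[T;T⁻¹]) := by rw [← map_mul, mul_inv_cancel₀ hc, map_one]
      rw [mul_neg_one]
      linear_combination (- C a * T m * T (-((m - n).toNat : ℤ))) * h2

end Laurent

/-! ### Line bundles on the projective line and their degree -/

section LineBundles

open LaurentPolynomial

variable {k : Type u} [Field k]

/-- The intersection of the standard charts of the projective line. -/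
abbrev overlap : (projSpace 1 k).Opens := chart 0 ⊓ chart 1

theorem nonempty_overlap : ((overlap (k := k)) : Set (projSpace 1 k)).Nonempty :=
  nonempty_inf (nonempty_chart 0) (nonempty_chart 1)

theorem overlap_le_chart (i : Fin 2) : overlap (k := k) ≤ chart i := by
  fin_cases i
  · exact inf_le_left
  · exact inf_le_right

theorem overlapLaurent_res (i : Fin 2) (h : overlap (k := k) ≤ chart i)
    (r : Γ(projSpace 1 k, chart i)) : overlapLaurent (res h r) = chartLaurent i r := by
  fin_cases i
  · exact overlapLaurent_res_zero r
  · exact overlapLaurent_res_one r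

theorem isUnit_of_chartLaurent_eq_C (i : Fin 2) {r : Γ(projSpace 1 k, chart i)} {a : k}
    (ha : a ≠ 0) (h : chartLaurent i r = C a) : IsUnit r := by
  obtain ⟨s, hs⟩ : ∃ s : Γ(projSpace 1 k, chart i), chartLaurent i s = C a⁻¹ := by
    fin_cases i
    · exact mem_range_chartLaurent_zero.mpr ⟨Polynomial.C a⁻¹, by simp⟩
    · exact mem_range_chartLaurent_one.mpr ⟨Polynomial.C a⁻¹, by simp⟩
  refine IsUnit.of_mul_eq_one s (chartLaurent_injective i ?_)
  rw [map_mul, h, hs, ← map_mul, mul_inv_cancel₀ ha, map_one, map_one]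

/-- If a function on the first chart is obtained from one on the second chart by multiplication with
a power of the unit `c Tᵐ`, then `m ≥ 0`, and both functions are units if `m = 0`. -/
theorem degree_nonneg_of_res_eq {u : Γ(projSpace 1 k, overlap)} {c : k} (hc : c ≠ 0) {m : ℤ}
    (hu : overlapLaurent u = C c * T m) {n : ℕ} (hn : 0 < n) {r₀ : Γ(projSpace 1 k, chart 0)}
    {r₁ : Γ(projSpace 1 k, chart 1)} (hr₀ : r₀ ≠ 0)
    (h : res inf_le_left r₀ = u ^ n * res inf_le_right r₁) :
    0 ≤ m ∧ (m = 0 → IsUnit r₀ ∧ IsUnit r₁) := by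
  obtain ⟨p, hp⟩ := mem_range_chartLaurent_zero.mp ⟨r₀, rfl⟩
  obtain ⟨q, hq⟩ := mem_range_chartLaurent_one.mp ⟨r₁, rfl⟩
  have h1 := congrArg overlapLaurent h
  rw [map_mul, map_pow, overlapLaurent_res_zero, overlapLaurent_res_one, hu, ← hp, ← hq, mul_pow,
    T_pow, ← map_pow] at h1
  have hp0 : p ≠ 0 := by
    rintro rfl
    rw [map_zero] at hp
    exact hr₀ (chartLaurent_injective 0 (hp.symm.trans (map_zero _).symm))
  -- A polynomial in T equals a polynomial in T⁻¹ times a multiple of Tⁿᵐ, so all its exponents are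
  -- at most n m; as it is nonzero, n m ≥ 0.
  have hle : 0 ≤ (n : ℤ) * m := by
    by_contra hlt
    push Not at hlt
    refine hp0 (Polynomial.ext fun e => ?_)
    rw [coeff_eq_zero_of_toLaurent_eq h1 e (by omega), Polynomial.coeff_zero]
  refine ⟨nonneg_of_mul_nonneg_right hle (by exact_mod_cast hn), ?_⟩
  rintro rfl
  rw [mul_zero] at h1
  have hpC : p = Polynomial.C (p.coeff 0) := by
    refine Polynomial.ext fun e => ?_
    rw [Polynomial.coeff_C]
    split_ifs with he
    · rw [he]
    · exact coeff_eq_zero_of_toLaurent_eq h1 e (by omega)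
  have ha : p.coeff 0 ≠ 0 := fun h0 => hp0 (by rw [hpC, h0, map_zero])
  rw [hpC, Polynomial.toLaurent_C] at hp h1
  refine ⟨isUnit_of_chartLaurent_eq_C 0 ha hp.symm, ?_⟩
  -- For m = 0 the first function is a constant, and the second is that constant divided by cⁿ.
  refine isUnit_of_chartLaurent_eq_C 1 (a := (c ^ n)⁻¹ * p.coeff 0)
    (mul_ne_zero (inv_ne_zero (pow_ne_zero n hc)) ha) ?_
  have h2 : C (c ^ n)⁻¹ * C (c ^ n) = (1 : k[T;T⁻¹]) := by
    rw [← map_mul, inv_mul_cancel₀ (pow_ne_zero n hc), map_one]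
  rw [map_mul, h1, ← hq, T_zero, mul_one, ← mul_assoc, h2, one_mul]

/-- A global function on the projective line vanishes identically or nowhere. -/
theorem eq_zero_or_basicOpen_eq_top (a : Γ(projSpace 1 k, ⊤)) :
    a = 0 ∨ (projSpace 1 k).basicOpen a = ⊤ := by
  by_cases h0 : res (le_top : chart 0 ≤ ⊤) a = 0
  · left
    exact res_injective (le_top : chart (k := k) (n := 1) 0 ≤ ⊤) (nonempty_chart 0)
      (h0.trans (map_zero _).symm)
  · right
    -- This is the degree zero case for the trivial bundle: the transition function is 1, and the
    -- two functions are the restrictions of a.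
    obtain ⟨h₀, h₁⟩ := (degree_nonneg_of_res_eq (u := 1) (c := 1) one_ne_zero (m := 0)
      (by simp) one_pos (r₁ := res le_top a) h0 (by
        rw [one_pow, one_mul, res_res, res_res])).2 rfl
    refine eq_top_iff.mpr (chart_sup_chart.ge.trans (sup_le ?_ ?_))
    · have := (projSpace 1 k).basicOpen_of_isUnit h₀
      rw [Scheme.basicOpen_res] at this
      exact inf_eq_left.mp this
    · have := (projSpace 1 k).basicOpen_of_isUnit h₁
      rw [Scheme.basicOpen_res] at this
      exact inf_eq_left.mp this

/-- A morphism from the projective line to an affine scheme is constant. -/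
theorem exists_forall_eq_of_isAffineOpen {D : Scheme.{u}} (h : projSpace 1 k ⟶ D) {V : D.Opens}
    (hV : IsAffineOpen V) (hh : ∀ x, h x ∈ V) : ∃ y : D, ∀ x, h x = y := by
  refine ⟨h (projSpaceGenericPoint 1 k), fun x => ?_⟩
  have key : ∀ (a : Γ(D, V)) (x x' : projSpace 1 k), h x ∈ D.basicOpen a → h x' ∈ D.basicOpen a := by
    intro a x x' hx
    have h1 : h ⁻¹ᵁ V = ⊤ := eq_top_iff.mpr fun y _ => hh y
    have h2 := h.preimage_basicOpen a
    have hx' : x ∈ h ⁻¹ᵁ D.basicOpen a := hx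
    change x' ∈ h ⁻¹ᵁ D.basicOpen a
    rw [h2] at hx' ⊢
    have h3 := Scheme.basicOpen_res (projSpace 1 k) (h.app V a) (homOfLE h1.ge).op
    rw [top_inf_eq] at h3
    rw [← h3] at hx' ⊢
    rcases eq_zero_or_basicOpen_eq_top (res h1.ge (h.app V a)) with h0 | h0
    · rw [h0] at hx'
      simp at hx'
    · rw [h0]
      trivial
  refine Inseparable.eq (inseparable_iff_forall_isOpen.mpr fun U hU => ?_)
  have half : ∀ x x' : projSpace 1 k, h x ∈ U → h x' ∈ U := fun x x' hx => by
    obtain ⟨f, hf, hxf⟩ := hV.exists_basicOpen_le (V := ⟨U, hU⟩) ⟨h x, hx⟩ (hh x)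
    exact hf (key f x x' hxf)
  exact ⟨half _ _, half _ _⟩

theorem isCocycle_ratio (l : ℕ) :
    IsCocycle (chart (n := 1) (k := k)) (fun i j => ratio i j ^ l) where
  cover p := by
    have : p ∈ ⨆ i, chart (n := 1) (k := k) i := by
      rw [iSup_chart]
      trivial
    exact Opens.mem_iSup.mp this
  self i := by
    have : ratio (n := 1) (k := k) i i = 1 := by
      apply chartLaurent_injective i
      apply (isUnit_evalLaurent_X i).mul_left_injective
      beta_reduce
      rw [chartLaurent_ratio, map_one, one_mul]
    rw [this, one_pow]
  mul i j q := by
    rw [map_pow, map_pow, map_pow, ← mul_pow]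
    congr 1
    -- The indices may coincide, but every intersection of two charts contains the overlap, where
    -- the relation becomes one between Laurent polynomials.
    apply res_injective (le_inf (overlap_le_chart i) (overlap_le_chart j)) nonempty_overlap
    apply overlapLaurent_bijective.1
    rw [map_mul, map_mul, res_res, res_res, res_res, overlapLaurent_res, overlapLaurent_res,
      overlapLaurent_res]
    apply (isUnit_evalLaurent_X i).mul_left_injective
    beta_reduce
    rw [chartLaurent_ratio, mul_right_comm, chartLaurent_ratio, mul_comm, chartLaurent_ratio]

/-- The first cohomology of `F(-2)` vanishes for a line bundle `F` of positive degree. -/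
theorem subsingleton_cohomology_twistNeg_two {F : (projSpace 1 k).Modules} {σ₀ : Γ(F, chart 0)}
    {σ₁ : Γ(F, chart 1)} (hσ₀ : IsGenerator F _ σ₀) (hσ₁ : IsGenerator F _ σ₁)
    {u : Γ(projSpace 1 k, overlap)}
    (hu : mres F inf_le_right σ₁ = u • mres F inf_le_left σ₀) {c : k} (hc : c ≠ 0) {m : ℤ}
    (hum : overlapLaurent u = C c * T m) (hm : 1 ≤ m) :
    Subsingleton (cohomology (twistNeg F 2) 1) := by
  have hg := isCocycle_ratio (k := k) 2
  have hτ := mres_twistOf_eq hg (i := 0) (j := 1) le_rfl le_rfl inf_le_left inf_le_right hu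
  refine subsingleton_cohomology_one (isAffineOpen_chart 0) (isAffineOpen_chart 1) chart_sup_chart
    (hσ₀.twist hg le_rfl) (hσ₁.twist hg le_rfl) fun x => ?_
  obtain ⟨r, hr⟩ := (hσ₀.twist hg le_rfl overlap inf_le_left).2 x
  -- Twisting multiplies the transition function by (x₀ / x₁)² = T⁻², lowering the degree from m to
  -- m - 2 ≥ -1.
  have hv : overlapLaurent (res (inf_le_right : overlap (k := k) ≤ chart 1) (ratio 1 0 ^ 2) * u) =
      C c * T (m - 2) := by
    rw [map_mul, map_pow, map_pow, overlapLaurent_res_one, hum]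
    have h1 := chartLaurent_ratio (k := k) 1 0
    rw [evalLaurent_X_one, evalLaurent_X_zero] at h1
    have h2 : chartLaurent 1 (ratio (k := k) (n := 1) 1 0) = T (-1) := by
      apply (isUnit_T (R := k) 1).mul_left_injective
      beta_reduce
      rw [h1, ← T_add, neg_add_cancel, T_zero]
    rw [h2, T_pow, T_sub, mul_comm, mul_assoc]
    rfl
  obtain ⟨p, q, hpq⟩ := exists_eq_toLaurent_add (overlapLaurent r) hc (m := m - 2) (by omega)
  obtain ⟨r₀, hr₀⟩ := mem_range_chartLaurent_zero.mpr ⟨p, rfl⟩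
  obtain ⟨r₁, hr₁⟩ := mem_range_chartLaurent_one.mpr ⟨q, rfl⟩
  refine ⟨r₀ • twistOf hg F 0 le_rfl σ₀, r₁ • twistOf hg F 1 le_rfl σ₁, ?_⟩
  have hr' : r = res inf_le_left r₀ + res inf_le_right r₁ *
      (res (inf_le_right : overlap (k := k) ≤ chart 1) (ratio 1 0 ^ 2) * u) := by
    apply overlapLaurent_bijective.1
    rw [map_add, map_mul, hv, overlapLaurent_res_zero, overlapLaurent_res_one, hr₀, hr₁, hpq,
      mul_comm (invert _)]
  beta_reduce at hr
  refine hr.symm.trans ?_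
  rw [hr', add_smul, mul_smul]
  refine congrArg₂ (· + ·) (mres_smul _ _ _ _).symm ?_
  refine Eq.trans ?_ (mres_smul _ _ _ _).symm
  exact congrArg (_ • ·) hτ.symm

end LineBundles
end VeryFreeCurves
end


noncomputable section

namespace VeryFreeCurves

/-! ### Smooth hypersurfaces: commutative algebra -/

section HypersurfaceAlgebra

open TensorProduct KaehlerDifferential

/-- If a smooth algebra is the quotient by a regular element, there is a derivation with value one
on this element. -/
theorem exists_isLeibniz_apply_eq_one {R A B : Type u} [CommRing R] [CommRing A] [CommRing B]
    [Algebra R A] [Algebra R B] [Algebra.FormallySmooth R B] (φ : A →ₐ[R] B)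
    (hφ : Function.Surjective φ) {a : A} (ha : ∀ x, φ x = 0 → ∃! c, x = c * a)
    (hφa : φ a = 0) :
    ∃ θ : A → B, IsLeibniz (φ : A →+* B) θ ∧ (∀ c, θ (algebraMap R A c) = 0) ∧ θ a = 1 := by
  have hreg : ∀ x, x * a = 0 → x = 0 := fun x hx =>
    (ha 0 (map_zero φ)).unique hx.symm (zero_mul a).symm
  let I : Ideal A := RingHom.ker φ
  let J : Ideal (A ⧸ I ^ 2) := I.map (Ideal.Quotient.mk (I ^ 2))
  have hJ : IsNilpotent J := by
    refine ⟨2, ?_⟩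
    rw [← Ideal.map_pow]
    exact Ideal.map_quotient_self _
  let q : A ⧸ I ^ 2 →ₐ[R] B := Ideal.Quotient.liftₐ (I ^ 2) φ fun x hx =>
    Ideal.pow_le_self two_ne_zero hx
  have hq : Function.Surjective q := Ideal.Quotient.lift_surjective_of_surjective _ _ hφ
  have hkq : RingHom.ker (q : A ⧸ I ^ 2 →+* B) = J := by
    ext z
    obtain ⟨x, rfl⟩ := Ideal.Quotient.mk_surjective z
    constructor
    · intro hx
      exact Ideal.mem_map_of_mem _ (show φ x = 0 from hx)
    · intro hx
      refine (Ideal.map_le_iff_le_comap (K := RingHom.ker (q : A ⧸ I ^ 2 →+* B))).mpr ?_ hx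
      intro y hy
      exact hy
  -- Formal smoothness of B splits the square-zero extension A/I² → B. The derivation sends x to the
  -- coefficient of a in x - s(φ x), which lies in I/I².
  obtain ⟨s, hs⟩ : ∃ s : B →ₐ[R] A ⧸ I ^ 2, ∀ b, q (s b) = b := by
    refine ⟨Algebra.FormallySmooth.liftOfSurjective (AlgHom.id R B) q hq (hkq ▸ hJ), fun b => ?_⟩
    exact Algebra.FormallySmooth.liftOfSurjective_apply (AlgHom.id R B) q hq (hkq ▸ hJ) b
  have hmem : ∀ x : A, x ∈ I ^ 2 ↔ ∃ c, x = c * (a * a) := by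
    have hI : I = Ideal.span {a} := by
      ext x
      rw [Ideal.mem_span_singleton']
      constructor
      · intro hx
        obtain ⟨c, hc, -⟩ := ha x hx
        exact ⟨c, hc.symm⟩
      · rintro ⟨c, rfl⟩
        exact (map_mul φ c a).trans (by rw [hφa, mul_zero])
    intro x
    rw [hI, Ideal.span_singleton_pow, Ideal.mem_span_singleton', sq]
    exact ⟨fun ⟨c, hc⟩ => ⟨c, hc.symm⟩, fun ⟨c, hc⟩ => ⟨c, hc.symm⟩⟩
  let mk : A →ₐ[R] A ⧸ I ^ 2 := Ideal.Quotient.mkₐ R (I ^ 2)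
  have hmk0 : ∀ x, mk x = 0 ↔ x ∈ I ^ 2 := fun x => Ideal.Quotient.eq_zero_iff_mem
  have hex : ∀ x : A, ∃ y, mk x - s (φ x) = mk (y * a) := by
    intro x
    obtain ⟨z, hz⟩ := Ideal.Quotient.mk_surjective (mk x - s (φ x))
    have : φ z = 0 := by
      have h1 : q (mk z) = q (mk x - s (φ x)) := congrArg q hz
      rw [map_sub, hs] at h1
      exact h1.trans (sub_self _)
    obtain ⟨y, hy, -⟩ := ha z this
    exact ⟨y, by rw [← hz, ← hy]; rfl⟩
  -- The coefficient is well defined modulo I, because I² is generated by a² and a is regular.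
  have huniq : ∀ y y', mk (y * a) = mk (y' * a) → φ y = φ y' := by
    intro y y' h
    rw [← sub_eq_zero, ← map_sub, hmk0, hmem] at h
    obtain ⟨c, hc⟩ := h
    have h1 : y - y' = c * a := by
      rw [← sub_eq_zero]
      exact hreg _ (by linear_combination hc)
    rw [← sub_eq_zero, ← map_sub, h1, map_mul, hφa, mul_zero]
  choose y hy using hex
  have haa : mk (a * a) = 0 := (hmk0 _).mpr ((hmem _).mpr ⟨1, (one_mul _).symm⟩)
  refine ⟨fun x => φ (y x), ⟨fun x x' => ?_, fun x x' => ?_⟩, fun c => ?_, ?_⟩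
  · rw [← map_add]
    refine huniq _ _ ?_
    rw [← hy, add_mul, map_add mk (y x * a), ← hy, ← hy, map_add mk, map_add φ, map_add s]
    ring
  · change φ (y (x * x')) = φ x * φ (y x') + φ x' * φ (y x)
    rw [← map_mul, ← map_mul, ← map_add]
    refine huniq _ _ ?_
    -- The Leibniz rule comes from expanding (x - s(φ x)) (x' - s(φ x')) = 0 in A/I².
    have h1 : mk (y x * a) * mk (y x' * a) = 0 := by
      rw [← map_mul, show y x * a * (y x' * a) = y x * y x' * (a * a) by ring, map_mul, haa,
        mul_zero]
    rw [← hy, add_mul, map_add mk, mul_assoc, mul_assoc, map_mul mk x (y x' * a),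
      map_mul mk x' (y x * a), ← hy, ← hy, map_mul mk x x', map_mul φ, map_mul s]
    rw [← hy, ← hy] at h1
    linear_combination -h1
  · have : φ (y (algebraMap R A c)) = φ 0 := huniq _ _ (by
      rw [← hy, zero_mul, map_zero, AlgHom.commutes, AlgHom.commutes, AlgHom.commutes, sub_self])
    exact this.trans (map_zero φ)
  · have : φ (y a) = φ 1 := huniq _ _ (by rw [← hy, hφa, map_zero, sub_zero, one_mul])
    exact this.trans (map_one φ)

/-- A smooth quotient of relative dimension one less is locally defined by one equation. -/
theorem exists_smul_ker_le_span_singleton {R A B : Type u} [CommRing R] [CommRing A] [CommRing B]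
    [Algebra R A] [Algebra R B] [Algebra A B] [IsScalarTower R A B]
    [Algebra.FormallySmooth R A] [Algebra.FormallySmooth R B]
    (hs : Function.Surjective (algebraMap A B)) (hfg : (RingHom.ker (algebraMap A B)).FG) {d : ℕ}
    [Module.Free A Ω[A⁄R]] [Module.Finite A Ω[A⁄R]] [Module.Free B Ω[B⁄R]]
    [Module.Finite B Ω[B⁄R]] (hA : Module.finrank A Ω[A⁄R] = d + 1)
    (hB : Module.finrank B Ω[B⁄R] = d) (𝔪 : Ideal B) [𝔪.IsMaximal] :
    ∃ a r : A, algebraMap A B a = 0 ∧ a ≠ 0 ∧ algebraMap A B r ∉ 𝔪 ∧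
      ∀ x, algebraMap A B x = 0 → ∃ c, r * x = c * a := by
  have : Nontrivial B := ⟨⟨0, 1, fun h01 => Ideal.IsMaximal.ne_top ‹𝔪.IsMaximal›
    ((Ideal.eq_top_iff_one _).mpr (h01 ▸ zero_mem _))⟩⟩
  have : Nontrivial A := (algebraMap A B).domain_nontrivial
  let 𝔭 : Ideal A := 𝔪.comap (algebraMap A B)
  have h𝔭 : 𝔭.IsMaximal := Ideal.comap_isMaximal_of_surjective _ hs
  let I : Ideal A := RingHom.ker (algebraMap A B)
  have hI𝔭 : I ≤ 𝔭 := fun x hx => by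
    change algebraMap A B x ∈ 𝔪
    rw [RingHom.mem_ker.mp hx]
    exact zero_mem _
  let κ := A ⧸ 𝔭
  let : Field κ := Ideal.Quotient.field 𝔭
  -- Since A and B are smooth over R, the conormal sequence 0 → I/I² → B ⊗ Ω_A → Ω_B → 0 is split
  -- exact.
  obtain ⟨l, hl⟩ := (Algebra.FormallySmooth.iff_split_injection (R := R) hs).mp ‹_›
  have hsurj := mapBaseChange_surjective R A B hs
  let e₁ : (B ⊗[A] Ω[A⁄R]) ≃ₗ[A] I.Cotangent × Ω[B⁄R] :=
    ((Function.Exact.splitInjectiveEquiv (g := (mapBaseChange R A B).restrictScalars A)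
      (exact_kerCotangentToTensor_mapBaseChange R A B hs) hsurj) ⟨l, hl⟩).1
  let e₂ : (B ⊗[A] Ω[A⁄R]) ≃ₗ[A] (Fin (d + 1) → B) := (LinearEquiv.ofFinrankEq _ _ (by
    rw [Module.finrank_baseChange, hA, Module.finrank_fin_fun]) :
      (B ⊗[A] Ω[A⁄R]) ≃ₗ[B] (Fin (d + 1) → B)).restrictScalars A
  let e₃ : Ω[B⁄R] ≃ₗ[A] (Fin d → B) := (LinearEquiv.ofFinrankEq _ _ (by
    rw [hB, Module.finrank_fin_fun]) : Ω[B⁄R] ≃ₗ[B] (Fin d → B)).restrictScalars A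
  let e : (Fin (d + 1) → B) ≃ₗ[A] I.Cotangent × (Fin d → B) :=
    e₂.symm ≪≫ₗ e₁ ≪≫ₗ (LinearEquiv.refl A _).prodCongr e₃
  have hIfin : Module.Finite A I := Module.Finite.iff_fg.mpr hfg
  have : Module.Finite A I.Cotangent := Module.Finite.of_surjective _ I.toCotangent_surjective
  have : Module.Finite A B := Module.Finite.of_surjective (Algebra.linearMap A B) hs
  have hκB : Module.finrank κ (κ ⊗[A] B) = 1 := by
    apply le_antisymm
    · refine finrank_le_one ((1 : κ) ⊗ₜ[A] (1 : B)) fun z => ?_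
      induction z using TensorProduct.induction_on with
      | zero => exact ⟨0, zero_smul _ _⟩
      | add z w hz hw =>
        obtain ⟨c, hc⟩ := hz
        obtain ⟨c', hc'⟩ := hw
        exact ⟨c + c', by rw [add_smul, hc, hc']⟩
      | tmul c b =>
        obtain ⟨x, rfl⟩ := hs b
        refine ⟨x • c, ?_⟩
        rw [TensorProduct.smul_tmul', smul_eq_mul, mul_one, TensorProduct.smul_tmul,
          Algebra.smul_def, mul_one]
    · rw [Nat.one_le_iff_ne_zero, ne_eq, Module.finrank_eq_zero_iff_of_free]
      intro hsub
      have h1 := (quotTensorEquivQuotSMul B 𝔭).symm.toEquiv.subsingleton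
      rw [Submodule.Quotient.subsingleton_iff] at h1
      have h2 : (1 : B) ∈ 𝔭 • (⊤ : Submodule A B) := h1.ge trivial
      have h3 : 𝔭 • (⊤ : Submodule A B) ≤ 𝔪.restrictScalars A := by
        refine Submodule.smul_le.mpr fun x hx b _ => ?_
        rw [Algebra.smul_def]
        exact Ideal.mul_mem_right b 𝔪 hx
      exact Ideal.IsMaximal.ne_top ‹𝔪.IsMaximal› ((Ideal.eq_top_iff_one _).mpr (h3 h2))
  have hpi : ∀ n, Module.finrank κ (κ ⊗[A] (Fin n → B)) = n := fun n => by
    rw [(TensorProduct.piRight A κ κ (fun _ : Fin n => B)).finrank_eq, Module.finrank_pi_fintype]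
    simp [hκB]
  -- Counting dimensions over the residue field κ: the middle term has dimension d + 1 and the
  -- quotient has dimension d.
  have hκN : Module.finrank κ (κ ⊗[A] I.Cotangent) = 1 := by
    have h1 := (e.baseChange A κ _ _).finrank_eq
    have : Module.Free κ (κ ⊗[A] (Fin d → B)) := Module.Free.of_divisionRing κ _
    have : Module.Free κ (κ ⊗[A] I.Cotangent) := Module.Free.of_divisionRing κ _
    have : Module.Finite κ (κ ⊗[A] (Fin d → B)) := Module.Finite.base_change A κ _
    have : Module.Finite κ (κ ⊗[A] I.Cotangent) := Module.Finite.base_change A κ _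
    rw [(TensorProduct.prodRight A κ κ I.Cotangent (Fin d → B)).finrank_eq, Module.finrank_prod,
      hpi, hpi] at h1
    omega
  obtain ⟨a, ha⟩ : ∃ a : I, (1 : κ) ⊗ₜ[A] I.toCotangent a ≠ 0 := by
    by_contra hall
    push Not at hall
    have hsub : Subsingleton (κ ⊗[A] I.Cotangent) := by
      refine subsingleton_of_forall_eq 0 fun z => ?_
      induction z using TensorProduct.induction_on with
      | zero => rfl
      | add z w hz hw => rw [hz, hw, add_zero]
      | tmul c n =>
        obtain ⟨x, rfl⟩ := I.toCotangent_surjective n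
        have h1 := congrArg (c • ·) (hall x)
        simpa [TensorProduct.smul_tmul'] using h1
    rw [Module.finrank_zero_of_subsingleton] at hκN
    exact zero_ne_one hκN
  have hgen := (finrank_eq_one_iff_of_nonzero' _ ha).mp hκN
  -- The class of a spans the one-dimensional space κ ⊗ I/I², and I² ⊆ 𝔭I, so a generates I modulo
  -- 𝔭I.
  have htop : (⊤ : Submodule A I) ≤ Submodule.span A {a} ⊔ 𝔭 • ⊤ := by
    intro x _
    obtain ⟨c, hc⟩ := hgen (1 ⊗ₜ[A] I.toCotangent x)
    obtain ⟨s, rfl⟩ := Ideal.Quotient.mk_surjective c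
    have h1 : (1 : κ) ⊗ₜ[A] I.toCotangent (x - s • a) = 0 := by
      rw [map_sub, map_smul, TensorProduct.tmul_sub, ← hc, TensorProduct.tmul_smul, sub_eq_zero]
      rfl
    have h2 := congrArg (quotTensorEquivQuotSMul I.Cotangent 𝔭) h1
    rw [quotTensorEquivQuotSMul_mk_one_tmul, map_zero, Submodule.Quotient.mk_eq_zero] at h2
    have h3 : I.toCotangent (x - s • a) ∈ (𝔭 • (⊤ : Submodule A I)).map I.toCotangent := by
      rw [Submodule.map_smul'', Submodule.map_top, LinearMap.range_eq_top.mpr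
        I.toCotangent_surjective]
      exact h2
    obtain ⟨z, hz, hzx⟩ := h3
    have h4 : x - s • a - z ∈ I • (⊤ : Submodule A I) := by
      refine (Submodule.Quotient.mk_eq_zero _).mp ?_
      change I.toCotangent (x - s • a - z) = 0
      rw [map_sub, hzx, sub_self]
    have h5 : x - s • a ∈ 𝔭 • (⊤ : Submodule A I) := by
      have := add_mem (Submodule.smul_mono_left hI𝔭 h4) hz
      rwa [sub_add_cancel] at this
    rw [← add_sub_cancel (s • a) x]
    exact Submodule.add_mem_sup (Submodule.smul_mem _ _ (Submodule.mem_span_singleton_self a)) h5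
  -- Nakayama's lemma gives r ≡ 1 modulo 𝔭 with r I ⊆ (a); in particular the image of r is not in 𝔪.
  obtain ⟨r, hr, hrI⟩ := Submodule.exists_sub_one_mem_and_smul_le_of_fg_of_le_sup
    hIfin.fg_top le_rfl htop
  refine ⟨a.1, r, a.2, fun h0 => ha ?_, fun hr' => ?_, fun x hx => ?_⟩
  · rw [show a = 0 from Subtype.ext h0, map_zero, TensorProduct.tmul_zero]
  · have h1 : (1 : A) ∈ 𝔭 := by
      have := sub_mem (show r ∈ 𝔭 from hr') hr
      rwa [sub_sub_cancel] at this
    exact h𝔭.ne_top ((Ideal.eq_top_iff_one _).mpr h1)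
  · have h1 : r • (⟨x, hx⟩ : I) ∈ Submodule.span A {a} :=
      hrI (Submodule.smul_mem_pointwise_smul _ _ _ trivial)
    obtain ⟨c, hc⟩ := Submodule.mem_span_singleton.mp h1
    exact ⟨c, (congrArg Subtype.val hc).symm⟩

end HypersurfaceAlgebra
end VeryFreeCurves
end


noncomputable section

namespace VeryFreeCurves

/-! ### Smooth hypersurfaces: charts -/

section HypersurfaceCharts

variable {X D : Scheme.{u}}

theorem isStandardSmoothOfRelativeDimension_basicOpen {S : Scheme.{u}} (π : X ⟶ S) {n : ℕ}
    {V W : X.Opens} (hV : IsAffineOpen V) (h : W ≤ V) {f : Γ(X, V)} (hW : W = X.basicOpen f)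
    (hs : (π.appLE ⊤ V (le_preimage_top π V)).hom.IsStandardSmoothOfRelativeDimension n) :
    (π.appLE ⊤ W (le_preimage_top π W)).hom.IsStandardSmoothOfRelativeDimension n := by
  let : Algebra Γ(X, V) Γ(X, W) := (res h).toAlgebra
  have : IsLocalization.Away f Γ(X, W) := hV.isLocalization_of_eq_basicOpen f (homOfLE h) hW
  have h1 := (RingHom.IsStandardSmoothOfRelativeDimension.algebraMap_isLocalizationAway
    (Rᵣ := Γ(X, W)) f).comp hs
  rw [zero_add] at h1
  convert h1 using 1
  exact RingHom.ext fun c => (res_appLE_top π h c).symm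

theorem exists_isStandardSmoothOfRelativeDimension {k : Type u} [Field k] (π : X ⟶ Spec (.of k))
    (n : ℕ) [SmoothOfRelativeDimension n π] (p : X) : ∃ V : X.Opens, IsAffineOpen V ∧ p ∈ V ∧
      (π.appLE ⊤ V (le_preimage_top π V)).hom.IsStandardSmoothOfRelativeDimension n := by
  obtain ⟨U, -, V, hV, hp, e, hs⟩ :=
    SmoothOfRelativeDimension.exists_isStandardSmoothOfRelativeDimension (n := n) (f := π) p
  obtain rfl : U = ⊤ := by
    refine top_le_iff.mp fun y _ => ?_
    have : Subsingleton (Spec (.of k)) := inferInstanceAs (Subsingleton (PrimeSpectrum k))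
    rw [Subsingleton.elim y (π p)]
    exact e hp
  exact ⟨V, hV, hp, hs⟩

theorem exists_isStandardSmoothOfRelativeDimension_pair {k : Type u} [Field k]
    (π : X ⟶ Spec (.of k)) (i : D ⟶ X) [IsClosedImmersion i] (n m : ℕ)
    [SmoothOfRelativeDimension n π] [SmoothOfRelativeDimension m (i ≫ π)] (p : D) :
    ∃ V : X.Opens, IsAffineOpen V ∧ i p ∈ V ∧
      (π.appLE ⊤ V (le_preimage_top π V)).hom.IsStandardSmoothOfRelativeDimension n ∧
      ((i ≫ π).appLE ⊤ (i ⁻¹ᵁ V)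
        (le_preimage_top (i ≫ π) _)).hom.IsStandardSmoothOfRelativeDimension m := by
  obtain ⟨V, hV, hpV, hsV⟩ := exists_isStandardSmoothOfRelativeDimension π n (i p)
  obtain ⟨W, hW, hpW, hsW⟩ := exists_isStandardSmoothOfRelativeDimension (i ≫ π) m p
  -- An open subset of D that is basic in both affine neighbourhoods; its equation lifts to V, so it
  -- is the trace of a basic open subset of X.
  obtain ⟨f, g, hfg, hpf⟩ := exists_basicOpen_le_affine_inter (hV.preimage i) hW p ⟨hpV, hpW⟩
  obtain ⟨f', rfl⟩ := i.app_surjective V hV f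
  have hpre : i ⁻¹ᵁ X.basicOpen f' = D.basicOpen (i.app V f') := Scheme.preimage_basicOpen i f'
  refine ⟨X.basicOpen f', hV.basicOpen f', ?_,
    isStandardSmoothOfRelativeDimension_basicOpen π hV (X.basicOpen_le f') rfl hsV,
    isStandardSmoothOfRelativeDimension_basicOpen (i ≫ π) hW ?_ (hpre.trans hfg) hsW⟩
  · change p ∈ i ⁻¹ᵁ X.basicOpen f'
    rwa [hpre]
  · rw [hpre, hfg]
    exact D.basicOpen_le g

/-- An equation of `D` up to multiplication by `r` generates the ideal of `D` where `r` does not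
vanish. -/
theorem isIdealGenerator_basicOpen [IsIntegral X] [IsIntegral D] (i : D ⟶ X) {V : X.Opens}
    (hV : IsAffineOpen V) {a r : Γ(X, V)} (ha : i.app V a = 0) (ha₀ : a ≠ 0)
    (hr : ∀ x, i.app V x = 0 → ∃ c, r * x = c * a) :
    IsIdealGenerator i (X.basicOpen r) (res (X.basicOpen_le r) a) := by
  have huniq : ∀ (V' : X.Opens) (h : V' ≤ V) (c c' : Γ(X, V')),
      c * res h a = c' * res h a → c = c' := by
    intro V' h c c' hcc
    rcases (V' : Set X).eq_empty_or_nonempty with hE | hne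
    · obtain rfl : V' = ⊥ := Opens.ext hE
      have : Subsingleton Γ(X, ⊥) := CommRingCat.subsingleton_of_isTerminal X.sheaf.isTerminalOfEmpty
      exact Subsingleton.elim _ _
    · have : Nonempty V' := hne.to_subtype
      refine mul_right_cancel₀ (fun h0 => ha₀ ?_) hcc
      exact res_injective h hne (h0.trans (map_zero _).symm)
  -- Division by a works on basic open subsets after clearing denominators, since r is invertible
  -- there; uniqueness of quotients on the integral scheme X lets the results glue.
  have hloc : ∀ (f : Γ(X, V)) (hf : X.basicOpen f ≤ X.basicOpen r) (b : Γ(X, X.basicOpen f)),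
      i.app (X.basicOpen f) b = 0 → ∃ c, b = c * res (X.basicOpen_le f) a := by
    intro f hf b hb
    obtain ⟨N, m, hm⟩ := exists_pow_mul_eq_res hV f (X.basicOpen_le f) rfl b
    -- The numerator m vanishes on D a priori only where f does not. If that locus is nonempty, m
    -- vanishes on D by integrality of D; if it is empty, f vanishes on D. In both cases f m does.
    have h1 : i.app V (f * m) = 0 := by
      rw [map_mul]
      rcases (D.basicOpen (i.app V f) : Set D).eq_empty_or_nonempty with hE | hne
      · rw [(basicOpen_eq_bot_iff _).mp (Opens.ext hE), zero_mul]
      · have hpre : i ⁻¹ᵁ X.basicOpen f = D.basicOpen (i.app V f) := Scheme.preimage_basicOpen i f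
        rw [← hpre] at hne
        have h2 : i.app (X.basicOpen f) (res (X.basicOpen_le f) m) = 0 := by
          rw [hm, map_mul, hb, mul_zero]
        have h3 : i.app V m = 0 := by
          refine res_injective (i.preimage_mono (X.basicOpen_le f)) hne ?_
          rw [map_zero, ← h2, Scheme.Hom.app_eq_appLE, Scheme.Hom.app_eq_appLE]
          exact (appLE_res i _ _ _ _ m).symm
        rw [h3, mul_zero]
    obtain ⟨c, hc⟩ := hr _ h1
    have hu : IsUnit (res (X.basicOpen_le f) r * res (X.basicOpen_le f) f ^ (N + 1)) := by
      refine IsUnit.mul ?_ (IsUnit.pow _ (X.toRingedSpace.isUnit_res_basicOpen f))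
      have h2 : IsUnit (res (X.basicOpen_le r) r) := X.toRingedSpace.isUnit_res_basicOpen r
      have h3 := h2.map (res hf)
      rwa [res_res] at h3
    obtain ⟨v, hv⟩ := hu.exists_left_inv
    refine ⟨v * res (X.basicOpen_le f) c, ?_⟩
    have h4 := congrArg (res (X.basicOpen_le f)) hc
    rw [map_mul, map_mul, map_mul, hm] at h4
    linear_combination (-b) * hv + v * h4
  refine ⟨app_res _ ha, fun V' h b hb => ?_⟩
  rw [show res h (res (X.basicOpen_le r) a) = res (h.trans (X.basicOpen_le r)) a from
    res_res _ _ _]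
  let ι := {f : Γ(X, V) // X.basicOpen f ≤ V'}
  have hcov : V' ≤ ⨆ f : ι, X.basicOpen f.1 := by
    intro p hp
    obtain ⟨f, hf, hpf⟩ := hV.exists_basicOpen_le ⟨p, hp⟩ (X.basicOpen_le r (h hp))
    exact Opens.mem_iSup.mpr ⟨⟨f, hf⟩, hpf⟩
  choose c hc using fun f : ι => hloc f.1 (f.2.trans h) (res f.2 b) (app_res _ hb)
  obtain ⟨t, ht⟩ := exists_glue (fun f : ι => X.basicOpen f.1) (fun f => f.2) hcov c
    (fun f g => by
      refine huniq _ (inf_le_left.trans (X.basicOpen_le f.1)) _ _ ?_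
      have h1 := congrArg (res (W := X.basicOpen f.1 ⊓ X.basicOpen g.1) inf_le_left) (hc f)
      have h2 := congrArg (res (W := X.basicOpen f.1 ⊓ X.basicOpen g.1) inf_le_right) (hc g)
      rw [map_mul, res_res, res_res] at h1 h2
      exact h1.symm.trans h2)
  refine ⟨t, ?_, fun c' hc' => ?_⟩
  · refine res_ext (fun f : ι => X.basicOpen f.1) (fun f => f.2) hcov _ _ fun f => ?_
    rw [map_mul, ht, res_res]
    exact hc f
  · refine huniq V' (h.trans (X.basicOpen_le r)) _ _ ?_
    rw [← hc']
    refine res_ext (fun f : ι => X.basicOpen f.1) (fun f => f.2) hcov _ _ fun f => ?_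
    rw [map_mul, ht, res_res]
    exact hc f

theorem app_appLE_top {S : Scheme.{u}} (π : X ⟶ S) (i : D ⟶ X) (V : X.Opens) (c : Γ(S, ⊤)) :
    i.app V (π.appLE ⊤ V (le_preimage_top π V) c) =
      (i ≫ π).appLE ⊤ (i ⁻¹ᵁ V) (le_preimage_top (i ≫ π) _) c := by
  rw [Scheme.Hom.app_eq_appLE, ← CommRingCat.comp_apply, Scheme.Hom.appLE_comp_appLE]

theorem isNoetherianRing_of_isStandardSmooth {k : Type u} [Field k] (π : X ⟶ Spec (.of k))
    {V : X.Opens} (hs : (π.appLE ⊤ V (le_preimage_top π V)).hom.IsStandardSmooth) :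
    IsNoetherianRing Γ(X, V) := by
  have : IsNoetherianRing Γ(Spec (.of k), ⊤) :=
    isNoetherianRing_of_ringEquiv k (Scheme.ΓSpecIso (.of k)).symm.commRingCatIsoToRingEquiv
  algebraize [(π.appLE ⊤ V (le_preimage_top π V)).hom]
  exact Algebra.FiniteType.isNoetherianRing Γ(Spec (.of k), ⊤) _

/-- On a common affine neighbourhood where both schemes are standard smooth, the algebra gives an
equation near p. Shrinking to where it generates the ideal keeps D smooth, so the normal derivation
exists there. -/
theorem exists_normalChart [IsIntegral X] [IsIntegral D] {k : Type u} [Field k]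
    (π : X ⟶ Spec (.of k)) (i : D ⟶ X) [IsClosedImmersion i] (d : ℕ)
    [SmoothOfRelativeDimension (d + 1) π] [SmoothOfRelativeDimension d (i ≫ π)] (p : D) :
    ∃ C : NormalChart π i, i p ∈ C.V := by
  have : Smooth (i ≫ π) := SmoothOfRelativeDimension.smooth d _
  obtain ⟨V, hV, hp, hsV, hsD⟩ :=
    exists_isStandardSmoothOfRelativeDimension_pair π i (d + 1) d p
  have : Nonempty V := ⟨⟨_, hp⟩⟩
  have : Nonempty (i ⁻¹ᵁ V : D.Opens) := ⟨⟨p, hp⟩⟩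
  have hsurj := i.app_surjective V hV
  obtain ⟨a, r, ha, ha₀, hpr, hr⟩ : ∃ a r : Γ(X, V), i.app V a = 0 ∧ a ≠ 0 ∧
      p ∈ D.basicOpen (i.app V r) ∧ ∀ x, i.app V x = 0 → ∃ c, r * x = c * a := by
    have := isNoetherianRing_of_isStandardSmooth π hsV.isStandardSmooth
    -- The point p need not be closed, so its prime is enlarged to a maximal ideal; a function
    -- outside the latter does not vanish at p.
    let 𝔭 := (IsLocalRing.maximalIdeal (D.presheaf.stalk p)).comap
      (D.presheaf.germ (i ⁻¹ᵁ V) p hp).hom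
    obtain ⟨𝔪, h𝔪, hle⟩ := Ideal.exists_le_maximal 𝔭 (Ideal.IsPrime.ne_top inferInstance)
    let R := Γ(Spec (.of k), ⊤)
    let A := Γ(X, V)
    let B := Γ(D, i ⁻¹ᵁ V)
    let : Algebra R A := (π.appLE ⊤ V (le_preimage_top π V)).hom.toAlgebra
    let : Algebra R B := ((i ≫ π).appLE ⊤ (i ⁻¹ᵁ V) (le_preimage_top (i ≫ π) _)).hom.toAlgebra
    let : Algebra A B := (i.app V).hom.toAlgebra
    have : IsScalarTower R A B := .of_algebraMap_eq fun c =>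
      (app_appLE_top π i V c).symm
    have : Algebra.IsStandardSmoothOfRelativeDimension (d + 1) R A := hsV
    have : Algebra.IsStandardSmoothOfRelativeDimension d R B := hsD
    have : Algebra.IsStandardSmooth R A := hsV.isStandardSmooth
    have : Algebra.IsStandardSmooth R B := hsD.isStandardSmooth
    obtain ⟨a, r, h1, h2, h3, h4⟩ := exists_smul_ker_le_span_singleton (R := R) (A := A) (B := B)
      hsurj (IsNoetherian.noetherian _) (d := d)
      (Module.finrank_eq_of_rank_eq
        (Algebra.IsStandardSmoothOfRelativeDimension.rank_kaehlerDifferential (d + 1)))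
      (Module.finrank_eq_of_rank_eq
        (Algebra.IsStandardSmoothOfRelativeDimension.rank_kaehlerDifferential d)) 𝔪
    refine ⟨a, r, h1, h2, ?_, h4⟩
    rw [D.mem_basicOpen (U := i ⁻¹ᵁ V) _ p hp]
    by_contra hu
    exact h3 (hle ((IsLocalRing.mem_maximalIdeal _).mpr hu))
  have hpre : i ⁻¹ᵁ X.basicOpen r = D.basicOpen (i.app V r) := Scheme.preimage_basicOpen i r
  have hgen := isIdealGenerator_basicOpen i hV ha ha₀ hr
  have haff := hV.basicOpen r
  have hsm : ((i ≫ π).appLE ⊤ (i ⁻¹ᵁ X.basicOpen r) (le_preimage_top (i ≫ π) _)).hom.Smooth :=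
    (i ≫ π).smooth_appLE (isAffineOpen_top _) (haff.preimage i) (le_preimage_top (i ≫ π) _)
  let R := Γ(Spec (.of k), ⊤)
  let A := Γ(X, X.basicOpen r)
  let B := Γ(D, i ⁻¹ᵁ X.basicOpen r)
  let : Algebra R A := (π.appLE ⊤ _ (le_preimage_top π (X.basicOpen r))).hom.toAlgebra
  let : Algebra R B := ((i ≫ π).appLE ⊤ (i ⁻¹ᵁ X.basicOpen r)
    (le_preimage_top (i ≫ π) _)).hom.toAlgebra
  have : Algebra.Smooth R B := hsm
  let φ : A →ₐ[R] B := { (i.app (X.basicOpen r)).hom with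
    commutes' := app_appLE_top π i _ }
  obtain ⟨θ, hθ, hθR, hθa⟩ := exists_isLeibniz_apply_eq_one φ (i.app_surjective _ haff)
    (a := res (X.basicOpen_le r) a)
    (fun x hx => by
      have := hgen.existsUnique _ le_rfl x hx
      rwa [res_self] at this) hgen.app_eq_zero
  refine ⟨⟨_, haff, _, hgen, θ, hθ, hθR, hθa⟩, ?_⟩
  change p ∈ i ⁻¹ᵁ X.basicOpen r
  rwa [hpre]

end HypersurfaceCharts
end VeryFreeCurves
end


noncomputable section

namespace VeryFreeCurves

/-! ### Sections of multiples of a divisor along a curve -/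

section Multiples

variable {X D Y : Scheme.{u}} {i : D ⟶ X} {g : Y ⟶ X}

theorem Normal.isGenerator_of_ev_eq_one {V : X.Opens} {a : Γ(X, V)} (ha : IsIdealGenerator i V a)
    {W : Y.Opens} (hW : W ≤ g ⁻¹ᵁ V) {s : Normal i g W}
    (hs : s.ev (le_inf le_rfl hW) a ha.app_eq_zero = 1) : IsGenerator (normalSheaf i g) W s := by
  intro W' h
  have hval : ∀ r : Γ(Y, W'), Normal.ev (i := i) (g := g) (r • (normalFamily i g).restrict h s)
      (le_inf le_rfl (h.trans hW)) a ha.app_eq_zero = r := by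
    intro r
    rw [Normal.smul_ev, res_self, Normal.restrict_ev]
    have h1 := congrArg (VeryFreeCurves.res h) hs
    rw [Normal.res_ev, map_one] at h1
    rw [h1, mul_one]
  constructor
  · intro r r' hr
    have h1 := congrArg (fun t : Normal i g W' => t.ev (le_inf le_rfl (h.trans hW)) a
      ha.app_eq_zero) hr
    exact (hval r).symm.trans (h1.trans (hval r'))
  · intro t
    change Normal i g W' at t
    refine ⟨t.ev (le_inf le_rfl (h.trans hW)) a ha.app_eq_zero, ?_⟩
    exact Normal.ext_of_isIdealGenerator ha (h.trans hW) (hval _)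

/-- Locally some section takes the value 1 on the equation, and it is a multiple of the generator s.
-/
theorem Normal.isUnit_ev {V : X.Opens} {a : Γ(X, V)} (ha : IsIdealGenerator i V a)
    {W : Y.Opens} {s : Normal i g W} (hs : IsGenerator (normalSheaf i g) W s) {W' : Y.Opens}
    (h : W' ≤ W ⊓ g ⁻¹ᵁ V) : IsUnit (s.ev h a ha.app_eq_zero) := by
  obtain ⟨t, ht⟩ := Normal.exists_of_isIdealGenerator ha (h.trans inf_le_right) (1 : Γ(Y, W'))
  obtain ⟨r, hr⟩ := (hs W' (h.trans inf_le_left)).2 t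
  have h1 := congrArg (fun t : Normal i g W' => t.ev (le_inf le_rfl (h.trans inf_le_right)) a
      ha.app_eq_zero) hr
  have h2 : Normal.ev (i := i) (g := g) (r • (normalFamily i g).restrict (h.trans inf_le_left) s)
      (le_inf le_rfl (h.trans inf_le_right)) a ha.app_eq_zero = 1 := h1.trans ht
  rw [Normal.smul_ev, res_self, Normal.restrict_ev] at h2
  exact isUnit_of_mul_isUnit_right (h2 ▸ isUnit_one)

variable [IsIntegral X]

/-- A local equation `a` of `D` together with the regular function `b = f aⁿ`. -/
structure MultipleChart (i : D ⟶ X) (n : ℕ) (f : X.functionField) where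
  /-- The affine open subset. -/
  V : X.Opens
  isAffineOpen : IsAffineOpen V
  nonempty : (V : Set X).Nonempty
  /-- The equation of `D`. -/
  a : Γ(X, V)
  isIdealGenerator : IsIdealGenerator i V a
  /-- The regular function `f aⁿ`. -/
  b : Γ(X, V)
  toRat_b : toRat nonempty b = f * toRat nonempty a ^ n

namespace MultipleChart

variable {n : ℕ} {f : X.functionField}

theorem mem_ker [QuasiCompact i] (C : MultipleChart i n f) :
    C.a ∈ i.ker.ideal ⟨C.V, C.isAffineOpen⟩ := by
  rw [Scheme.Hom.ker_apply]
  exact C.isIdealGenerator.app_eq_zero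

theorem exists_of_isIdealGenerator [QuasiCompact i] (hf : IsSectionOfMultiple i n f) {V : X.Opens}
    (hV : IsAffineOpen V) {a : Γ(X, V)} (ha : IsIdealGenerator i V a) {x : X} (hx : x ∈ V) :
    ∃ C : MultipleChart i n f, x ∈ C.V := by
  have : Nonempty V := ⟨⟨x, hx⟩⟩
  obtain ⟨b, hb⟩ := hf ⟨V, hV⟩ (a ^ n) (Ideal.pow_mem_pow (by
    rw [Scheme.Hom.ker_apply]
    exact ha.app_eq_zero) n)
  refine ⟨⟨V, hV, ⟨x, hx⟩, a, ha, b, ?_⟩, hx⟩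
  rw [← map_pow]
  exact hb

/-- On the overlap of two charts, a' = c a and hence b' = cⁿ b, so both sides of the defining
relation are multiplied by the pullback of cⁿ. -/
theorem mul_ev_pow (C C' : MultipleChart i n f) {W W' : Y.Opens} (s : Normal i g W)
    (h : W' ≤ W ⊓ g ⁻¹ᵁ C.V) (h' : W' ≤ W ⊓ g ⁻¹ᵁ C'.V) {Q : Γ(Y, W')}
    (hQ : Q * s.ev h C.a C.isIdealGenerator.app_eq_zero ^ n =
      g.appLE C.V W' (h.trans inf_le_right) C.b) :
    Q * s.ev h' C'.a C'.isIdealGenerator.app_eq_zero ^ n =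
      g.appLE C'.V W' (h'.trans inf_le_right) C'.b := by
  have ha := C.isIdealGenerator.app_eq_zero
  have ha' := C'.isIdealGenerator.app_eq_zero
  have hne := nonempty_inf C'.nonempty C.nonempty
  obtain ⟨c, hc, -⟩ := C.isIdealGenerator.existsUnique (C'.V ⊓ C.V) inf_le_right
    (res inf_le_left C'.a) (app_res _ ha')
  have hb : res (W := C'.V ⊓ C.V) inf_le_left C'.b = c ^ n * res inf_le_right C.b := by
    have h1 := congrArg (toRat hne) hc
    rw [map_mul, toRat_res C'.nonempty, toRat_res C.nonempty] at h1
    apply toRat_injective hne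
    rw [map_mul, map_pow, toRat_res C'.nonempty, toRat_res C.nonempty, C.toRat_b, C'.toRat_b, h1]
    ring
  have hle : W' ≤ W ⊓ g ⁻¹ᵁ (C'.V ⊓ C.V) :=
    le_inf (h.trans inf_le_left) (le_inf (h'.trans inf_le_right) (h.trans inf_le_right))
  have hca : i.app (C'.V ⊓ C.V) (c * res inf_le_right C.a) = 0 := hc ▸ app_res _ ha'
  have h₁ := s.ev_congr inf_le_left hle ha' hca hc.symm
  have h₂ := s.ev_congr inf_le_right hle ha (app_res _ ha) rfl
  rw [s.ev_mul hle _ _ (app_res _ ha), h₂] at h₁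
  have h₃ := congrArg (g.appLE (C'.V ⊓ C.V) W' (hle.trans inf_le_right)) hb
  rw [map_mul, map_pow, appLE_res_le g _ _ (h'.trans inf_le_right),
    appLE_res_le g _ _ (h.trans inf_le_right)] at h₃
  rw [h₃, ← hQ, ← h₁]
  ring

end MultipleChart

variable {n : ℕ} {f : X.functionField}

/-- The function `P` is the quotient of the section `f` of the `n`-th power of the normal sheaf
along `g` by the `n`-th power of `s`. -/
def IsQuotientAlong (n : ℕ) (f : X.functionField) {W : Y.Opens} (s : Normal i g W)
    (P : Γ(Y, W)) : Prop :=
  ∀ (C : MultipleChart i n f) (W' : Y.Opens) (h : W' ≤ W ⊓ g ⁻¹ᵁ C.V),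
    res (h.trans inf_le_left) P * s.ev h C.a C.isIdealGenerator.app_eq_zero ^ n =
      g.appLE C.V W' (h.trans inf_le_right) C.b

/-- Locally P is the pullback of f aⁿ divided by s(a)ⁿ, which is a unit; independence of the chart
makes the quotients glue. -/
theorem exists_isQuotientAlong (hC : ∀ y : Y, ∃ C : MultipleChart i n f, g y ∈ C.V)
    {W : Y.Opens} {s : Normal i g W} (hs : IsGenerator (normalSheaf i g) W s) :
    ∃ P, IsQuotientAlong n f s P := by
  choose C hCy using hC
  let U : Y → Y.Opens := fun y => W ⊓ g ⁻¹ᵁ (C y).V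
  have hcov : W ≤ iSup U := fun y hy => Opens.mem_iSup.mpr ⟨y, hy, hCy y⟩
  have hunit := fun (C : MultipleChart i n f) (W' : Y.Opens) (h : W' ≤ W ⊓ g ⁻¹ᵁ C.V) =>
    (Normal.isUnit_ev C.isIdealGenerator hs h).pow n
  have hex : ∀ y, ∃ Q : Γ(Y, U y),
      Q * s.ev le_rfl (C y).a (C y).isIdealGenerator.app_eq_zero ^ n =
        g.appLE (C y).V (U y) inf_le_right (C y).b := by
    intro y
    obtain ⟨v, hv⟩ := (hunit (C y) (U y) le_rfl).exists_left_inv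
    exact ⟨g.appLE (C y).V (U y) inf_le_right (C y).b * v, by rw [mul_assoc, hv, mul_one]⟩
  choose Q hQ using hex
  have hQ' : ∀ (y : Y) (W' : Y.Opens) (h : W' ≤ U y),
      res h (Q y) * s.ev h (C y).a (C y).isIdealGenerator.app_eq_zero ^ n =
        g.appLE (C y).V W' (h.trans inf_le_right) (C y).b := by
    intro y W' h
    have h1 := congrArg (res h) (hQ y)
    rwa [map_mul, map_pow, Normal.res_ev, res_appLE g _ _ (h.trans inf_le_right)] at h1
  obtain ⟨P, hP⟩ := exists_glue U (fun _ => inf_le_left) hcov Q fun y z => by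
    apply (hunit (C z) _ inf_le_right).mul_left_injective
    beta_reduce
    rw [(C y).mul_ev_pow (C z) s inf_le_left inf_le_right (hQ' y _ inf_le_left),
      hQ' z _ inf_le_right]
  refine ⟨P, fun C' W' h => ?_⟩
  refine res_ext (fun y => W' ⊓ U y) (fun _ => inf_le_left) ?_ _ _ fun y => ?_
  · rw [← inf_iSup_eq]
    exact le_inf le_rfl ((h.trans inf_le_left).trans hcov)
  · rw [map_mul, map_pow, Normal.res_ev, res_res, res_appLE g _ _
      ((inf_le_left.trans h).trans inf_le_right)]
    refine (C y).mul_ev_pow C' s (inf_le_right.trans le_rfl) (inf_le_left.trans h) ?_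
    have h1 := hQ' y (W' ⊓ U y) inf_le_right
    rwa [← hP, res_res] at h1

/-- From s₁ = u s₀ and P₀ s₀ⁿ = f = P₁ s₁ⁿ one reads off P₀ = uⁿ P₁, after cancelling the unit
s₀(a)ⁿ. -/
theorem IsQuotientAlong.res_eq (hC : ∀ y : Y, ∃ C : MultipleChart i n f, g y ∈ C.V)
    {W₀ W₁ : Y.Opens} {s₀ : Normal i g W₀} {s₁ : Normal i g W₁}
    (hs₀ : IsGenerator (normalSheaf i g) W₀ s₀) {u : Γ(Y, W₀ ⊓ W₁)}
    (hu : mres (normalSheaf i g) (W := W₀ ⊓ W₁) inf_le_right s₁ =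
      u • mres (normalSheaf i g) inf_le_left s₀) {P₀ : Γ(Y, W₀)} {P₁ : Γ(Y, W₁)}
    (hP₀ : IsQuotientAlong n f s₀ P₀) (hP₁ : IsQuotientAlong n f s₁ P₁) :
    res (W := W₀ ⊓ W₁) inf_le_left P₀ = u ^ n * res inf_le_right P₁ := by
  choose C hCy using hC
  refine res_ext (fun y => W₀ ⊓ W₁ ⊓ g ⁻¹ᵁ (C y).V) (fun _ => inf_le_left)
    (fun y hy => Opens.mem_iSup.mpr ⟨y, hy, hCy y⟩) _ _ fun y => ?_
  have ha := (C y).isIdealGenerator.app_eq_zero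
  have h1 : Normal.ev (i := i) (g := g) ((normalFamily i g).restrict inf_le_right s₁)
      (le_refl (W₀ ⊓ W₁ ⊓ g ⁻¹ᵁ (C y).V)) (C y).a ha =
      Normal.ev (i := i) (g := g) (u • (normalFamily i g).restrict inf_le_left s₀) le_rfl
        (C y).a ha :=
    congrArg (fun t : Normal i g (W₀ ⊓ W₁) => t.ev le_rfl (C y).a ha) hu
  rw [Normal.smul_ev, Normal.restrict_ev, Normal.restrict_ev] at h1
  have h₀ := hP₀ (C y) (W₀ ⊓ W₁ ⊓ g ⁻¹ᵁ (C y).V) (inf_le_inf_right _ inf_le_left)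
  have h₁ := hP₁ (C y) (W₀ ⊓ W₁ ⊓ g ⁻¹ᵁ (C y).V) (inf_le_inf_right _ inf_le_right)
  apply ((Normal.isUnit_ev (C y).isIdealGenerator hs₀
    (inf_le_inf_right (g ⁻¹ᵁ (C y).V) (inf_le_left : W₀ ⊓ W₁ ≤ W₀))).pow n).mul_left_injective
  beta_reduce
  rw [map_mul, map_pow, res_res, res_res, h₀, ← h₁, h1, mul_pow]
  ring

theorem IsQuotientAlong.mem_basicOpen_iff [QuasiCompact i]
    (hC : ∀ y : Y, ∃ C : MultipleChart i n f, g y ∈ C.V) {W : Y.Opens} {s : Normal i g W}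
    (hs : IsGenerator (normalSheaf i g) W s) {P : Γ(Y, W)} (hP : IsQuotientAlong n f s P) {y : Y}
    (hy : y ∈ W) : y ∈ Y.basicOpen P ↔ GeneratesMultipleAt i n f (g y) := by
  obtain ⟨C, hCy⟩ := hC y
  have hyC : y ∈ W ⊓ g ⁻¹ᵁ C.V := ⟨hy, hCy⟩
  -- Near y, the function P and the pullback of b differ by the unit s(a)ⁿ.
  have hiff : y ∈ Y.basicOpen P ↔ g y ∈ X.basicOpen C.b := by
    have h1 := congrArg Y.basicOpen (hP C (W ⊓ g ⁻¹ᵁ C.V) le_rfl)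
    rw [Scheme.basicOpen_mul, Y.basicOpen_of_isUnit ((Normal.isUnit_ev C.isIdealGenerator hs
      le_rfl).pow n), Scheme.basicOpen_res] at h1
    have h2 : Y.basicOpen (g.appLE C.V (W ⊓ g ⁻¹ᵁ C.V) inf_le_right C.b) =
        W ⊓ g ⁻¹ᵁ C.V ⊓ g ⁻¹ᵁ X.basicOpen C.b := by
      rw [Scheme.preimage_basicOpen]
      exact Scheme.basicOpen_res _ _ _
    rw [h2] at h1
    constructor
    · intro h
      exact (h1.le ⟨⟨hyC, h⟩, hyC⟩).2
    · intro h
      exact (h1.ge ⟨hyC, h⟩).1.2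
  rw [hiff]
  constructor
  · intro h
    refine ⟨⟨C.V, C.isAffineOpen⟩, C.nonempty.to_subtype, C.a ^ n, Ideal.pow_mem_pow C.mem_ker n,
      C.b, ?_, h⟩
    have := C.toRat_b
    rw [← map_pow] at this
    exact this
  · rintro ⟨U, hU, a, ha, b, hb, hyb⟩
    have hUne : (U.1 : Set X).Nonempty := ⟨_, hU.some.2⟩
    have hne := nonempty_inf hUne C.nonempty
    have hyU : g y ∈ U.1 := X.basicOpen_le b hyb
    -- An arbitrary local section of the n-th power of the ideal is a multiple of C.aⁿ, so the
    -- regular function it produces from f is a multiple of C.b; if the former does not vanish at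
    -- the point, neither does C.b.
    obtain ⟨c, hc⟩ : ∃ c, c * res (W := U.1 ⊓ C.V) inf_le_right C.a ^ n = res inf_le_left a := by
      rw [← Ideal.mem_span_singleton', ← Ideal.span_singleton_pow]
      have h1 : (i.ker.ideal U).map (res (W := U.1 ⊓ C.V) inf_le_left) ≤
          Ideal.span {res inf_le_right C.a} := by
        refine Ideal.map_le_iff_le_comap.mpr fun x hx => ?_
        rw [Scheme.Hom.ker_apply] at hx
        obtain ⟨c, hc, -⟩ := C.isIdealGenerator.existsUnique (U.1 ⊓ C.V) inf_le_right
          (res inf_le_left x) (app_res _ hx)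
        exact Ideal.mem_span_singleton'.mpr ⟨c, hc.symm⟩
      refine Ideal.pow_right_mono h1 n ?_
      rw [← Ideal.map_pow]
      exact Ideal.mem_map_of_mem _ ha
    have hbc : res (W := U.1 ⊓ C.V) inf_le_left b = c * res inf_le_right C.b := by
      apply toRat_injective hne
      have h1 := congrArg (toRat hne) hc
      have h2 : toRat hUne b = f * toRat hUne a := hb
      rw [map_mul, map_pow, toRat_res hUne, toRat_res C.nonempty] at h1
      rw [map_mul, toRat_res hUne, toRat_res C.nonempty, C.toRat_b, h2, ← h1]
      ring
    have h1 := congrArg X.basicOpen hbc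
    rw [Scheme.basicOpen_mul, Scheme.basicOpen_res, Scheme.basicOpen_res] at h1
    exact (h1.le ⟨⟨hyU, hCy⟩, hyb⟩).2.2

end Multiples
end VeryFreeCurves
end


noncomputable section

namespace VeryFreeCurves

/-! ### The degree of the normal sheaf of an ample divisor along a rational curve -/

section Degree

open LaurentPolynomial

variable {k : Type u} [Field k] {X D : Scheme.{u}}

theorem subsingleton_cohomology_normalSheaf_twistNeg_two [IsIntegral X] (i : D ⟶ X)
    [IsClosedImmersion i] (hample : IsAmpleDivisor i) (h : projSpace 1 k ⟶ D)
    (hconst : ¬ ∃ y : D, ∀ x, h x = y)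
    (hN : ∀ p : D, ∃ V : X.Opens, IsAffineOpen V ∧ i p ∈ V ∧ ∃ a, IsIdealGenerator i V a) :
    Subsingleton (cohomology (twistNeg (normalSheaf i (h ≫ i)) 2) 1) := by
  have hM : ∀ p, ∃ (W : (projSpace 1 k).Opens) (σ : Γ(normalSheaf i (h ≫ i), W)), p ∈ W ∧
      IsGenerator (normalSheaf i (h ≫ i)) W σ := by
    intro p
    obtain ⟨V, -, hpV, a, ha⟩ := hN (h p)
    obtain ⟨s, hs⟩ := Normal.exists_of_isIdealGenerator (g := h ≫ i) ha
      (le_refl ((h ≫ i) ⁻¹ᵁ V)) 1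
    exact ⟨_, s, hpV, Normal.isGenerator_of_ev_eq_one ha le_rfl hs⟩
  obtain ⟨s₀, hs₀⟩ := exists_isGenerator hM (isAffineOpen_chart 0) (nonempty_chart 0)
  obtain ⟨s₁, hs₁⟩ := exists_isGenerator hM (isAffineOpen_chart 1) (nonempty_chart 1)
  obtain ⟨u, hu⟩ := (hs₀ overlap inf_le_left).2 (mres _ inf_le_right s₁)
  obtain ⟨v, hv⟩ := (hs₁ overlap inf_le_right).2 (mres _ inf_le_left s₀)
  beta_reduce at hu hv
  have huv : u * v = 1 := by
    refine (hs₁ overlap inf_le_right).1 ?_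
    beta_reduce
    rw [mul_smul, hv, hu, one_smul]
  obtain ⟨c, hc, m, hm⟩ := exists_eq_C_mul_T_of_isUnit
    ((IsUnit.of_mul_eq_one v huv).map (overlapLaurent (k := k)))
  refine subsingleton_cohomology_twistNeg_two hs₀ hs₁ hu.symm hc hm ?_
  obtain ⟨x₀, hx₀⟩ := nonempty_chart (k := k) (n := 1) 0
  -- The point comes from the first chart, so that the function representing f on that chart is
  -- visibly nonzero.
  obtain ⟨n, hn, f, hf, U, hU, hxU, hUiff⟩ := hample ((h ≫ i) x₀)
  have hC : ∀ y, ∃ C : MultipleChart i n f, (h ≫ i) y ∈ C.V := fun y => by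
    obtain ⟨V, hV, hpV, a, ha⟩ := hN (h y)
    exact MultipleChart.exists_of_isIdealGenerator hf hV ha hpV
  obtain ⟨P₀, hP₀⟩ := exists_isQuotientAlong hC hs₀
  obtain ⟨P₁, hP₁⟩ := exists_isQuotientAlong hC hs₁
  have hP₀ne : P₀ ≠ 0 := by
    rintro rfl
    have h1 := (hP₀.mem_basicOpen_iff hC hs₀ hx₀).mpr ((hUiff _).mp hxU)
    rw [Scheme.basicOpen_zero] at h1
    exact h1
  obtain ⟨hm₀, hm₁⟩ := degree_nonneg_of_res_eq hc hm hn hP₀ne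
    (hP₀.res_eq hC hs₀ hu.symm hP₁)
  by_contra hlt
  -- If the degree were not positive it would be 0, and f would vanish nowhere along the curve,
  -- which would then lie in the affine open U.
  obtain ⟨hu₀, hu₁⟩ := hm₁ (by omega)
  refine hconst (exists_forall_eq_of_isAffineOpen h (hU.preimage i) fun x => ?_)
  change (h ≫ i) x ∈ U
  rw [hUiff]
  have hx : x ∈ chart 0 ⊔ chart 1 := chart_sup_chart (k := k) ▸ trivial
  rcases hx with hx | hx
  · refine (hP₀.mem_basicOpen_iff hC hs₀ hx).mp ?_
    rwa [Scheme.basicOpen_of_isUnit _ hu₀]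
  · refine (hP₁.mem_basicOpen_iff hC hs₁ hx).mp ?_
    rwa [Scheme.basicOpen_of_isUnit _ hu₁]

end Degree
end VeryFreeCurves
end

/-! ### Very freeness passes from the ample divisor to the ambient variety -/

theorem mainTheorem2 {k : Type u} [Field k] [IsAlgClosed k]
    {X D : Scheme.{u}} [IsIntegral X] [IsIntegral D]
    (π : X ⟶ Spec (.of k)) (i : D ⟶ X) [IsClosedImmersion i]
    (hproj : VeryFreeCurves.IsProjective π)
    (d : ℕ) [SmoothOfRelativeDimension (d + 1) π] [SmoothOfRelativeDimension d (i ≫ π)]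
    (hample : VeryFreeCurves.IsAmpleDivisor i)
    (h : VeryFreeCurves.projSpace 1 k ⟶ D)
    (hk : h ≫ i ≫ π = VeryFreeCurves.projSpaceToSpec 1 k)
    (hconst : ¬ ∃ y : D, ∀ x, h x = y)
    (hfree : VeryFreeCurves.IsVeryFree (i ≫ π) h) :
    VeryFreeCurves.IsVeryFree π (h ≫ i) := by
  have : Smooth π := SmoothOfRelativeDimension.smooth (d + 1) π
  have : Smooth (i ≫ π) := SmoothOfRelativeDimension.smooth d (i ≫ π)
  obtain ⟨eD⟩ := VeryFreeCurves.nonempty_pullback_tangentSheaf_iso (g := h)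
    (VeryFreeCurves.exists_coordinates (i ≫ π))
  obtain ⟨eX⟩ := VeryFreeCurves.nonempty_pullback_tangentSheaf_iso (g := h ≫ i)
    (VeryFreeCurves.exists_coordinates π)
  have hN := VeryFreeCurves.exists_normalChart π i d
  have hD := VeryFreeCurves.subsingleton_cohomology_of_iso (VeryFreeCurves.twistIso _ _ eD) 1 hfree
  have hnormal := VeryFreeCurves.subsingleton_cohomology_normalSheaf_twistNeg_two i hample h hconst
    fun p => by
      obtain ⟨C, hC⟩ := hN p
      exact ⟨C.V, C.isAffineOpen, hC, C.a, C.isIdealGenerator⟩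
  exact VeryFreeCurves.subsingleton_cohomology_of_iso (VeryFreeCurves.twistIso _ _ eX.symm) 1
    (VeryFreeCurves.subsingleton_cohomology_of_sectionExact
      ((VeryFreeCurves.sectionExact_normal π i h hN).twist (VeryFreeCurves.isCocycle_ratio 2))
      hD hnormal)
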